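/- Fix $\bar\alpha\in(0,1)$. Let $\mathscr{C}$ be the class of smooth functions $\Xi:\mathbb{R}\to(0,\infty)$ such that, with $A:=\Xi''+2\Xi'$: (i) $\Xi(-\infty):=\lim_{t\to-\infty}\Xi(t)$ exists and is finite, and there are constants $c_0>0$ and $M_0\in\mathbb{R}$ with $\Xi(t)=\Xi(-\infty)-c_0e^{2t}$ for all $t\le M_0$; (ii) there is a constant $c_1\in\mathbb{R}$ with $\Xi(t)=c_1e^{-2t}+\frac{1}{2-\bar\alpha}e^{-\bar\alpha t}$ for all $t\ge\ln 2$; (iii) $A$ has exactly two zeros $a<b$, and $A'(a)>0$, $A'(b)<0$; (iv) $\Xi'(t)<0$ for every $t\in\mathbb{R}$. For $\Xi\in\mathscr{C}$ and a real number $m>1$, let $\mathscr{U}_m$ be the set of all $z\in\mathbb{C}$ with $\operatorname{Im} z>0$ for which Rayleigh's stability equation $$-\varphi''(t)+m^2\varphi(t)+\frac{A(t)}{\Xi(t)-z}\,\varphi(t)=0$$ has a nontrivial solution $\varphi\in L^2\cap W^{2,2}_{\mathrm{loc}}(\mathbb{R},\mathbb{C})$. Theorem. There are a function $\Xi\in\mathscr{C}$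 and an integer $m_0\ge 2$ such that $\mathscr{U}_{m_0}$ is finite and nonempty. -/

import Mathlib

open Filter Topology MeasureTheory
open scoped ContDiff

noncomputable section

/-- The function `A = Ξ'' + 2 Ξ'` associated with the differential rotation `Ξ`
(in the logarithmic variable `t = log r`). -/
def rayleighA (Ξ : ℝ → ℝ) (t : ℝ) : ℝ :=
  deriv (deriv Ξ) t + 2 * deriv Ξ t

/-- The class `𝒞` of (smooth, positive) profiles `Ξ`, for the fixed decay exponent `α`. -/
structure ClassC (α : ℝ) (Ξ : ℝ → ℝ) : Prop where
  smooth : ContDiff ℝ ∞ Ξ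
  pos : ∀ t, 0 < Ξ t
  /-- `L` is the value `Ξ(-∞)`. -/
  near_neg_infty : ∃ L : ℝ, Tendsto Ξ atBot (𝓝 L) ∧
    ∃ c₀ M₀ : ℝ, 0 < c₀ ∧ ∀ t ≤ M₀, Ξ t = L - c₀ * Real.exp (2 * t)
  near_infty : ∃ c₁ : ℝ, ∀ t, Real.log 2 ≤ t →
    Ξ t = c₁ * Real.exp (-2 * t) + 1 / (2 - α) * Real.exp (-α * t)
  two_zeros : ∃ a b : ℝ, a < b ∧ (∀ t, rayleighA Ξ t = 0 ↔ t = a ∨ t = b) ∧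
    0 < deriv (rayleighA Ξ) a ∧ deriv (rayleighA Ξ) b < 0
  deriv_neg : ∀ t, deriv Ξ t < 0

/-- `v` is the weak derivative on `ℝ` of the function `u`. -/
def HasWeakDeriv (u v : ℝ → ℂ) : Prop :=
  LocallyIntegrable u ∧ LocallyIntegrable v ∧
    ∀ η : ℝ → ℝ, ContDiff ℝ ∞ η → HasCompactSupport η →
      ∫ t, deriv η t • u t = - ∫ t, η t • v t

/-- `f` belongs to `L²_loc(ℝ, ℂ)`. -/
def MemL2Loc (f : ℝ → ℂ) : Prop :=
  ∀ K : Set ℝ, IsCompact K → MemLp f 2 (volume.restrict K)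

/-- `φ ∈ W^{2,2}_loc(ℝ, ℂ)`, with first and second weak derivatives `φ₁` and `φ₂`. -/
def IsW22Loc (φ φ₁ φ₂ : ℝ → ℂ) : Prop :=
  HasWeakDeriv φ φ₁ ∧ HasWeakDeriv φ₁ φ₂ ∧ MemL2Loc φ ∧ MemL2Loc φ₁ ∧ MemL2Loc φ₂

/-- `φ ∈ L² ∩ W^{2,2}_loc(ℝ, ℂ)` solves Rayleigh's stability equation
`-φ'' + m² φ + A / (Ξ - z) φ = 0`. -/
def IsRayleighSolution (Ξ : ℝ → ℝ) (m : ℝ) (z : ℂ) (φ : ℝ → ℂ) : Prop :=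
  MemLp φ 2 volume ∧ ∃ φ₁ φ₂ : ℝ → ℂ, IsW22Loc φ φ₁ φ₂ ∧
    ∀ᵐ t : ℝ, -φ₂ t + (m : ℂ) ^ 2 * φ t + (rayleighA Ξ t : ℂ) / ((Ξ t : ℂ) - z) * φ t = 0

/-- The set `𝒰_m` of unstable parameters: those `z` with `Im z > 0` for which Rayleigh's
equation has a nontrivial solution. -/
def unstableSet (Ξ : ℝ → ℝ) (m : ℝ) : Set ℂ :=
  {z : ℂ | 0 < z.im ∧ ∃ φ : ℝ → ℂ, IsRayleighSolution Ξ m z φ ∧ ¬ φ =ᵐ[volume] 0}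

end

/-! The instance is `m₀ = 2`, and the profile is a smoothing of a vortex with two interfaces.
Finiteness and existence of unstable parameters are proved by unrelated means.

Finiteness. The function `A` has signs `-, +, -` and `Ξ` is strictly decreasing, so `A = -(Ξ - Ξ
a)(Ξ - Ξ b)ρ²` with `ρ` bounded and in `L²` (`exists_weight`). Let `M` be multiplication by `Ξ`, `P
= (M - Ξ a)(M - Ξ b)` and `K = ρ G ρ`, where `G` is the Green operator of `-d²/dt² + m²`. The
substitution `f = -ρ φ / (Ξ - z)` turns Rayleigh's equation into `(M - K P) f = z f`. The operator
`M - K P` is symmetric for the indefinite form `⟪P ·, ·⟫`, so the span of all its eigenvectors with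
`Im z > 0` is neutral for this form. Evaluating the form on `(M - K P - x₁) g` and `(M - K P - x₂)
g` gives `‖P g‖ ≤ D ‖K P g‖` on that span. Since `K` is Hilbert-Schmidt, Bessel's inequality bounds
the number of eigenvalues (`finite_upper_eigenvalues`, `finite_unstableSet`).

Existence. For `m = 2` write `φ = e^{-2t} v` with `v → 1` at `+∞`. Then `v` solves a Volterra
equation, and its limit `F(z)` at `-∞` is holomorphic in `z` (`exists_jost_solution`). A zero of `F`
in the upper half-plane makes `φ` decay at both ends (`mem_unstableSet_of_jost`). For the measure `A
= -δ_{t₁} + δ_{t₂}/4` with `e^{-2(t₂ - t₁)} = 3/8`, the function `F` is rational and vanishes at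
`1/8 + 3i/64` (`patchJost_mul`). Smooth densities weakly close to this measure have Jost functions
uniformly close to the rational one (`exists_norm_jost_sub_le`), so the zero persists by the maximum
principle (`exists_jost_zero`).

It remains to find such densities whose profiles lie in `ClassC`: two narrow bumps are added to a
small multiple of a background with the right signs and tails (`exists_isDensity_nearDeltas`). The
prescribed coefficient of the right tail is obtained by rescaling `Ξ`, which only rescales the
unstable set. -/

/-! ### The Green operator of `-d²/dt² + m²` and the integral form of weak solutions. -/

section Green

/-- The Green function `e^{-m|x|} / (2m)` of `-d²/dt² + m²`. -/
noncomputable def greenKernel (m x : ℝ) : ℝ := Real.exp (-m * |x|) / (2 * m)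

theorem continuous_greenKernel (m : ℝ) : Continuous (greenKernel m) := by
  unfold greenKernel; fun_prop

theorem greenKernel_nonneg {m : ℝ} (hm : 0 < m) (x : ℝ) : 0 ≤ greenKernel m x := by
  unfold greenKernel; positivity

theorem greenKernel_le {m : ℝ} (hm : 0 < m) (x : ℝ) : greenKernel m x ≤ 1 / (2 * m) := by
  unfold greenKernel
  gcongr
  rw [Real.exp_le_one_iff]
  nlinarith [abs_nonneg x]

theorem norm_greenKernel_le {m : ℝ} (hm : 0 < m) (x : ℝ) : ‖greenKernel m x‖ ≤ 1 / (2 * m) := by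
  rw [Real.norm_of_nonneg (greenKernel_nonneg hm x)]
  exact greenKernel_le hm x

theorem greenKernel_sub_comm (m x y : ℝ) : greenKernel m (x - y) = greenKernel m (y - x) := by
  unfold greenKernel; rw [abs_sub_comm]

theorem integrable_exp_neg_mul_abs {m : ℝ} (hm : 0 < m) :
    Integrable (fun t : ℝ => Real.exp (-m * |t|)) := by
  rw [← integrableOn_univ, ← Set.Iic_union_Ioi (a := (0 : ℝ))]
  refine IntegrableOn.union ?_ ?_
  · refine (integrableOn_exp_mul_Iic hm 0).congr_fun (fun t ht => ?_) measurableSet_Iic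
    simp only [abs_of_nonpos (Set.mem_Iic.1 ht)]
    ring_nf
  · refine (integrableOn_exp_mul_Ioi (neg_lt_zero.2 hm) 0).congr_fun (fun t ht => ?_)
      measurableSet_Ioi
    simp only [abs_of_pos (Set.mem_Ioi.1 ht)]

theorem memLp_exp_neg_mul_abs {m : ℝ} (hm : 0 < m) :
    MemLp (fun t : ℝ => Real.exp (-m * |t|)) 2 := by
  rw [memLp_two_iff_integrable_sq (by fun_prop)]
  refine (integrable_exp_neg_mul_abs (m := 2 * m) (by positivity)).congr (.of_forall fun t => ?_)
  simp only [← Real.exp_nat_mul]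
  congr 1
  push_cast
  ring

/-- Convolution with the Green function. -/
noncomputable def greenConv (m : ℝ) {F : Type*} [NormedAddCommGroup F] [NormedSpace ℝ F]
    (f : ℝ → F) (t : ℝ) : F := ∫ s, greenKernel m (t - s) • f s

theorem greenConv_eq_convolution (m : ℝ) (f : ℝ → ℝ) :
    greenConv m f = MeasureTheory.convolution (greenKernel m) f (ContinuousLinearMap.mul ℝ ℝ)
      volume := by
  ext t
  rw [convolution_eq_swap]
  rfl

theorem contDiff_greenConv (m : ℝ) {f : ℝ → ℝ} (hf : ContDiff ℝ ∞ f) (hc : HasCompactSupport f) :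
    ContDiff ℝ ∞ (greenConv m f) := by
  rw [greenConv_eq_convolution]
  exact hc.contDiff_convolution_right _ (continuous_greenKernel m).locallyIntegrable hf

theorem deriv_greenConv (m : ℝ) {f : ℝ → ℝ} (hf : ContDiff ℝ ∞ f) (hc : HasCompactSupport f) :
    deriv (greenConv m f) = greenConv m (deriv f) := by
  ext t
  rw [greenConv_eq_convolution, greenConv_eq_convolution]
  exact (hc.hasDerivAt_convolution_right _ (continuous_greenKernel m).locallyIntegrable
    (hf.of_le (by exact_mod_cast le_top)) t).deriv

/-- Follows from `|t| - |s| ≤ |t - s|`. This decay is what allows `greenConv m f`, which is not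
compactly supported, to serve as a test function. -/
theorem exists_abs_greenConv_le {m : ℝ} (hm : 0 < m) {f : ℝ → ℝ} (hf : Continuous f)
    (hc : HasCompactSupport f) : ∃ C, ∀ t, |greenConv m f t| ≤ C * Real.exp (-m * |t|) := by
  refine ⟨(∫ s, Real.exp (m * |s|) * |f s|) / (2 * m), fun t => ?_⟩
  have hint : Integrable fun s => Real.exp (m * |s|) * |f s| :=
    Continuous.integrable_of_hasCompactSupport (by fun_prop) (hc.abs.mul_left)
  unfold greenConv
  calc |∫ s, greenKernel m (t - s) • f s|
      ≤ ∫ s, (Real.exp (-m * |t|) / (2 * m)) * (Real.exp (m * |s|) * |f s|) := by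
        rw [← Real.norm_eq_abs]
        refine norm_integral_le_of_norm_le (hint.const_mul _) (.of_forall fun s => ?_)
        rw [norm_smul, Real.norm_of_nonneg (greenKernel_nonneg hm _), Real.norm_eq_abs, ← mul_assoc]
        gcongr
        unfold greenKernel
        rw [div_mul_eq_mul_div, ← Real.exp_add]
        gcongr
        nlinarith [abs_sub_abs_le_abs_sub t s]
    _ = _ := by
        rw [integral_const_mul]; ring

/-- An explicit primitive of `e^{k(s-t)} (f'' - k² f)`. With `k = m` and `k = -m` it integrates the
Green kernel against `f'' - m² f` on each side of its corner. -/
theorem exp_mul_deriv_sub_aux {f : ℝ → ℝ} (hf : ContDiff ℝ ∞ f) (hc : HasCompactSupport f)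
    (k t : ℝ) :
    ContDiff ℝ 1 (fun s => Real.exp (k * (s - t)) * (deriv f s - k * f s)) ∧
    HasCompactSupport (fun s => Real.exp (k * (s - t)) * (deriv f s - k * f s)) ∧
    ∀ s, deriv (fun s => Real.exp (k * (s - t)) * (deriv f s - k * f s)) s
        = Real.exp (k * (s - t)) * (deriv (deriv f) s - k ^ 2 * f s) := by
  have hf1 : ContDiff ℝ ∞ (deriv f) := (contDiff_infty_iff_deriv.1 hf).2
  refine ⟨?_, ?_, fun s => ?_⟩
  · have h1 : ContDiff ℝ 1 f := hf.of_le (by exact_mod_cast le_top)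
    have h2 : ContDiff ℝ 1 (deriv f) := hf1.of_le (by exact_mod_cast le_top)
    fun_prop
  · have h1 : HasCompactSupport fun s => k * f s := hc.mul_left
    exact HasCompactSupport.mul_left (hc.deriv.sub h1)
  · have hd0 : HasDerivAt f (deriv f s) s := (hf.differentiable (by simp) s).hasDerivAt
    have hd1 : HasDerivAt (deriv f) (deriv (deriv f) s) s :=
      (hf1.differentiable (by simp) s).hasDerivAt
    have h1 : HasDerivAt (fun s => Real.exp (k * (s - t))) (Real.exp (k * (s - t)) * k) s := by
      simpa using (((hasDerivAt_id s).sub_const t).const_mul k).exp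
    refine (HasDerivAt.deriv (h1.mul (hd1.sub (hd0.const_mul k)))).trans ?_
    simp only [Pi.sub_apply]
    ring

/-- Split the integral at `s = t`: each half is a boundary value, the `f'` terms cancel, and the
jump of the kernel's derivative leaves `-f t`. -/
theorem greenConv_deriv_deriv {m : ℝ} (hm : 0 < m) {f : ℝ → ℝ} (hf : ContDiff ℝ ∞ f)
    (hc : HasCompactSupport f) (t : ℝ) :
    greenConv m (deriv (deriv f)) t = m ^ 2 * greenConv m f t - f t := by
  have hf1 : ContDiff ℝ ∞ (deriv f) := (contDiff_infty_iff_deriv.1 hf).2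
  have hf2 : ContDiff ℝ ∞ (deriv (deriv f)) := (contDiff_infty_iff_deriv.1 hf1).2
  have hi : ∀ g : ℝ → ℝ, Continuous g → HasCompactSupport g →
      Integrable fun s => greenKernel m (t - s) * g s := fun g hg hgc =>
    Continuous.integrable_of_hasCompactSupport
      (((continuous_greenKernel m).comp (by fun_prop)).mul hg) hgc.mul_left
  have i0 := hi f hf.continuous hc
  have i2 := hi _ hf2.continuous hc.deriv.deriv
  have hsub : greenConv m (deriv (deriv f)) t - m ^ 2 * greenConv m f t
      = ∫ s, greenKernel m (t - s) * (deriv (deriv f) s - m ^ 2 * f s) := by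
    unfold greenConv
    simp only [smul_eq_mul]
    rw [← integral_const_mul, ← integral_sub i2 (i0.const_mul _)]
    congr 1 with s
    ring
  have hint : Integrable fun s => greenKernel m (t - s) * (deriv (deriv f) s - m ^ 2 * f s) := by
    refine (i2.sub (i0.const_mul (m ^ 2))).congr (.of_forall fun s => ?_)
    simp only [Pi.sub_apply]
    ring
  have hIic : ∫ s in Set.Iic t, greenKernel m (t - s) * (deriv (deriv f) s - m ^ 2 * f s)
      = (deriv f t - m * f t) / (2 * m) := by
    obtain ⟨h1, h2, h3⟩ := exp_mul_deriv_sub_aux hf hc m t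
    have h4 := h2.integral_Iic_deriv_eq h1 t
    simp only [sub_self, mul_zero, Real.exp_zero, one_mul] at h4
    rw [← h4, ← integral_div]
    refine setIntegral_congr_fun measurableSet_Iic fun s hs => ?_
    simp only [h3 s, greenKernel, abs_of_nonneg (sub_nonneg.2 (Set.mem_Iic.1 hs))]
    rw [show -m * (t - s) = m * (s - t) by ring]
    ring
  have hIoi : ∫ s in Set.Ioi t, greenKernel m (t - s) * (deriv (deriv f) s - m ^ 2 * f s)
      = -(deriv f t + m * f t) / (2 * m) := by
    obtain ⟨h1, h2, h3⟩ := exp_mul_deriv_sub_aux hf hc (-m) t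
    have h4 := h2.integral_Ioi_deriv_eq h1 t
    simp only [sub_self, mul_zero, Real.exp_zero, one_mul, neg_mul, sub_neg_eq_add] at h4
    rw [← h4, ← integral_div]
    refine setIntegral_congr_fun measurableSet_Ioi fun s hs => ?_
    have := h3 s
    simp only [neg_mul, sub_neg_eq_add] at this
    simp only [this, greenKernel, abs_of_neg (sub_neg.2 (Set.mem_Ioi.1 hs))]
    rw [show -m * -(t - s) = -(m * (s - t)) by ring]
    ring
  have h5 := integral_add_compl (measurableSet_Iic (a := t)) hint
  rw [Set.compl_Iic, hIic, hIoi, ← hsub] at h5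
  have h6 : (deriv f t - m * f t) / (2 * m) + -(deriv f t + m * f t) / (2 * m) = -f t := by
    field_simp; ring
  linarith

/-- A weak identity `∫ η'' φ = ∫ η ψ` extends from compactly supported test functions to
exponentially decaying ones. -/
theorem integral_deriv_deriv_smul_of_decay {φ ψ : ℝ → ℂ} (hφ : MemLp φ 2) (hψ : MemLp ψ 2)
    (hw : ∀ η : ℝ → ℝ, ContDiff ℝ ∞ η → HasCompactSupport η →
      ∫ t, deriv (deriv η) t • φ t = ∫ t, η t • ψ t)
    {m C : ℝ} (hm : 0 < m) {h : ℝ → ℝ} (hh : ContDiff ℝ ∞ h)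
    (h0 : ∀ t, |h t| ≤ C * Real.exp (-m * |t|)) (h1 : ∀ t, |deriv h t| ≤ C * Real.exp (-m * |t|))
    (h2 : ∀ t, |deriv (deriv h) t| ≤ C * Real.exp (-m * |t|)) :
    ∫ t, deriv (deriv h) t • φ t = ∫ t, h t • ψ t := by
  have hh1 : ContDiff ℝ ∞ (deriv h) := (contDiff_infty_iff_deriv.1 hh).2
  have hh2 : ContDiff ℝ ∞ (deriv (deriv h)) := (contDiff_infty_iff_deriv.1 hh1).2
  have hdh : ∀ s, HasDerivAt h (deriv h s) s := fun s => (hh.differentiable (by simp) s).hasDerivAt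
  have hdh1 : ∀ s, HasDerivAt (deriv h) (deriv (deriv h) s) s :=
    fun s => (hh1.differentiable (by simp) s).hasDerivAt
  -- The test functions are `χ(t / (n + 1)) h(t)`. Derivatives falling on the cutoff carry factors
  -- `r n → 0`, and the decay of `h` paired with an `L²` function gives an integrable majorant.
  let χ : ContDiffBump (0 : ℝ) := ⟨1, 2, by norm_num, by norm_num⟩
  have c0 : ContDiff ℝ ∞ χ := χ.contDiff
  have c1 : ContDiff ℝ ∞ (deriv χ) := (contDiff_infty_iff_deriv.1 c0).2
  have c2 : ContDiff ℝ ∞ (deriv (deriv χ)) := (contDiff_infty_iff_deriv.1 c1).2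
  have k0 : HasCompactSupport χ := χ.hasCompactSupport
  obtain ⟨B0, hB0⟩ := c0.continuous.bounded_above_of_compact_support k0
  obtain ⟨B1, hB1⟩ := c1.continuous.bounded_above_of_compact_support k0.deriv
  obtain ⟨B2, hB2⟩ := c2.continuous.bounded_above_of_compact_support k0.deriv.deriv
  have hB0' : 0 ≤ B0 := (norm_nonneg _).trans (hB0 0)
  have hB1' : 0 ≤ B1 := (norm_nonneg _).trans (hB1 0)
  have hB2' : 0 ≤ B2 := (norm_nonneg _).trans (hB2 0)
  have hC : 0 ≤ C := by simpa using (abs_nonneg _).trans (h0 0)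
  have hE := memLp_exp_neg_mul_abs hm
  let r : ℕ → ℝ := fun n => 1 / ((n : ℝ) + 1)
  have hr : Tendsto r atTop (𝓝 0) := tendsto_one_div_add_atTop_nhds_zero_nat
  have hr0 : ∀ n, 0 ≤ r n := fun n => by positivity
  have hr1 : ∀ n, r n ≤ 1 := fun n => by
    rw [div_le_one (by positivity)]; linarith [n.cast_nonneg (α := ℝ)]
  let η : ℕ → ℝ → ℝ := fun n t => χ (r n * t) * h t
  have hηs : ∀ n, ContDiff ℝ ∞ (η n) := fun n =>
    (c0.comp (contDiff_const.mul contDiff_id)).mul hh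
  have hηc : ∀ n, HasCompactSupport (η n) := by
    intro n
    have hne : r n ≠ 0 := by positivity
    exact (k0.comp_homeomorph (Homeomorph.mulLeft₀ (r n) hne)).mul_right
  have hχd : ∀ (g : ℝ → ℝ), ContDiff ℝ ∞ g → ∀ n t, HasDerivAt (fun t => g (r n * t))
      (r n * deriv g (r n * t)) t := by
    intro g hg n t
    have := (hg.differentiable (by simp) (r n * t)).hasDerivAt.comp t
      ((hasDerivAt_id t).const_mul (r n))
    exact this.congr_deriv (by ring)
  have hd1 : ∀ n, deriv (η n) = fun t => r n * deriv χ (r n * t) * h t + χ (r n * t) * deriv h t :=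
    fun n => funext fun t => ((hχd _ c0 n t).mul (hdh t)).deriv
  have hd2 : ∀ n t, deriv (deriv (η n)) t = r n * (r n * deriv (deriv χ) (r n * t)) * h t
      + r n * deriv χ (r n * t) * deriv h t + (r n * deriv χ (r n * t) * deriv h t
        + χ (r n * t) * deriv (deriv h) t) := by
    intro n t
    rw [hd1 n]
    exact ((((hχd _ c1 n t).const_mul (r n)).mul (hdh t)).add
      ((hχd _ c0 n t).mul (hdh1 t))).deriv
  have hχ1 : ∀ t, ∀ᶠ n in atTop, χ (r n * t) = 1 := by
    intro t
    have : Tendsto (fun n => r n * t) atTop (𝓝 0) := by simpa using hr.mul_const t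
    filter_upwards [this (Metric.closedBall_mem_nhds 0 one_pos)] with n hn
    exact χ.one_of_mem_closedBall hn
  have L1 : Tendsto (fun n => ∫ t, deriv (deriv (η n)) t • φ t) atTop
      (𝓝 (∫ t, deriv (deriv h) t • φ t)) := by
    refine tendsto_integral_of_dominated_convergence
      (fun t => (B2 + B1 + (B1 + B0)) * C * (Real.exp (-m * |t|) * ‖φ t‖)) (fun n => ?_) ?_
      (fun n => .of_forall fun t => ?_) (.of_forall fun t => ?_)
    · have := (contDiff_infty_iff_deriv.1 (contDiff_infty_iff_deriv.1 (hηs n)).2).2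
      exact this.continuous.aestronglyMeasurable.smul hφ.1
    · exact (hE.integrable_mul hφ.norm).const_mul _
    · rw [norm_smul, hd2, Real.norm_eq_abs, ← mul_assoc ((B2 + B1 + (B1 + B0)) * C)]
      gcongr
      have e1 : |r n * (r n * deriv (deriv χ) (r n * t)) * h t|
          ≤ B2 * (C * Real.exp (-m * |t|)) := by
        rw [abs_mul]
        gcongr
        · rw [abs_mul, abs_mul, abs_of_nonneg (hr0 n)]
          calc r n * (r n * |deriv (deriv χ) (r n * t)|) ≤ 1 * (1 * B2) := by
                gcongr
                · exact hr1 n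
                · exact hr1 n
                · exact hB2 _
            _ = B2 := by ring
        · exact h0 t
      have e2 : |r n * deriv χ (r n * t) * deriv h t| ≤ B1 * (C * Real.exp (-m * |t|)) := by
        rw [abs_mul]
        gcongr
        · rw [abs_mul, abs_of_nonneg (hr0 n)]
          calc r n * |deriv χ (r n * t)| ≤ 1 * B1 := by
                gcongr
                · exact hr1 n
                · exact hB1 _
            _ = B1 := by ring
        · exact h1 t
      have e3 : |χ (r n * t) * deriv (deriv h) t| ≤ B0 * (C * Real.exp (-m * |t|)) := by
        rw [abs_mul]
        gcongr
        · exact hB0 _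
        · exact h2 t
      refine (abs_add_le _ _).trans ((add_le_add (abs_add_le _ _) (abs_add_le _ _)).trans ?_)
      linarith
    · refine Tendsto.smul ?_ tendsto_const_nhds
      simp only [hd2]
      have b2 : Tendsto (fun n => r n * (r n * deriv (deriv χ) (r n * t)) * h t) atTop (𝓝 0) := by
        have : Tendsto (fun n => r n * (r n * deriv (deriv χ) (r n * t)) * h t) atTop
            (𝓝 (0 * (0 * deriv (deriv χ) (0 * t)) * h t)) :=
          (hr.mul (hr.mul ((c2.continuous.tendsto _).comp (hr.mul_const t)))).mul_const _
        simpa using this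
      have b1 : Tendsto (fun n => r n * deriv χ (r n * t) * deriv h t) atTop (𝓝 0) := by
        have : Tendsto (fun n => r n * deriv χ (r n * t) * deriv h t) atTop
            (𝓝 (0 * deriv χ (0 * t) * deriv h t)) :=
          (hr.mul ((c1.continuous.tendsto _).comp (hr.mul_const t))).mul_const _
        simpa using this
      have b0 : Tendsto (fun n => χ (r n * t) * deriv (deriv h) t) atTop
          (𝓝 (deriv (deriv h) t)) := by
        refine tendsto_const_nhds.congr' ?_
        filter_upwards [hχ1 t] with n hn
        rw [hn, one_mul]
      simpa using (b2.add b1).add (b1.add b0)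
  have L2 : Tendsto (fun n => ∫ t, η n t • ψ t) atTop (𝓝 (∫ t, h t • ψ t)) := by
    refine tendsto_integral_of_dominated_convergence
      (fun t => B0 * C * (Real.exp (-m * |t|) * ‖ψ t‖)) (fun n => ?_) ?_
      (fun n => .of_forall fun t => ?_) (.of_forall fun t => ?_)
    · exact (hηs n).continuous.aestronglyMeasurable.smul hψ.1
    · exact (hE.integrable_mul hψ.norm).const_mul _
    · rw [norm_smul, ← mul_assoc]
      gcongr
      rw [Real.norm_eq_abs, abs_mul, mul_assoc]
      gcongr
      · exact hB0 _
      · exact h0 t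
    · refine tendsto_const_nhds.congr' ?_
      filter_upwards [hχ1 t] with n hn
      simp only [η, hn, one_mul]
  refine tendsto_nhds_unique L1 (L2.congr fun n => ?_)
  exact (hw _ (hηs n) (hηc n)).symm

theorem continuous_greenConv {m : ℝ} (hm : 0 < m) {u : ℝ → ℂ} (hu : Integrable u) :
    Continuous (greenConv m u) := by
  refine continuous_of_dominated (bound := fun s => 1 / (2 * m) * ‖u s‖) (fun t => ?_)
    (fun t => .of_forall fun s => ?_) (hu.norm.const_mul _) (.of_forall fun s => ?_)
  · exact ((continuous_greenKernel m).comp (by fun_prop)).aestronglyMeasurable.smul hu.1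
  · rw [norm_smul]
    gcongr
    exact norm_greenKernel_le hm _
  · exact ((continuous_greenKernel m).comp (by fun_prop)).smul continuous_const

/-- The `L²` weak solution of `-φ'' + m² φ + w = 0` is `-G * w`. -/
theorem ae_eq_neg_greenConv {m : ℝ} (hm : 0 < m) {φ w : ℝ → ℂ} (hφ : MemLp φ 2) (hw2 : MemLp w 2)
    (hw1 : Integrable w)
    (hweak : ∀ η : ℝ → ℝ, ContDiff ℝ ∞ η → HasCompactSupport η →
      ∫ t, deriv (deriv η) t • φ t = ∫ t, η t • ((m : ℂ) ^ 2 * φ t + w t)) :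
    ∀ᵐ t, φ t = -greenConv m w t := by
  have hcont : Continuous (greenConv m w) := continuous_greenConv hm hw1
  have hli : LocallyIntegrable (fun t => φ t + greenConv m w t) :=
    (hφ.locallyIntegrable (by norm_num)).add hcont.locallyIntegrable
  -- Duality: testing the weak equation with `G f` moves `-d²/dt² + m²` back onto `f`, so `φ + G w`
  -- is orthogonal to every test function.
  have key : ∀ f : ℝ → ℝ, ContDiff ℝ ∞ f → HasCompactSupport f →
      ∫ t, f t • (φ t + greenConv m w t) = 0 := by
    intro f hf hc
    have hf1 : ContDiff ℝ ∞ (deriv f) := (contDiff_infty_iff_deriv.1 hf).2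
    have hf2 : ContDiff ℝ ∞ (deriv (deriv f)) := (contDiff_infty_iff_deriv.1 hf1).2
    have hs := contDiff_greenConv m hf hc
    have hg1 : deriv (greenConv m f) = greenConv m (deriv f) := deriv_greenConv m hf hc
    have hg2 : deriv (deriv (greenConv m f)) = greenConv m (deriv (deriv f)) := by
      rw [hg1, deriv_greenConv m hf1 hc.deriv]
    obtain ⟨C0, hC0⟩ := exists_abs_greenConv_le hm hf.continuous hc
    obtain ⟨C1, hC1⟩ := exists_abs_greenConv_le hm hf1.continuous hc.deriv
    obtain ⟨C2, hC2⟩ := exists_abs_greenConv_le hm hf2.continuous hc.deriv.deriv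
    have hψ : MemLp (fun t => (m : ℂ) ^ 2 * φ t + w t) 2 := (hφ.const_mul _).add hw2
    have h1 := integral_deriv_deriv_smul_of_decay (C := max C0 (max C1 C2)) hφ hψ hweak hm hs
      (fun t => (hC0 t).trans (by gcongr; exact le_max_left _ _))
      (fun t => by
        rw [hg1]
        exact (hC1 t).trans (by gcongr; exact (le_max_left _ _).trans (le_max_right _ _)))
      (fun t => by
        rw [hg2]
        exact (hC2 t).trans (by gcongr; exact (le_max_right _ _).trans (le_max_right _ _)))
    have hgm : MemLp (greenConv m f) 2 := by
      refine ((memLp_exp_neg_mul_abs hm).const_mul C0).mono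
        hs.continuous.aestronglyMeasurable (.of_forall fun t => ?_)
      exact (hC0 t).trans (le_abs_self _)
    have i1 : Integrable fun t => greenConv m f t • φ t := memLp_one_iff_integrable.1 (hφ.smul hgm)
    have i2 : Integrable fun t => greenConv m f t • w t := memLp_one_iff_integrable.1 (hw2.smul hgm)
    have i3 : Integrable fun t => f t • φ t :=
      memLp_one_iff_integrable.1
        (hφ.smul (hf.continuous.memLp_of_hasCompactSupport (p := 2) hc))
    have i4 : Integrable fun t => f t • greenConv m w t :=
      (hf.continuous.smul hcont).integrable_of_hasCompactSupport hc.smul_right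
    have e1 : ∫ t, deriv (deriv (greenConv m f)) t • φ t
        = (∫ t, (m : ℂ) ^ 2 * greenConv m f t • φ t) - ∫ t, f t • φ t := by
      rw [← integral_sub (i1.const_mul _) i3]
      congr 1 with t
      rw [hg2, greenConv_deriv_deriv hm hf hc]
      simp only [Complex.real_smul]
      push_cast
      ring
    have e2 : ∫ t, greenConv m f t • ((m : ℂ) ^ 2 * φ t + w t)
        = (∫ t, (m : ℂ) ^ 2 * greenConv m f t • φ t) + ∫ t, greenConv m f t • w t := by
      rw [← integral_add (i1.const_mul _) i2]
      congr 1 with t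
      simp only [Complex.real_smul]
      ring
    have e3 : ∫ t, greenConv m f t • w t = ∫ t, f t • greenConv m w t := by
      have hfint : Integrable f := hf.continuous.integrable_of_hasCompactSupport hc
      have hprod : Integrable (Function.uncurry fun t s => (greenKernel m (t - s) * f s) • w t)
          (volume.prod volume) := by
        have := (hw1.mul_prod (hfint.ofReal (𝕜 := ℂ))).bdd_mul (c := 1 / (2 * m))
          (f := fun p : ℝ × ℝ => ((greenKernel m (p.1 - p.2) : ℝ) : ℂ))
          (Complex.continuous_ofReal.comp
            ((continuous_greenKernel m).comp (by fun_prop))).aestronglyMeasurable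
          (.of_forall fun p => by rw [Complex.norm_real]; exact norm_greenKernel_le hm _)
        refine this.congr (.of_forall fun p => ?_)
        simp only [Function.uncurry, Complex.real_smul]
        push_cast
        ring_nf
        rfl
      calc ∫ t, greenConv m f t • w t = ∫ t, ∫ s, (greenKernel m (t - s) * f s) • w t := by
            congr 1 with t
            rw [integral_smul_const]
            rfl
        _ = ∫ s, ∫ t, (greenKernel m (t - s) * f s) • w t := integral_integral_swap hprod
        _ = ∫ s, f s • greenConv m w s := by
            congr 1 with s
            unfold greenConv
            rw [← integral_smul]
            congr 1 with t
            rw [greenKernel_sub_comm, mul_comm, mul_smul]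
    have e4 : ∫ t, f t • (φ t + greenConv m w t)
        = (∫ t, f t • φ t) + ∫ t, f t • greenConv m w t := by
      rw [← integral_add i3 i4]
      simp only [smul_add]
    rw [e4, ← e3]
    rw [e1, e2] at h1
    linear_combination -h1
  filter_upwards [ae_eq_zero_of_integral_contDiff_smul_eq_zero hli key] with t ht
  exact eq_neg_of_add_eq_zero_left ht

end Green

/-! ### Symmetric operators for an indefinite form: finitely many nonreal eigenvalues. -/

section KreinForm

variable {H : Type*} [NormedAddCommGroup H] [InnerProductSpace ℂ H]

/-- The quadratic polynomial `(M - x₁) (M - x₂)` in a bounded operator `M`. -/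
noncomputable def quadOp (M : H →L[ℂ] H) (x₁ x₂ : ℝ) : H →L[ℂ] H :=
  (M - (x₁ : ℂ) • ContinuousLinearMap.id ℂ H) ∘L (M - (x₂ : ℂ) • ContinuousLinearMap.id ℂ H)

theorem quadOp_apply (M : H →L[ℂ] H) (x₁ x₂ : ℝ) (f : H) :
    quadOp M x₁ x₂ f = M (M f) - (x₁ + x₂ : ℂ) • M f + (x₁ * x₂ : ℂ) • f := by
  simp only [quadOp, ContinuousLinearMap.comp_apply, sub_apply,
    smul_apply, ContinuousLinearMap.id_apply, map_sub, map_smul]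
  module

theorem quadOp_comm (M : H →L[ℂ] H) (x₁ x₂ : ℝ) (f : H) :
    quadOp M x₁ x₂ (M f) = M (quadOp M x₁ x₂ f) := by
  simp only [quadOp_apply, map_add, map_sub, map_smul]

theorem quadOp_symm {M : H →L[ℂ] H} (hM : ∀ f g, inner ℂ (M f) g = inner ℂ f (M g))
    (x₁ x₂ : ℝ) (f g : H) :
    inner ℂ (quadOp M x₁ x₂ f) g = inner ℂ f (quadOp M x₁ x₂ g) := by
  simp only [quadOp_apply, inner_add_left, inner_add_right, inner_sub_left, inner_sub_right,
    inner_smul_left, inner_smul_right, hM]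
  simp

/-- Eigenvectors of `M - K P` for eigenvalues in the upper half-plane are mutually neutral for the
form `⟪P ·, ·⟫`. -/
theorem inner_quadOp_eigen_eq_zero {M K : H →L[ℂ] H}
    (hM : ∀ f g, inner ℂ (M f) g = inner ℂ f (M g))
    (hK : ∀ f g, inner ℂ (K f) g = inner ℂ f (K g)) (x₁ x₂ : ℝ) {z w : ℂ} (hz : 0 < z.im)
    (hw : 0 < w.im) {f g : H} (hf : M f - K (quadOp M x₁ x₂ f) = z • f)
    (hg : M g - K (quadOp M x₁ x₂ g) = w • g) :
    inner ℂ (quadOp M x₁ x₂ f) g = 0 := by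
  -- `P (M - K P)` is symmetric, because `P` commutes with `M`.
  have h1 : inner ℂ (quadOp M x₁ x₂ (z • f)) g = inner ℂ (quadOp M x₁ x₂ f) (w • g) := by
    rw [← hf, ← hg, map_sub, inner_sub_left, inner_sub_right, quadOp_comm, hM,
      quadOp_symm hM _ _ (K _), hK]
  rw [map_smul, inner_smul_left, inner_smul_right] at h1
  -- Both imaginary parts are positive, so `conj z ≠ w`. This covers `z = w`, so each eigenvector is
  -- itself neutral.
  have h2 : ((starRingEnd ℂ) z - w) * inner ℂ (quadOp M x₁ x₂ f) g = 0 := by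
    rw [sub_mul, h1, sub_self]
  rcases mul_eq_zero.1 h2 with h | h
  · have := congrArg Complex.im h
    simp at this
    linarith
  · exact h

theorem inner_sub_smul_symm {M : H →L[ℂ] H} (hM : ∀ f g, inner ℂ (M f) g = inner ℂ f (M g))
    (x : ℝ) (f g : H) :
    inner ℂ (M f - (x : ℂ) • f) g = inner ℂ f (M g - (x : ℂ) • g) := by
  simp only [inner_sub_left, inner_sub_right, inner_smul_left, inner_smul_right, hM,
    Complex.conj_ofReal]

/-- The factorization of `P` is used here: the part of the form free of `K` is `⟪P (M - x₁) f, (M -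
x₂) f⟫ = ⟪P f, (M - x₁)(M - x₂) f⟫ = ‖P f‖²`. Every other term contains `K P f`. -/
theorem norm_sq_quadOp_eq {M K : H →L[ℂ] H}
    (hM : ∀ f g, inner ℂ (M f) g = inner ℂ f (M g)) (x₁ x₂ : ℝ) (f : H)
    (h : inner ℂ (quadOp M x₁ x₂ (M f - K (quadOp M x₁ x₂ f) - (x₁ : ℂ) • f))
      (M f - K (quadOp M x₁ x₂ f) - (x₂ : ℂ) • f) = 0) :
    (‖quadOp M x₁ x₂ f‖ ^ 2 : ℂ) =
      inner ℂ (M (quadOp M x₁ x₂ f) - (x₁ : ℂ) • quadOp M x₁ x₂ f) (K (quadOp M x₁ x₂ f)) +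
      inner ℂ (K (quadOp M x₁ x₂ f)) (M (quadOp M x₁ x₂ f) - (x₂ : ℂ) • quadOp M x₁ x₂ f) -
      inner ℂ (quadOp M x₁ x₂ (K (quadOp M x₁ x₂ f))) (K (quadOp M x₁ x₂ f)) := by
  have hc : ∀ x : ℝ, quadOp M x₁ x₂ (M f - (x : ℂ) • f)
      = M (quadOp M x₁ x₂ f) - (x : ℂ) • quadOp M x₁ x₂ f := by
    intro x
    rw [map_sub, map_smul, quadOp_comm]
  have h4 : M (M f - (x₂ : ℂ) • f) - (x₁ : ℂ) • (M f - (x₂ : ℂ) • f) = quadOp M x₁ x₂ f := by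
    simp only [quadOp_apply, map_sub, map_smul]
    module
  have h5 : inner ℂ (quadOp M x₁ x₂ f) (quadOp M x₁ x₂ f)
      = (‖quadOp M x₁ x₂ f‖ ^ 2 : ℂ) := inner_self_eq_norm_sq_to_K _
  have h6 : inner ℂ (M (quadOp M x₁ x₂ f) - (x₁ : ℂ) • quadOp M x₁ x₂ f) (M f - (x₂ : ℂ) • f)
      = (‖quadOp M x₁ x₂ f‖ ^ 2 : ℂ) := by
    rw [inner_sub_smul_symm hM, h4, h5]
  have h7 : inner ℂ (quadOp M x₁ x₂ (K (quadOp M x₁ x₂ f))) (M f - (x₂ : ℂ) • f)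
      = inner ℂ (K (quadOp M x₁ x₂ f))
        (M (quadOp M x₁ x₂ f) - (x₂ : ℂ) • quadOp M x₁ x₂ f) := by
    rw [quadOp_symm hM, hc]
  rw [sub_right_comm (M f) _ ((x₁ : ℂ) • f), sub_right_comm (M f) _ ((x₂ : ℂ) • f), map_sub, hc,
    inner_sub_left, inner_sub_right _ _ (K _), inner_sub_right _ _ (K _), h6, h7] at h
  linear_combination h

/-- A subspace spanned by eigenvectors with eigenvalues in the upper half-plane is bounded below by
the perturbation `K`. -/
theorem norm_quadOp_le_of_mem_span {M K : H →L[ℂ] H}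
    (hM : ∀ f g, inner ℂ (M f) g = inner ℂ f (M g))
    (hK : ∀ f g, inner ℂ (K f) g = inner ℂ f (K g)) (x₁ x₂ : ℝ) {ι : Type*} (z : ι → ℂ) (f : ι → H)
    (hz : ∀ i, 0 < (z i).im)
    (hf : ∀ i, M (f i) - K (quadOp M x₁ x₂ (f i)) = z i • f i) {g : H}
    (hg : g ∈ Submodule.span ℂ (Set.range f)) :
    ‖quadOp M x₁ x₂ g‖ ≤
      (‖M‖ + |x₁| + (‖M‖ + |x₂|) + ‖quadOp M x₁ x₂‖ * ‖K‖) * ‖K (quadOp M x₁ x₂ g)‖ := by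
  -- On eigenvectors `M - K P - x` acts as a scalar, so neutrality reduces to pairs of eigenvectors;
  -- sesquilinearity extends it to the span.
  have key : ∀ g ∈ Submodule.span ℂ (Set.range f), ∀ h ∈ Submodule.span ℂ (Set.range f),
      inner ℂ (quadOp M x₁ x₂ (M g - K (quadOp M x₁ x₂ g) - (x₁ : ℂ) • g))
      (M h - K (quadOp M x₁ x₂ h) - (x₂ : ℂ) • h) = 0 := by
    intro g hg h hh
    induction hg using Submodule.span_induction with
    | mem g hg =>
      induction hh using Submodule.span_induction with
      | mem h hh =>
        obtain ⟨i, rfl⟩ := hg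
        obtain ⟨j, rfl⟩ := hh
        rw [hf, hf, ← sub_smul, ← sub_smul, map_smul, inner_smul_left, inner_smul_right,
          inner_quadOp_eigen_eq_zero hM hK x₁ x₂ (hz i) (hz j) (hf i) (hf j)]
        simp
      | zero => simp
      | add a b _ _ ha hb =>
        have : M (a + b) - K (quadOp M x₁ x₂ (a + b)) - (x₂ : ℂ) • (a + b)
          = (M a - K (quadOp M x₁ x₂ a) - (x₂ : ℂ) • a)
            + (M b - K (quadOp M x₁ x₂ b) - (x₂ : ℂ) • b) := by
          simp only [map_add, smul_add]; abel
        rw [this, inner_add_right, ha, hb, add_zero]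
      | smul c a _ ha =>
        have : M (c • a) - K (quadOp M x₁ x₂ (c • a)) - (x₂ : ℂ) • (c • a)
          = c • (M a - K (quadOp M x₁ x₂ a) - (x₂ : ℂ) • a) := by
          simp only [map_smul, smul_sub, smul_comm c]
        rw [this, inner_smul_right, ha, mul_zero]
    | zero => simp
    | add a b _ _ ha hb =>
      have : M (a + b) - K (quadOp M x₁ x₂ (a + b)) - (x₁ : ℂ) • (a + b)
        = (M a - K (quadOp M x₁ x₂ a) - (x₁ : ℂ) • a)
          + (M b - K (quadOp M x₁ x₂ b) - (x₁ : ℂ) • b) := by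
        simp only [map_add, smul_add]; abel
      rw [this, map_add, inner_add_left, ha, hb, add_zero]
    | smul c a _ ha =>
      have : M (c • a) - K (quadOp M x₁ x₂ (c • a)) - (x₁ : ℂ) • (c • a)
        = c • (M a - K (quadOp M x₁ x₂ a) - (x₁ : ℂ) • a) := by
        simp only [map_smul, smul_sub, smul_comm c]
      rw [this, map_smul, inner_smul_left, ha, mul_zero]
  have h1 := norm_sq_quadOp_eq hM x₁ x₂ g (key g hg g hg)
  set e := quadOp M x₁ x₂ g
  have hb : ∀ x : ℝ, ‖M e - (x : ℂ) • e‖ ≤ (‖M‖ + |x|) * ‖e‖ := by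
    intro x
    calc ‖M e - (x : ℂ) • e‖ ≤ ‖M e‖ + ‖(x : ℂ) • e‖ := norm_sub_le _ _
      _ ≤ ‖M‖ * ‖e‖ + |x| * ‖e‖ := by
        gcongr
        · exact M.le_opNorm e
        · rw [norm_smul, Complex.norm_real, Real.norm_eq_abs]
      _ = _ := by ring
  have h2 : ‖e‖ ^ 2 ≤ (‖M‖ + |x₁| + (‖M‖ + |x₂|) + ‖quadOp M x₁ x₂‖ * ‖K‖) * ‖K e‖ * ‖e‖ := by
    have : ‖e‖ ^ 2 = ‖(‖e‖ ^ 2 : ℂ)‖ := by simp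
    rw [this, h1]
    calc _ ≤ ‖M e - (x₁ : ℂ) • e‖ * ‖K e‖ + ‖K e‖ * ‖M e - (x₂ : ℂ) • e‖
          + ‖quadOp M x₁ x₂ (K e)‖ * ‖K e‖ := by
          refine (norm_sub_le _ _).trans (add_le_add ((norm_add_le _ _).trans (add_le_add ?_ ?_)) ?_)
            <;> exact norm_inner_le_norm _ _
      _ ≤ ((‖M‖ + |x₁|) * ‖e‖) * ‖K e‖ + ‖K e‖ * ((‖M‖ + |x₂|) * ‖e‖)
          + (‖quadOp M x₁ x₂‖ * (‖K‖ * ‖e‖)) * ‖K e‖ := by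
          gcongr
          · exact hb _
          · exact hb _
          · exact ((quadOp M x₁ x₂).le_opNorm _).trans (by gcongr; exact K.le_opNorm e)
      _ = _ := by ring
  rcases (norm_nonneg e).eq_or_lt with h0 | h0
  · rw [← h0]; positivity
  · rw [sq] at h2
    exact le_of_mul_le_mul_right h2 h0

/-- If `M`, `K` are bounded and symmetric and `K` is Hilbert-Schmidt, then `M - K P`, with
`P = (M - x₁) (M - x₂)`, has only finitely many eigenvalues in the upper half-plane with an
eigenvector outside the kernel of `P`. -/
theorem finite_upper_eigenvalues {M K : H →L[ℂ] H}
    (hM : ∀ f g, inner ℂ (M f) g = inner ℂ f (M g))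
    (hK : ∀ f g, inner ℂ (K f) g = inner ℂ f (K g)) (x₁ x₂ C : ℝ)
    (hC : ∀ (n : ℕ) (e : Fin n → H), Orthonormal ℂ e → ∑ i, ‖K (e i)‖ ^ 2 ≤ C) :
    {z : ℂ | 0 < z.im ∧ ∃ f, quadOp M x₁ x₂ f ≠ 0 ∧
      M f - K (quadOp M x₁ x₂ f) = z • f}.Finite := by
  set P := quadOp M x₁ x₂ with hP
  set D : ℝ := ‖M‖ + |x₁| + (‖M‖ + |x₂|) + ‖quadOp M x₁ x₂‖ * ‖K‖ with hD
  by_contra hinf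
  obtain ⟨N, hN⟩ := exists_nat_gt (D ^ 2 * C)
  obtain ⟨t, hts, htc⟩ := Set.Infinite.exists_subset_card_eq hinf N
  choose f hf0 hf using fun i : t => (hts i.2).2
  have hz : ∀ i : t, 0 < (i : ℂ).im := fun i => (hts i.2).1
  -- `P` intertwines `M - K P` with `M - P K`, so the vectors `P (f i)` are eigenvectors of the
  -- latter for distinct eigenvalues. The images are used because the lower bound for `K` holds on
  -- vectors `P g`.
  have hli : LinearIndependent ℂ (fun i : t => P (f i)) := by
    refine Module.End.eigenvectors_linearIndependent' ((M - P ∘L K : H →L[ℂ] H) : H →ₗ[ℂ] H)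
      (fun i : t => (i : ℂ)) Subtype.val_injective _ fun i => ?_
    rw [Module.End.hasEigenvector_iff, Module.End.mem_eigenspace_iff]
    refine ⟨?_, hf0 i⟩
    have := congrArg P (hf i)
    rw [map_sub, map_smul, hP, quadOp_comm] at this
    simpa using this
  set E := Submodule.span ℂ (Set.range fun i : t => P (f i)) with hE
  have : FiniteDimensional ℂ E := FiniteDimensional.span_of_finite ℂ (Set.finite_range _)
  have hdim : Module.finrank ℂ E = N := by
    rw [hE, finrank_span_eq_card hli, Fintype.card_coe, htc]
  let b := stdOrthonormalBasis ℂ E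
  have hbo : Orthonormal ℂ (fun i => (b i : H)) := by
    simpa [Function.comp_def] using b.orthonormal.comp_linearIsometry E.subtypeₗᵢ
  -- Each basis vector is `P g` with `g` in the span of the eigenvectors, so `1 = ‖P g‖ ≤ D ‖K P
  -- g‖`. Summing over the `N` basis vectors contradicts `N > D² C`.
  have hlow : ∀ i, 1 ≤ D ^ 2 * ‖K (b i : H)‖ ^ 2 := by
    intro i
    have hmem : (b i : H) ∈ (Submodule.span ℂ (Set.range f)).map (P : H →ₗ[ℂ] H) := by
      rw [Submodule.map_span, ← Set.range_comp]
      exact (b i).2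
    obtain ⟨g, hg, hge⟩ := hmem
    have h1 := norm_quadOp_le_of_mem_span hM hK x₁ x₂ (fun i : t => (i : ℂ)) f hz hf hg
    have hge' : quadOp M x₁ x₂ g = b i := hge
    rw [hge', hbo.1 i] at h1
    calc (1 : ℝ) = 1 ^ 2 := by norm_num
      _ ≤ (D * ‖K (b i : H)‖) ^ 2 := by gcongr
      _ = _ := by ring
  have h2 : (N : ℝ) ≤ D ^ 2 * C := by
    calc (N : ℝ) = ∑ _i : Fin (Module.finrank ℂ E), (1 : ℝ) := by simp [hdim]
      _ ≤ ∑ i, D ^ 2 * ‖K (b i : H)‖ ^ 2 := Finset.sum_le_sum fun i _ => hlow i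
      _ = D ^ 2 * ∑ i, ‖K (b i : H)‖ ^ 2 := by rw [Finset.mul_sum]
      _ ≤ D ^ 2 * C := by gcongr; exact hC _ _ hbo
  linarith

end KreinForm

/-! ### The operator `ρ G ρ` on `L²`. -/

section WeightedGreen

/-- Symmetry of the Green operator on integrable functions. -/
theorem integral_greenConv_mul {m : ℝ} (hm : 0 < m) {u v : ℝ → ℂ} (hu : Integrable u)
    (hv : Integrable v) :
    ∫ t, greenConv m u t * v t = ∫ t, u t * greenConv m v t := by
  have hprod : Integrable (Function.uncurry fun t s => greenKernel m (t - s) • u s * v t)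
      (volume.prod volume) := by
    have := (hv.mul_prod hu).bdd_mul (c := 1 / (2 * m))
      (f := fun p : ℝ × ℝ => ((greenKernel m (p.1 - p.2) : ℝ) : ℂ))
      (Complex.continuous_ofReal.comp
        ((continuous_greenKernel m).comp (by fun_prop))).aestronglyMeasurable
      (.of_forall fun p => by rw [Complex.norm_real]; exact norm_greenKernel_le hm _)
    refine this.congr (.of_forall fun p => ?_)
    simp only [Function.uncurry, Complex.real_smul]
    ring
  calc ∫ t, greenConv m u t * v t = ∫ t, ∫ s, greenKernel m (t - s) • u s * v t := by
        congr 1 with t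
        exact (integral_mul_const _ _).symm
    _ = ∫ s, ∫ t, greenKernel m (t - s) • u s * v t := integral_integral_swap hprod
    _ = ∫ s, u s * greenConv m v s := by
        congr 1 with s
        unfold greenConv
        rw [← integral_const_mul]
        congr 1 with t
        rw [greenKernel_sub_comm]
        simp only [Complex.real_smul]
        ring

theorem greenConv_congr {m : ℝ} {u v : ℝ → ℂ} (h : u =ᵐ[volume] v) :
    greenConv m u = greenConv m v := by
  ext t
  exact integral_congr_ae (h.mono fun s hs => by simp only [hs])

theorem conj_greenConv (m : ℝ) (u : ℝ → ℂ) (t : ℝ) :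
    (starRingEnd ℂ) (greenConv m u t) = greenConv m (fun s => (starRingEnd ℂ) (u s)) t := by
  unfold greenConv
  rw [← integral_conj]
  simp [Complex.real_smul]

theorem norm_sq_eq_integral (f : Lp ℂ 2 (volume : Measure ℝ)) : ‖f‖ ^ 2 = ∫ t, ‖f t‖ ^ 2 := by
  have h1 : ((‖f‖ ^ 2 : ℝ) : ℂ) = inner ℂ f f := by
    rw [inner_self_eq_norm_sq_to_K]; simp
  have h2 : inner ℂ f f = ((∫ t, ‖f t‖ ^ 2 : ℝ) : ℂ) := by
    rw [L2.inner_def, ← integral_complex_ofReal]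
    congr 1 with t
    rw [inner_self_eq_norm_sq_to_K]; simp
  exact_mod_cast h1.trans h2

theorem exists_mul_operator {g : ℝ → ℝ} (hg : Continuous g) {B : ℝ} (hB : ∀ t, |g t| ≤ B) :
    ∃ M : Lp ℂ 2 (volume : Measure ℝ) →L[ℂ] Lp ℂ 2 (volume : Measure ℝ),
      ∀ f, M f =ᵐ[volume] fun t => (g t : ℂ) * f t := by
  have hgm : MemLp (fun t => (g t : ℂ)) ⊤ :=
    memLp_top_of_bound (Complex.continuous_ofReal.comp hg).aestronglyMeasurable B
      (.of_forall fun t => by rw [Complex.norm_real]; exact hB t)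
  refine ⟨(ContinuousLinearMap.mul ℂ ℂ).holderL volume ⊤ 2 2 (hgm.toLp _), fun f => ?_⟩
  filter_upwards [(ContinuousLinearMap.mul ℂ ℂ).coeFn_holder (r := 2) (hgm.toLp _) f,
    hgm.coeFn_toLp] with t h1 h2
  have h3 : (((ContinuousLinearMap.mul ℂ ℂ).holderL volume ⊤ 2 2 (hgm.toLp _)) f) t
    = ((ContinuousLinearMap.mul ℂ ℂ).holder 2 (hgm.toLp _) f) t := rfl
  rw [h3, h1, h2]
  rfl

/-- The weighted Green operator `ρ G ρ` is bounded, symmetric and Hilbert-Schmidt on `L²`. -/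
theorem exists_weighted_green_operator {m : ℝ} (hm : 0 < m) {ρ : ℝ → ℝ} (hρ : MemLp ρ 2) :
    ∃ K : Lp ℂ 2 (volume : Measure ℝ) →L[ℂ] Lp ℂ 2 (volume : Measure ℝ),
      (∀ f, K f =ᵐ[volume] fun t => (ρ t : ℂ) * greenConv m (fun s => (ρ s : ℂ) * f s) t) ∧
      (∀ f g, inner ℂ (K f) g = inner ℂ f (K g)) ∧
      ∃ C : ℝ, ∀ (n : ℕ) (e : Fin n → Lp ℂ 2 (volume : Measure ℝ)), Orthonormal ℂ e →
        ∑ i, ‖K (e i)‖ ^ 2 ≤ C := by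
  have hρc : MemLp (fun t => (ρ t : ℂ)) 2 := hρ.ofReal
  have hint : ∀ f : Lp ℂ 2 (volume : Measure ℝ), Integrable fun s => (ρ s : ℂ) * f s :=
    fun f => hρc.integrable_mul (Lp.memLp f)
  set r : Lp ℂ 2 (volume : Measure ℝ) := hρc.toLp _ with hr
  have hr_coe : r =ᵐ[volume] fun t => (ρ t : ℂ) := hρc.coeFn_toLp
  have hkm : ∀ t, MemLp (fun s => ((greenKernel m (t - s) : ℝ) : ℂ) * (ρ s : ℂ)) 2 := by
    intro t
    refine (hρc.const_mul ((1 / (2 * m) : ℝ) : ℂ)).mono ?_ (.of_forall fun s => ?_)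
    · exact (Complex.continuous_ofReal.comp
        ((continuous_greenKernel m).comp (by fun_prop))).aestronglyMeasurable.mul hρc.1
    · rw [norm_mul, norm_mul, Complex.norm_real, Complex.norm_real (1 / (2 * m))]
      gcongr
      exact (norm_greenKernel_le hm _).trans (le_abs_self _)
  -- Kernel slices: `K f (t) = ρ(t) ⟪k t, f⟫` with `‖k t‖` bounded uniformly in `t`. Linearity,
  -- boundedness and the Hilbert-Schmidt bound all follow from this form.
  set k : ℝ → Lp ℂ 2 (volume : Measure ℝ) := fun t => (hkm t).toLp _ with hk
  have hknorm : ∀ t, ‖k t‖ ≤ 1 / (2 * m) * ‖r‖ := by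
    intro t
    refine Lp.norm_le_mul_norm_of_ae_le_mul ?_
    filter_upwards [(hkm t).coeFn_toLp, hr_coe] with s h1 h2
    rw [h1, h2, norm_mul, Complex.norm_real]
    gcongr
    exact norm_greenKernel_le hm _
  have hkinner : ∀ t f, inner ℂ (k t) f = greenConv m (fun s => (ρ s : ℂ) * f s) t := by
    intro t f
    rw [L2.inner_def]
    refine integral_congr_ae ?_
    filter_upwards [(hkm t).coeFn_toLp] with s h1
    rw [h1]
    simp only [RCLike.inner_apply, map_mul, Complex.conj_ofReal, Complex.real_smul]
    ring
  have hKm : ∀ f : Lp ℂ 2 (volume : Measure ℝ), MemLp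
      (fun t => (ρ t : ℂ) * greenConv m (fun s => (ρ s : ℂ) * f s) t) 2 := by
    intro f
    refine (hρc.const_mul ((1 / (2 * m) * ‖r‖ * ‖f‖ : ℝ) : ℂ)).mono
      (hρc.1.mul (continuous_greenConv hm (hint f)).aestronglyMeasurable) (.of_forall fun t => ?_)
    rw [norm_mul, norm_mul, mul_comm, Complex.norm_real (1 / (2 * m) * ‖r‖ * ‖f‖)]
    gcongr
    rw [← hkinner]
    refine (norm_inner_le_norm _ _).trans (le_trans ?_ (le_abs_self _))
    gcongr
    exact hknorm t
  let K₀ : Lp ℂ 2 (volume : Measure ℝ) →ₗ[ℂ] Lp ℂ 2 (volume : Measure ℝ) :=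
    { toFun := fun f => (hKm f).toLp _
      map_add' := by
        intro f g
        rw [← MemLp.toLp_add]
        refine MemLp.toLp_congr _ _ (.of_forall fun t => ?_)
        simp only [Pi.add_apply]
        rw [← hkinner, ← hkinner, ← hkinner, inner_add_right, mul_add]
      map_smul' := by
        intro c f
        rw [RingHom.id_apply, ← MemLp.toLp_const_smul]
        refine MemLp.toLp_congr _ _ (.of_forall fun t => ?_)
        simp only [Pi.smul_apply, smul_eq_mul]
        rw [← hkinner, ← hkinner, inner_smul_right]
        ring }
  have hK₀ : ∀ f, ‖K₀ f‖ ≤ 1 / (2 * m) * ‖r‖ * ‖r‖ * ‖f‖ := by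
    intro f
    have : ‖K₀ f‖ ≤ (1 / (2 * m) * ‖r‖ * ‖f‖) * ‖r‖ := by
      refine Lp.norm_le_mul_norm_of_ae_le_mul ?_
      filter_upwards [(hKm f).coeFn_toLp, hr_coe] with t h1 h2
      have h3 : (K₀ f) t = ((hKm f).toLp _) t := rfl
      rw [h3, h1, h2, norm_mul, mul_comm, ← hkinner]
      gcongr
      exact (norm_inner_le_norm _ _).trans (by gcongr; exact hknorm t)
    linarith
  let K := K₀.mkContinuous _ hK₀
  have hK : ∀ f, K f =ᵐ[volume] fun t => (ρ t : ℂ) * greenConv m (fun s => (ρ s : ℂ) * f s) t :=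
    fun f => (hKm f).coeFn_toLp
  refine ⟨K, hK, fun f g => ?_, (1 / (2 * m) * ‖r‖) ^ 2 * ∫ t, ρ t ^ 2, fun n e he => ?_⟩
  · rw [L2.inner_def, L2.inner_def]
    have hconj : Integrable fun s => (starRingEnd ℂ) ((ρ s : ℂ) * f s) :=
      (integrable_norm_iff
        (Complex.continuous_conj.comp_aestronglyMeasurable (hint f).1)).1 (by simpa using (hint f).norm)
    calc ∫ t, inner ℂ (K f t) (g t)
        = ∫ t, greenConv m (fun s => (starRingEnd ℂ) ((ρ s : ℂ) * f s)) t * ((ρ t : ℂ) * g t) := by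
          refine integral_congr_ae ?_
          filter_upwards [hK f] with t ht
          rw [ht]
          simp only [RCLike.inner_apply, map_mul, Complex.conj_ofReal, conj_greenConv]
          ring
      _ = ∫ t, (starRingEnd ℂ) ((ρ t : ℂ) * f t) * greenConv m (fun s => (ρ s : ℂ) * g s) t :=
          integral_greenConv_mul hm hconj (hint g)
      _ = ∫ t, inner ℂ (f t) (K g t) := by
          refine integral_congr_ae ?_
          filter_upwards [hK g] with t ht
          rw [ht]
          simp only [RCLike.inner_apply, map_mul, Complex.conj_ofReal]
          ring
  · have hn : ∀ i, ‖K (e i)‖ ^ 2 = ∫ t, ρ t ^ 2 * ‖inner ℂ (e i) (k t)‖ ^ 2 := by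
      intro i
      rw [norm_sq_eq_integral]
      refine integral_congr_ae ?_
      filter_upwards [hK (e i)] with t ht
      rw [ht, ← hkinner, norm_mul, mul_pow, Complex.norm_real, Real.norm_eq_abs, sq_abs,
        norm_inner_symm]
    have hi : ∀ i, Integrable fun t => ρ t ^ 2 * ‖inner ℂ (e i) (k t)‖ ^ 2 := by
      intro i
      have h1 : Integrable fun t => ‖K (e i) t‖ ^ 2 := (Lp.memLp (K (e i))).integrable_norm_pow
        (by norm_num)
      refine h1.congr ?_
      filter_upwards [hK (e i)] with t ht
      rw [ht, ← hkinner, norm_mul, mul_pow, Complex.norm_real, Real.norm_eq_abs, sq_abs,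
        norm_inner_symm]
    simp only [hn]
    rw [← integral_finsetSum _ fun i _ => hi i, ← integral_const_mul]
    refine integral_mono (integrable_finsetSum _ fun i _ => hi i)
      (hρ.integrable_sq.const_mul _) fun t => ?_
    simp only
    rw [← Finset.mul_sum, mul_comm]
    gcongr
    -- Bessel's inequality for the slice `k t`, pointwise in `t`.
    exact (he.sum_inner_products_le (k t)).trans (by gcongr; exact hknorm t)

end WeightedGreen

/-! ### From Rayleigh's equation to the eigenvalue problem for `M - K P`. -/

section Finiteness

/-- If `A = -(Ξ - x₁) (Ξ - x₂) ρ²` with `ρ` bounded and square integrable, then there are only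
finitely many unstable parameters. -/
theorem finite_unstableSet {Ξ : ℝ → ℝ} (hΞ : Continuous Ξ) {B : ℝ} (hB : ∀ t, |Ξ t| ≤ B)
    {ρ : ℝ → ℝ} {R : ℝ} (hR : ∀ t, |ρ t| ≤ R) (hρ : MemLp ρ 2) (x₁ x₂ : ℝ)
    (hA : ∀ t, rayleighA Ξ t = -((Ξ t - x₁) * (Ξ t - x₂) * ρ t ^ 2)) {m : ℝ} (hm : 0 < m) :
    (unstableSet Ξ m).Finite := by
  obtain ⟨M, hM⟩ := exists_mul_operator hΞ hB
  obtain ⟨K, hK, hKs, C, hC⟩ := exists_weighted_green_operator hm hρ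
  have hMs : ∀ f g, inner ℂ (M f) g = inner ℂ f (M g) := by
    intro f g
    rw [L2.inner_def, L2.inner_def]
    refine integral_congr_ae ?_
    filter_upwards [hM f, hM g] with t h1 h2
    rw [h1, h2]
    simp only [RCLike.inner_apply, map_mul, Complex.conj_ofReal]
    ring
  refine (finite_upper_eigenvalues hMs hKs x₁ x₂ C hC).subset ?_
  rintro z ⟨hz, φ, ⟨hφ, φ₁, φ₂, ⟨hd1, hd2, -, -, -⟩, heq⟩, hφ0⟩
  refine ⟨hz, ?_⟩
  have hne : ∀ t, (Ξ t : ℂ) - z ≠ 0 := by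
    intro t h
    have := congrArg Complex.im h
    simp at this
    linarith
  have hlow : ∀ t, ‖((Ξ t : ℂ) - z)⁻¹‖ ≤ 1 / z.im := by
    intro t
    rw [norm_inv, ← one_div]
    gcongr
    calc z.im = |((Ξ t : ℂ) - z).im| := by simp [abs_of_pos hz]
      _ ≤ _ := Complex.abs_im_le_norm _
  have hB0 : 0 ≤ B := (abs_nonneg _).trans (hB 0)
  have hR0 : 0 ≤ R := (abs_nonneg _).trans (hR 0)
  have hρc : MemLp (fun t => (ρ t : ℂ)) 2 := hρ.ofReal
  have hinvc : Continuous fun t => ((Ξ t : ℂ) - z)⁻¹ :=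
    ((Complex.continuous_ofReal.comp hΞ).sub continuous_const).inv₀ hne
  -- The substitution `f = -ρ φ / (Ξ - z)`. It gives `ρ P f = A φ / (Ξ - z) = w` and, as `φ = -G w`,
  -- also `K P f = -ρ φ`; hence `M f - K P f = z f`.
  have hfm : MemLp (fun t => -((ρ t : ℂ) * φ t * ((Ξ t : ℂ) - z)⁻¹)) 2 := by
    refine (hφ.const_mul ((R * (1 / z.im) : ℝ) : ℂ)).mono
      ((hρc.1.mul hφ.1).mul hinvc.aestronglyMeasurable).neg (.of_forall fun t => ?_)
    rw [norm_neg, norm_mul, norm_mul, norm_mul, Complex.norm_real, Complex.norm_real,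
      Real.norm_of_nonneg (by positivity : 0 ≤ R * (1 / z.im))]
    calc ‖ρ t‖ * ‖φ t‖ * ‖((Ξ t : ℂ) - z)⁻¹‖ ≤ R * ‖φ t‖ * (1 / z.im) := by
          gcongr
          · exact hR t
          · exact hlow t
      _ = _ := by ring
  set f : Lp ℂ 2 (volume : Measure ℝ) := hfm.toLp _ with hf
  have hfc : f =ᵐ[volume] fun t => -((ρ t : ℂ) * φ t * ((Ξ t : ℂ) - z)⁻¹) := hfm.coeFn_toLp
  have hPf : quadOp M x₁ x₂ f =ᵐ[volume]
      fun t => ((Ξ t : ℂ) - x₁) * ((Ξ t : ℂ) - x₂) * f t := by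
    rw [quadOp_apply]
    filter_upwards [hM f, hM (M f), Lp.coeFn_add (M (M f) - (x₁ + x₂ : ℂ) • M f)
      ((x₁ * x₂ : ℂ) • f), Lp.coeFn_sub (M (M f)) ((x₁ + x₂ : ℂ) • M f),
      Lp.coeFn_smul (x₁ + x₂ : ℂ) (M f), Lp.coeFn_smul (x₁ * x₂ : ℂ) f] with t h1 h2 h3 h4 h5 h6
    simp only [h3, Pi.add_apply, h4, Pi.sub_apply, h5, h6, Pi.smul_apply, h2, h1, smul_eq_mul]
    ring
  set w : ℝ → ℂ := fun t => (rayleighA Ξ t : ℂ) / ((Ξ t : ℂ) - z) * φ t with hw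
  have hρP : (fun t => (ρ t : ℂ) * quadOp M x₁ x₂ f t) =ᵐ[volume] w := by
    filter_upwards [hPf, hfc] with t h1 h2
    rw [h1, h2, hw]
    simp only [hA]
    push_cast
    rw [div_eq_mul_inv]
    ring
  have hw1 : Integrable w := (hρc.integrable_mul (Lp.memLp (quadOp M x₁ x₂ f))).congr hρP
  have hw2 : MemLp w 2 := by
    refine ((Lp.memLp (quadOp M x₁ x₂ f)).const_mul (R : ℂ)).mono hw1.1 ?_
    filter_upwards [hρP] with t ht
    rw [← ht, norm_mul, norm_mul, Complex.norm_real, Complex.norm_real, Real.norm_of_nonneg hR0]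
    gcongr
    exact hR t
  have hgreen : ∀ᵐ t, φ t = -greenConv m w t := by
    refine ae_eq_neg_greenConv hm hφ hw2 hw1 fun η hη hηc => ?_
    rw [hd1.2.2 _ (contDiff_infty_iff_deriv.1 hη).2 hηc.deriv, hd2.2.2 η hη hηc, neg_neg]
    refine integral_congr_ae ?_
    filter_upwards [heq] with t ht
    simp only [hw]
    congr 1
    linear_combination -ht
  -- If `P f = 0` then `w = 0` almost everywhere, and `φ = -G w` vanishes.
  refine ⟨f, fun h0 => hφ0 ?_, ?_⟩
  · have hw0 : w =ᵐ[volume] fun _ => 0 := by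
      rw [h0] at hρP
      filter_upwards [hρP, Lp.coeFn_zero ℂ 2 (volume : Measure ℝ)] with t h1 h2
      rw [← h1, h2, Pi.zero_apply, mul_zero]
    filter_upwards [hgreen] with t ht
    rw [ht, greenConv_congr hw0]
    simp [greenConv]
  · refine Lp.ext ?_
    have hKP := hK (quadOp M x₁ x₂ f)
    rw [greenConv_congr hρP] at hKP
    filter_upwards [Lp.coeFn_sub (M f) (K (quadOp M x₁ x₂ f)), Lp.coeFn_smul z f, hKP, hM f, hfc,
      hgreen] with t h1 h2 h3 h4 h5 h6
    have h7 : greenConv m w t = -φ t := by rw [h6, neg_neg]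
    rw [h1, h2, Pi.sub_apply, Pi.smul_apply, h3, h4, h5, h7, smul_eq_mul]
    have := hne t
    field_simp
    ring

end Finiteness

/-! ### Factoring `A` through the monotone profile. -/

section Weight

theorem continuous_dslope {f : ℝ → ℝ} (hf : Differentiable ℝ f) (a : ℝ) :
    Continuous (dslope f a) := by
  rw [continuous_iff_continuousAt]
  intro t
  rcases eq_or_ne t a with rfl | h
  · exact continuousAt_dslope_same.2 (hf t)
  · exact (continuousAt_dslope_of_ne h).2 (hf t).continuousAt

theorem dslope_neg_of_deriv_neg {f : ℝ → ℝ} (hf : ∀ t, deriv f t < 0) (a t : ℝ) :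
    dslope f a t < 0 := by
  have hanti : StrictAnti f := strictAnti_of_deriv_neg hf
  rcases eq_or_ne t a with rfl | h
  · rw [dslope_same]; exact hf t
  · rw [dslope_of_ne f h, slope_def_field]
    rcases lt_or_gt_of_ne h with h | h
    · exact div_neg_of_pos_of_neg (sub_pos.2 (hanti h)) (sub_neg.2 h)
    · exact div_neg_of_neg_of_pos (sub_neg.2 (hanti h)) (sub_pos.2 h)

/-- A function with sign pattern `-, +, -` is `-(Ξ - Ξ a) (Ξ - Ξ b) ρ²` for a bounded square
integrable weight `ρ`. -/
theorem exists_weight {Ξ A : ℝ → ℝ} (hΞ : Differentiable ℝ Ξ) (hΞ' : ∀ t, deriv Ξ t < 0)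
    (hA : Differentiable ℝ A) (hAi : Integrable A) {D : ℝ} (hD : ∀ t, |A t| ≤ D) {a b : ℝ}
    (hab : a < b) (hAa : A a = 0) (hAb : A b = 0) (h1 : ∀ t < a, A t ≤ 0)
    (h2 : ∀ t, a < t → t < b → 0 ≤ A t) (h3 : ∀ t, b < t → A t ≤ 0) :
    ∃ ρ : ℝ → ℝ, MemLp ρ 2 ∧ (∃ R, ∀ t, |ρ t| ≤ R) ∧
      ∀ t, A t = -((Ξ t - Ξ a) * (Ξ t - Ξ b) * ρ t ^ 2) := by
  have hanti : StrictAnti Ξ := strictAnti_of_deriv_neg hΞ'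
  set Xa := dslope Ξ a
  set Xb := dslope Ξ b
  set Q := dslope (dslope A a) b
  have hXa : ∀ t, Xa t < 0 := dslope_neg_of_deriv_neg hΞ' a
  have hXb : ∀ t, Xb t < 0 := dslope_neg_of_deriv_neg hΞ' b
  have hXa' : ∀ t, Ξ t - Ξ a = (t - a) * Xa t := fun t => (sub_smul_dslope Ξ a t).symm
  have hXb' : ∀ t, Ξ t - Ξ b = (t - b) * Xb t := fun t => (sub_smul_dslope Ξ b t).symm
  have hQc : Continuous Q := by
    rw [continuous_iff_continuousAt]
    intro t
    rcases eq_or_ne t b with rfl | h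
    · exact continuousAt_dslope_same.2 ((differentiableAt_dslope_of_ne hab.ne').2 (hA t))
    · exact (continuousAt_dslope_of_ne h).2 (continuous_dslope hA a).continuousAt
  have hQ : ∀ t, A t = (t - a) * ((t - b) * Q t) := by
    intro t
    have e1 : (t - b) * Q t = dslope A a t - dslope A a b := sub_smul_dslope (dslope A a) b t
    have e2 : (t - a) * dslope A a t = A t - A a := sub_smul_dslope A a t
    have e3 : dslope A a b = 0 := by
      rw [dslope_of_ne A hab.ne', slope_def_field, hAa, hAb]; simp
    rw [e1, e3, sub_zero, e2, hAa, sub_zero]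
  -- The sign pattern settles this away from `a` and `b`; continuity and density give the two
  -- remaining points.
  have hQ0 : ∀ t, Q t ≤ 0 := by
    have hd : Dense (({a, b} : Set ℝ)ᶜ) := (Set.toFinite ({a, b} : Set ℝ)).countable.dense_compl ℝ
    have hcl : IsClosed {t | Q t ≤ 0} := isClosed_le hQc continuous_const
    have hsub : (({a, b} : Set ℝ)ᶜ) ⊆ {t | Q t ≤ 0} := by
      intro t ht
      simp only [Set.mem_compl_iff, Set.mem_insert_iff, Set.mem_singleton_iff, not_or] at ht
      have hq := hQ t
      by_contra hcon
      replace hcon : 0 < Q t := not_le.1 hcon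
      rcases lt_or_gt_of_ne ht.1 with ha | ha
      · have := h1 t ha
        have : 0 < (t - a) * ((t - b) * Q t) :=
          mul_pos_of_neg_of_neg (by linarith) (mul_neg_of_neg_of_pos (by linarith) hcon)
        linarith
      · rcases lt_or_gt_of_ne ht.2 with hb | hb
        · have := h2 t ha hb
          have : (t - a) * ((t - b) * Q t) < 0 :=
            mul_neg_of_pos_of_neg (by linarith) (mul_neg_of_neg_of_pos (by linarith) hcon)
          linarith
        · have := h3 t hb
          have : 0 < (t - a) * ((t - b) * Q t) :=
            mul_pos (by linarith) (mul_pos (by linarith) hcon)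
          linarith
    intro t
    exact (hcl.closure_subset_iff.2 hsub) (hd t)
  -- The candidate for `ρ²`. The difference quotients of `Ξ` never vanish, since `Ξ' < 0`
  -- everywhere.
  set σ : ℝ → ℝ := fun t => -Q t / (Xa t * Xb t) with hσ
  have hσc : Continuous σ := hQc.neg.div
    ((continuous_dslope hΞ a).mul (continuous_dslope hΞ b))
    fun t => (mul_pos_of_neg_of_neg (hXa t) (hXb t)).ne'
  have hσ0 : ∀ t, 0 ≤ σ t := fun t =>
    div_nonneg (neg_nonneg.2 (hQ0 t)) (mul_pos_of_neg_of_neg (hXa t) (hXb t)).le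
  have hAσ : ∀ t, A t = -((Ξ t - Ξ a) * (Ξ t - Ξ b) * σ t) := by
    intro t
    rw [hXa', hXb', hQ, hσ]
    have := (hXa t).ne
    have := (hXb t).ne
    field_simp
  obtain ⟨S, hS⟩ := (isCompact_Icc (a := a - 1) (b := b + 1)).exists_bound_of_continuousOn
    hσc.continuousOn
  have hS0 : 0 ≤ S := (norm_nonneg _).trans (hS a ⟨by linarith, by linarith⟩)
  -- Outside `[a - 1, b + 1]` monotonicity keeps both factors `Ξ - Ξ a` and `Ξ - Ξ b` at least `δ`
  -- in absolute value. There `σ` is controlled by `|A|`; inside, compactness suffices.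
  set δ := min (Ξ (a - 1) - Ξ a) (Ξ b - Ξ (b + 1)) with hδ
  have hδ0 : 0 < δ :=
    lt_min (sub_pos.2 (hanti (by linarith))) (sub_pos.2 (hanti (by linarith)))
  have hout : ∀ t, t ∉ Set.Icc (a - 1) (b + 1) → σ t ≤ (δ ^ 2)⁻¹ * |A t| := by
    intro t ht
    have hp : δ ^ 2 ≤ |(Ξ t - Ξ a) * (Ξ t - Ξ b)| := by
      rw [abs_mul, sq]
      have hba : Ξ b < Ξ a := hanti hab
      rcases lt_or_ge t (a - 1) with h | h
      · have e1 := hanti h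
        have e2 := min_le_left (Ξ (a - 1) - Ξ a) (Ξ b - Ξ (b + 1))
        rw [← hδ] at e2
        rw [abs_of_pos (by linarith), abs_of_pos (by linarith)]
        gcongr <;> linarith
      · have h' : b + 1 < t := by
          by_contra hc
          exact ht ⟨h, not_lt.1 hc⟩
        have e1 := hanti h'
        have e2 := min_le_right (Ξ (a - 1) - Ξ a) (Ξ b - Ξ (b + 1))
        rw [← hδ] at e2
        rw [abs_of_neg (by linarith), abs_of_neg (by linarith)]
        gcongr <;> linarith
    rw [hAσ t, abs_neg, abs_mul, abs_of_nonneg (hσ0 t), inv_mul_eq_div, le_div_iff₀ (by positivity),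
      mul_comm]
    exact mul_le_mul_of_nonneg_right hp (hσ0 t)
  have hσi : Integrable σ := by
    have hbd : Integrable fun t => (Set.Icc (a - 1) (b + 1)).indicator (fun _ => S) t
        + (δ ^ 2)⁻¹ * |A t| :=
      (IntegrableOn.integrable_indicator (by simp) measurableSet_Icc).add (hAi.abs.const_mul _)
    refine hbd.mono' hσc.aestronglyMeasurable (.of_forall fun t => ?_)
    by_cases ht : t ∈ Set.Icc (a - 1) (b + 1)
    · rw [Set.indicator_of_mem ht]
      exact (hS t ht).trans (le_add_of_nonneg_right (by positivity))
    · rw [Set.indicator_of_notMem ht, zero_add, Real.norm_of_nonneg (hσ0 t)]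
      exact hout t ht
  have hD0 : 0 ≤ D := (abs_nonneg _).trans (hD 0)
  refine ⟨fun t => √(σ t), ?_, ⟨√(S + (δ ^ 2)⁻¹ * D), fun t => ?_⟩, fun t => ?_⟩
  · rw [memLp_two_iff_integrable_sq hσc.sqrt.aestronglyMeasurable]
    simpa only [Real.sq_sqrt (hσ0 _)] using hσi
  · rw [abs_of_nonneg (Real.sqrt_nonneg _)]
    refine Real.sqrt_le_sqrt ?_
    by_cases ht : t ∈ Set.Icc (a - 1) (b + 1)
    · exact ((le_abs_self _).trans (hS t ht)).trans (le_add_of_nonneg_right (by positivity))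
    · refine (hout t ht).trans ?_
      have : (δ ^ 2)⁻¹ * |A t| ≤ (δ ^ 2)⁻¹ * D := by gcongr; exact hD t
      linarith
  · rw [Real.sq_sqrt (hσ0 t)]
    exact hAσ t

end Weight

/-! ### Derivatives of integrals over half-lines. -/

section Primitives

variable {E : Type*} [NormedAddCommGroup E] [NormedSpace ℝ E] [CompleteSpace E]

theorem hasDerivAt_integral_Iic {f : ℝ → E} (hf : Continuous f)
    (hi : ∀ t, IntegrableOn f (Set.Iic t)) (t : ℝ) :
    HasDerivAt (fun t => ∫ s in Set.Iic t, f s) (f t) t := by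
  have h : (fun t => ∫ s in Set.Iic t, f s)
      = fun t => (∫ s in Set.Iic 0, f s) + ∫ s in (0 : ℝ)..t, f s := by
    ext u
    rw [← intervalIntegral.integral_Iic_sub_Iic (hi 0) (hi u), add_sub_cancel]
  rw [h]
  exact (hf.integral_hasStrictDerivAt 0 t).hasDerivAt.const_add _

theorem hasDerivAt_integral_Ioi {f : ℝ → E} (hf : Continuous f)
    (hi : ∀ t, IntegrableOn f (Set.Ioi t)) (t : ℝ) :
    HasDerivAt (fun t => ∫ s in Set.Ioi t, f s) (-f t) t := by
  have h : (fun t => ∫ s in Set.Ioi t, f s)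
      = fun t => (∫ s in Set.Ioi 0, f s) - ∫ s in (0 : ℝ)..t, f s := by
    ext u
    rw [← intervalIntegral.integral_Ioi_sub_Ioi' (hi 0) (hi u), sub_sub_cancel]
  rw [h]
  exact (hf.integral_hasStrictDerivAt 0 t).hasDerivAt.const_sub _

end Primitives

/-! ### The Volterra equation for the Jost solution when `m = 2`. -/

section Jost

/-- The Volterra kernel `(1 - e^{-4 max(x, 0)}) / 4`. -/
noncomputable def jostKernel (x : ℝ) : ℝ := (1 - Real.exp (-4 * max x 0)) / 4

theorem continuous_jostKernel : Continuous jostKernel := by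
  unfold jostKernel; fun_prop

theorem jostKernel_of_nonpos {x : ℝ} (hx : x ≤ 0) : jostKernel x = 0 := by
  simp [jostKernel, max_eq_right hx]

theorem jostKernel_nonneg (x : ℝ) : 0 ≤ jostKernel x := by
  unfold jostKernel
  have : Real.exp (-4 * max x 0) ≤ 1 := by
    rw [Real.exp_le_one_iff]; nlinarith [le_max_right x 0]
  linarith

theorem jostKernel_le (x : ℝ) : jostKernel x ≤ 1 / 4 := by
  unfold jostKernel
  linarith [Real.exp_pos (-4 * max x 0)]

theorem abs_exp_neg_sub_exp_neg_le {x y : ℝ} (hx : 0 ≤ x) (hy : 0 ≤ y) :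
    |Real.exp (-x) - Real.exp (-y)| ≤ |x - y| := by
  wlog h : x ≤ y generalizing x y
  · rw [abs_sub_comm, abs_sub_comm x]
    exact this hy hx (le_of_not_ge h)
  have h1 : Real.exp (-y) ≤ Real.exp (-x) := Real.exp_le_exp.2 (by linarith)
  rw [abs_of_nonneg (by linarith), abs_sub_comm, abs_of_nonneg (by linarith)]
  have h2 : Real.exp (-y) = Real.exp (-x) * Real.exp (-(y - x)) := by
    rw [← Real.exp_add]; ring_nf
  have h3 := Real.add_one_le_exp (-(y - x))
  have h4 : Real.exp (-x) ≤ 1 := Real.exp_le_one_iff.2 (by linarith)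
  have h5 := Real.exp_pos (-x)
  nlinarith

theorem abs_jostKernel_sub_le (x y : ℝ) : |jostKernel x - jostKernel y| ≤ |x - y| := by
  have h1 : jostKernel x - jostKernel y
      = -(Real.exp (-(4 * max x 0)) - Real.exp (-(4 * max y 0))) / 4 := by
    unfold jostKernel; ring_nf
  have h2 := abs_exp_neg_sub_exp_neg_le (x := 4 * max x 0) (y := 4 * max y 0)
    (by positivity) (by positivity)
  have h3 : |4 * max x 0 - 4 * max y 0| ≤ 4 * |x - y| := by
    rw [← mul_sub, abs_mul, abs_of_pos (by norm_num : (0 : ℝ) < 4)]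
    exact mul_le_mul_of_nonneg_left (abs_max_sub_max_le_abs x y 0) (by norm_num)
  rw [h1, abs_div, abs_neg, abs_of_pos (by norm_num : (0 : ℝ) < 4)]
  linarith

/-- The mass of `|A|` to the right of `t`. -/
noncomputable def tailMass (A : ℝ → ℝ) (t : ℝ) : ℝ := ∫ s in Set.Ioi t, |A s|

variable {A : ℝ → ℝ}

theorem tailMass_nonneg (t : ℝ) : 0 ≤ tailMass A t :=
  integral_nonneg fun _ => abs_nonneg _

theorem tailMass_le (hi : Integrable A) (t : ℝ) : tailMass A t ≤ ∫ s, |A s| :=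
  setIntegral_le_integral hi.abs (.of_forall fun _ => abs_nonneg _)

theorem hasDerivAt_tailMass (hc : Continuous A) (hi : Integrable A) (t : ℝ) :
    HasDerivAt (tailMass A) (-|A t|) t :=
  hasDerivAt_integral_Ioi hc.abs (fun _ => hi.abs.integrableOn) t

theorem continuous_tailMass (hc : Continuous A) (hi : Integrable A) : Continuous (tailMass A) :=
  continuous_iff_continuousAt.2 fun t => (hasDerivAt_tailMass hc hi t).continuousAt

theorem tailMass_antitone (hi : Integrable A) : Antitone (tailMass A) := fun _ _ h =>
  setIntegral_mono_set hi.abs.integrableOn (.of_forall fun _ => abs_nonneg _)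
    (Set.Ioi_subset_Ioi h).eventuallyLE

theorem tendsto_tailMass (hi : Integrable A) : Tendsto (tailMass A) atTop (𝓝 0) := by
  have h : tailMass A = fun t => (∫ s, |A s|) - ∫ s in Set.Iic t, |A s| := by
    ext t
    rw [← integral_add_compl (measurableSet_Iic (a := t)) hi.abs, Set.compl_Iic, add_sub_cancel_left]
    rfl
  rw [h, ← sub_self (∫ s, |A s|)]
  exact tendsto_const_nhds.sub
    ((aecover_Iic tendsto_id).integral_tendsto_of_countably_generated hi.abs)

/-- With `N = tailMass A` one has `N' = -|A|`, so the integrand is an exact derivative. The gain `1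
/ κ` makes the weighted Volterra operator small without any smallness of `A`. -/
theorem integral_Ioi_weight_le (hc : Continuous A) (hi : Integrable A) {κ : ℝ} (hκ : 0 < κ)
    (t : ℝ) :
    IntegrableOn (fun s => Real.exp (κ * (tailMass A s - tailMass A t)) * |A s|) (Set.Ioi t) ∧
    ∫ s in Set.Ioi t, Real.exp (κ * (tailMass A s - tailMass A t)) * |A s| ≤ 1 / κ := by
  have hN := continuous_tailMass hc hi
  have hint : IntegrableOn (fun s => Real.exp (κ * (tailMass A s - tailMass A t)) * |A s|)
      (Set.Ioi t) := by
    refine (hi.abs.integrableOn (s := Set.Ioi t)).mono'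
      (Continuous.aestronglyMeasurable (by fun_prop)) ?_
    refine (ae_restrict_iff' measurableSet_Ioi).2 (.of_forall fun s hs => ?_)
    rw [Real.norm_of_nonneg (by positivity)]
    refine mul_le_of_le_one_left (abs_nonneg _) (Real.exp_le_one_iff.2 ?_)
    have := tailMass_antitone hi (le_of_lt (Set.mem_Ioi.1 hs))
    nlinarith
  refine ⟨hint, ?_⟩
  have hd : ∀ s, HasDerivAt (fun s => -(Real.exp (κ * (tailMass A s - tailMass A t)) / κ))
      (Real.exp (κ * (tailMass A s - tailMass A t)) * |A s|) s := by
    intro s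
    have := ((((hasDerivAt_tailMass hc hi s).sub_const (tailMass A t)).const_mul κ).exp.div_const
      κ).neg
    refine this.congr_deriv ?_
    field_simp
  have ht : Tendsto (fun s => -(Real.exp (κ * (tailMass A s - tailMass A t)) / κ)) atTop
      (𝓝 (-(Real.exp (κ * (0 - tailMass A t)) / κ))) :=
    (((Real.continuous_exp.tendsto _).comp
      (((tendsto_tailMass hi).sub_const _).const_mul κ)).div_const κ).neg
  rw [integral_Ioi_of_hasDerivAt_of_tendsto (hd t).continuousAt.continuousWithinAt
    (fun s _ => hd s) hint ht]
  simp only [sub_self, mul_zero, Real.exp_zero]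
  have : 0 < Real.exp (κ * (0 - tailMass A t)) / κ := by positivity
  linarith

open BoundedContinuousFunction in
/-- The Volterra operator with kernel `jostKernel (s - t) A s`, conjugated with the exponential of
`tailMass A`, is a contraction for a large weight. -/
theorem exists_volterra_operator (hc : Continuous A) (hi : Integrable A) {κ : ℝ} (hκ : 0 < κ) :
    ∃ T : (ℝ →ᵇ ℂ) →L[ℂ] (ℝ →ᵇ ℂ),
      (∀ u t, T u t = ∫ s, ((jostKernel (s - t) * Real.exp (κ * (tailMass A s - tailMass A t)) * A s
        : ℝ) : ℂ) * u s) ∧ ∀ u, ‖T u‖ ≤ 1 / (4 * κ) * ‖u‖ := by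
  have hN := continuous_tailMass hc hi
  have hk := continuous_jostKernel
  set q : ℝ → ℝ → ℝ := fun t s =>
    jostKernel (s - t) * Real.exp (κ * (tailMass A s - tailMass A t)) * A s with hq
  have hqc : ∀ t, Continuous (q t) := fun t => by fun_prop
  have hqc' : ∀ s, Continuous fun t => q t s := fun s => by fun_prop
  have hqb : ∀ t s, |q t s| ≤ (Set.Ioi t).indicator
      (fun s => 1 / 4 * (Real.exp (κ * (tailMass A s - tailMass A t)) * |A s|)) s := by
    intro t s
    by_cases hs : s ∈ Set.Ioi t
    · rw [Set.indicator_of_mem hs, hq]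
      simp only [abs_mul, Real.abs_exp, abs_of_nonneg (jostKernel_nonneg _), mul_assoc]
      gcongr
      exact jostKernel_le _
    · rw [Set.indicator_of_notMem hs, hq]
      simp [jostKernel_of_nonpos (sub_nonpos.2 (not_lt.1 hs))]
  have hqb' : ∀ t s, |q t s| ≤ 1 / 4 * |A s| := by
    intro t s
    refine (hqb t s).trans ?_
    by_cases hs : s ∈ Set.Ioi t
    · rw [Set.indicator_of_mem hs]
      gcongr
      refine mul_le_of_le_one_left (abs_nonneg _) (Real.exp_le_one_iff.2 ?_)
      have := tailMass_antitone hi (le_of_lt (Set.mem_Ioi.1 hs))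
      nlinarith
    · rw [Set.indicator_of_notMem hs]; positivity
  have hqi : ∀ t, Integrable (q t) := fun t =>
    (hi.abs.const_mul (1 / 4)).mono' (hqc t).aestronglyMeasurable (.of_forall (hqb' t))
  have hqn : ∀ t, ∫ s, |q t s| ≤ 1 / (4 * κ) := by
    intro t
    obtain ⟨h1, h2⟩ := integral_Ioi_weight_le hc hi hκ t
    calc ∫ s, |q t s| ≤ ∫ s, (Set.Ioi t).indicator
          (fun s => 1 / 4 * (Real.exp (κ * (tailMass A s - tailMass A t)) * |A s|)) s :=
          integral_mono (hqi t).abs ((integrable_indicator_iff measurableSet_Ioi).2 (Integrable.const_mul h1 _)) (hqb t)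
      _ = 1 / 4 * ∫ s in Set.Ioi t, Real.exp (κ * (tailMass A s - tailMass A t)) * |A s| := by
          rw [integral_indicator measurableSet_Ioi, integral_const_mul]
      _ ≤ 1 / 4 * (1 / κ) := by gcongr
      _ = _ := by field_simp
  have hui : ∀ (u : ℝ →ᵇ ℂ) t, Integrable fun s => (q t s : ℂ) * u s := fun u t =>
    (hqi t).ofReal.mul_bdd (c := ‖u‖) u.continuous.aestronglyMeasurable
      (.of_forall fun s => u.norm_coe_le_norm s)
  have hcont : ∀ u : ℝ →ᵇ ℂ, Continuous fun t => ∫ s, (q t s : ℂ) * u s := by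
    intro u
    refine continuous_of_dominated (bound := fun s => 1 / 4 * |A s| * ‖u‖) (fun t => (hui u t).1)
      (fun t => .of_forall fun s => ?_) ((hi.abs.const_mul _).mul_const _) (.of_forall fun s => ?_)
    · rw [norm_mul, Complex.norm_real]
      gcongr
      · exact hqb' t s
      · exact u.norm_coe_le_norm s
    · exact (Complex.continuous_ofReal.comp (hqc' s)).mul continuous_const
  have hbd : ∀ (u : ℝ →ᵇ ℂ) t, ‖∫ s, (q t s : ℂ) * u s‖ ≤ 1 / (4 * κ) * ‖u‖ := by
    intro u t
    calc ‖∫ s, (q t s : ℂ) * u s‖ ≤ ∫ s, |q t s| * ‖u‖ := by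
          refine norm_integral_le_of_norm_le ((hqi t).abs.mul_const _) (.of_forall fun s => ?_)
          rw [norm_mul, Complex.norm_real, Real.norm_eq_abs]
          gcongr
          exact u.norm_coe_le_norm s
      _ = (∫ s, |q t s|) * ‖u‖ := integral_mul_const _ _
      _ ≤ _ := by gcongr; exact hqn t
  let T₀ : (ℝ →ᵇ ℂ) →ₗ[ℂ] (ℝ →ᵇ ℂ) :=
    { toFun := fun u => ofNormedAddCommGroup _ (hcont u) _ (hbd u)
      map_add' := by
        intro u v
        ext t
        simp only [coe_ofNormedAddCommGroup, BoundedContinuousFunction.add_apply, mul_add]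
        exact integral_add (hui u t) (hui v t)
      map_smul' := by
        intro c u
        ext t
        simp only [coe_ofNormedAddCommGroup, BoundedContinuousFunction.smul_apply, RingHom.id_apply,
          smul_eq_mul]
        rw [← integral_const_mul]
        congr 1 with s
        ring }
  have hT₀ : ∀ u, ‖T₀ u‖ ≤ 1 / (4 * κ) * ‖u‖ := fun u =>
    norm_ofNormedAddCommGroup_le _ (by positivity) (hbd u)
  exact ⟨T₀.mkContinuous _ hT₀, fun u t => rfl, hT₀⟩

theorem ofReal_sub_ne_zero {z : ℂ} (hz : 0 < z.im) (x : ℝ) : (x : ℂ) - z ≠ 0 := by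
  intro h
  have := congrArg Complex.im h
  simp at this
  linarith

theorem norm_inv_ofReal_sub_le {z : ℂ} {δ : ℝ} (hδ : 0 < δ) (hz : δ ≤ z.im) (x : ℝ) :
    ‖((x : ℂ) - z)⁻¹‖ ≤ 1 / δ := by
  rw [norm_inv, ← one_div]
  gcongr
  calc δ ≤ z.im := hz
    _ = |((x : ℂ) - z).im| := by simp [abs_of_pos (hδ.trans_le hz)]
    _ ≤ _ := Complex.abs_im_le_norm _

/-- A Volterra-Gronwall estimate. -/
theorem norm_le_of_volterra_residual (hc : Continuous A) (hi : Integrable A) {X : ℝ → ℝ}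
    (hX : Continuous X) {δ : ℝ} (hδ : 0 < δ) {z : ℂ} (hz : δ ≤ z.im) {y : ℝ → ℂ}
    (hy : Continuous y) {B : ℝ} (hB : ∀ t, ‖y t‖ ≤ B) {η : ℝ} (hη : 0 ≤ η)
    (hres : ∀ t, ‖y t - ∫ s, ((jostKernel (s - t) * A s : ℝ) : ℂ) * (((X s : ℂ) - z)⁻¹ * y s)‖ ≤ η)
    (t : ℝ) : ‖y t‖ ≤ 2 * η * Real.exp (1 / (2 * δ) * ∫ s, |A s|) := by
  -- With resolvent bound `1 / δ`, the weighted operator has norm at most `(1 / (4κ)) (1 / δ) =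
  -- 1/2`. Inverting `1 - T r` then costs the factor `2`, and removing the weight costs the
  -- exponential.
  set κ := 1 / (2 * δ) with hκ
  have hκ0 : 0 < κ := by positivity
  obtain ⟨T, hT, hTn⟩ := exists_volterra_operator hc hi hκ0
  have hN := continuous_tailMass hc hi
  have hB0 : 0 ≤ B := (norm_nonneg _).trans (hB 0)
  have he1 : ∀ t, Real.exp (-κ * tailMass A t) ≤ 1 := fun t => by
    rw [Real.exp_le_one_iff]; nlinarith [tailMass_nonneg (A := A) t]
  have hrc : Continuous fun s => ((X s : ℂ) - z)⁻¹ :=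
    ((Complex.continuous_ofReal.comp hX).sub continuous_const).inv₀
      fun s => ofReal_sub_ne_zero (hδ.trans_le hz) _
  have hec : Continuous fun t => ((Real.exp (-κ * tailMass A t) : ℝ) : ℂ) :=
    Complex.continuous_ofReal.comp (by fun_prop)
  let u : BoundedContinuousFunction ℝ ℂ := BoundedContinuousFunction.ofNormedAddCommGroup
    (fun t => ((Real.exp (-κ * tailMass A t) : ℝ) : ℂ) * y t) (hec.mul hy) B fun t => by
      rw [norm_mul, Complex.norm_real, Real.norm_eq_abs, Real.abs_exp]
      exact (mul_le_of_le_one_left (norm_nonneg _) (he1 t)).trans (hB t)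
  let r : BoundedContinuousFunction ℝ ℂ := BoundedContinuousFunction.ofNormedAddCommGroup
    (fun s => ((X s : ℂ) - z)⁻¹) hrc (1 / δ) fun s => norm_inv_ofReal_sub_le hδ hz _
  have hrn : ‖r‖ ≤ 1 / δ := BoundedContinuousFunction.norm_ofNormedAddCommGroup_le _
    (by positivity) _
  have hut : ∀ t, u t - T (r * u) t = ((Real.exp (-κ * tailMass A t) : ℝ) : ℂ) *
      (y t - ∫ s, ((jostKernel (s - t) * A s : ℝ) : ℂ) * (((X s : ℂ) - z)⁻¹ * y s)) := by
    intro t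
    rw [hT, mul_sub, ← integral_const_mul]
    congr 1
    congr 1 with s
    have h1 : (r * u) s = ((X s : ℂ) - z)⁻¹ * (((Real.exp (-κ * tailMass A s) : ℝ) : ℂ) * y s) := rfl
    have h2 : Real.exp (κ * (tailMass A s - tailMass A t)) * Real.exp (-κ * tailMass A s)
        = Real.exp (-κ * tailMass A t) := by
      rw [← Real.exp_add]; ring_nf
    rw [h1, ← h2]
    push_cast
    ring
  have hle : ‖u - T (r * u)‖ ≤ η := by
    refine (BoundedContinuousFunction.norm_le hη).2 fun t => ?_
    have h1 : (u - T (r * u)) t = u t - T (r * u) t := rfl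
    rw [h1, hut, norm_mul, Complex.norm_real, Real.norm_eq_abs, Real.abs_exp]
    exact (mul_le_of_le_one_left (norm_nonneg _) (he1 t)).trans (hres t)
  have hu : ‖u‖ ≤ 2 * η := by
    have h1 : ‖T (r * u)‖ ≤ 1 / 2 * ‖u‖ := by
      calc ‖T (r * u)‖ ≤ 1 / (4 * κ) * ‖r * u‖ := hTn _
        _ ≤ 1 / (4 * κ) * (1 / δ * ‖u‖) := by
          gcongr
          exact (norm_mul_le _ _).trans (by gcongr)
        _ = _ := by rw [hκ]; field_simp; norm_num
    have h2 := norm_sub_norm_le u (T (r * u))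
    linarith
  have h1 : ‖y t‖ = Real.exp (κ * tailMass A t) * ‖u t‖ := by
    have h2 : u t = ((Real.exp (-κ * tailMass A t) : ℝ) : ℂ) * y t := rfl
    rw [h2, norm_mul, Complex.norm_real, Real.norm_eq_abs, Real.abs_exp, ← mul_assoc, ← Real.exp_add]
    simp
  rw [h1, mul_comm]
  gcongr
  · exact (u.norm_coe_le_norm t).trans hu
  · exact tailMass_le hi t

/-- Gives holomorphy of the Jost solution in `z`: inversion is smooth on invertible operators. -/
theorem differentiableAt_ringInverse_apply {E : Type*} [NormedAddCommGroup E] [NormedSpace ℂ E]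
    [CompleteSpace E] {S : ℂ → E →L[ℂ] E} {z : ℂ} (hS : DifferentiableAt ℂ S z)
    (hu : IsUnit (S z)) (g : E) : DifferentiableAt ℂ (fun w => Ring.inverse (S w) g) z := by
  obtain ⟨U, hU⟩ := hu
  have h1 : ContDiffAt ℂ 1 ContinuousLinearMap.inverse (S z) := by
    rw [← hU]
    exact contDiffAt_map_inverse (ContinuousLinearEquiv.unitsEquiv ℂ E U)
  have h2 : DifferentiableAt ℂ (fun w => ContinuousLinearMap.inverse (S w)) z :=
    (h1.differentiableAt one_ne_zero).comp z hS
  have h3 := h2.clm_apply (differentiableAt_const g)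
  simpa only [ContinuousLinearMap.ringInverse_eq_inverse] using h3

/-- Jost solutions, normalized at `+∞`, exist in the half-plane `Im z > δ`, and their limit `F` at
`-∞` is holomorphic in the spectral parameter. -/
theorem exists_jost_solution (hc : Continuous A) (hi : Integrable A) {X : ℝ → ℝ}
    (hX : Continuous X) {D : ℝ} (hD : ∀ t, |X t| ≤ D) {δ : ℝ} (hδ : 0 < δ) :
    ∃ (F : ℂ → ℂ) (v : ℂ → ℝ → ℂ), DifferentiableOn ℂ F {z | δ < z.im} ∧ ∀ z : ℂ, δ < z.im →
      Continuous (v z) ∧ (∃ B, ∀ t, ‖v z t‖ ≤ B) ∧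
      (∀ t, v z t = 1 + ∫ s, ((jostKernel (s - t) * A s : ℝ) : ℂ) * (((X s : ℂ) - z)⁻¹ * v z s)) ∧
      F z = 1 + 1 / 4 * ∫ s, (A s : ℂ) * (((X s : ℂ) - z)⁻¹ * v z s) := by
  set κ := 1 / (2 * δ) with hκ
  have hκ0 : 0 < κ := by positivity
  obtain ⟨T, hT, hTn⟩ := exists_volterra_operator hc hi hκ0
  have hN := continuous_tailMass hc hi
  have he1 : ∀ t, Real.exp (-κ * tailMass A t) ≤ 1 := fun t => by
    rw [Real.exp_le_one_iff]; nlinarith [tailMass_nonneg (A := A) t]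
  have hec : Continuous fun t => ((Real.exp (-κ * tailMass A t) : ℝ) : ℂ) :=
    Complex.continuous_ofReal.comp (by fun_prop)
  let g : BoundedContinuousFunction ℝ ℂ := BoundedContinuousFunction.ofNormedAddCommGroup
    (fun t => ((Real.exp (-κ * tailMass A t) : ℝ) : ℂ)) hec 1 fun t => by
      rw [Complex.norm_real, Real.norm_eq_abs, Real.abs_exp]; exact he1 t
  let Xb : BoundedContinuousFunction ℝ ℂ := BoundedContinuousFunction.ofNormedAddCommGroup
    (fun s => (X s : ℂ)) (Complex.continuous_ofReal.comp hX) D fun s => by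
      rw [Complex.norm_real]; exact hD s
  let r : ℂ → BoundedContinuousFunction ℝ ℂ := fun z =>
    Ring.inverse (Xb - z • (1 : BoundedContinuousFunction ℝ ℂ))
  have hXz : ∀ z : ℂ, δ < z.im → IsUnit (Xb - z • (1 : BoundedContinuousFunction ℝ ℂ)) ∧
      (∀ s, r z s = ((X s : ℂ) - z)⁻¹) ∧ ‖r z‖ ≤ 1 / δ := by
    intro z hz
    have hrc : Continuous fun s => ((X s : ℂ) - z)⁻¹ :=
      ((Complex.continuous_ofReal.comp hX).sub continuous_const).inv₀
        fun s => ofReal_sub_ne_zero (hδ.trans hz) _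
    let q : BoundedContinuousFunction ℝ ℂ := BoundedContinuousFunction.ofNormedAddCommGroup
      (fun s => ((X s : ℂ) - z)⁻¹) hrc (1 / δ) fun s => norm_inv_ofReal_sub_le hδ hz.le _
    have h1 : (Xb - z • (1 : BoundedContinuousFunction ℝ ℂ)) * q = 1 := by
      ext s
      have : ((Xb - z • (1 : BoundedContinuousFunction ℝ ℂ)) * q) s
          = ((X s : ℂ) - z • 1) * ((X s : ℂ) - z)⁻¹ := rfl
      rw [this, smul_eq_mul, mul_one, mul_inv_cancel₀ (ofReal_sub_ne_zero (hδ.trans hz) _)]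
      rfl
    let U : (BoundedContinuousFunction ℝ ℂ)ˣ := ⟨_, q, h1, by rw [mul_comm, h1]⟩
    have h2 : r z = q := Ring.inverse_unit U
    refine ⟨U.isUnit, fun s => by rw [h2]; rfl, ?_⟩
    rw [h2]
    exact BoundedContinuousFunction.norm_ofNormedAddCommGroup_le _ (by positivity) _
  -- In the weighted unknown `u = e^{-κN} v`, where `N = tailMass A`, the Volterra equation reads `S
  -- z u = g`. The multiplier `r z` is itself an inverse in the algebra of bounded continuous
  -- functions, so `S` is holomorphic.
  let S : ℂ → (BoundedContinuousFunction ℝ ℂ →L[ℂ] BoundedContinuousFunction ℝ ℂ) := fun z =>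
    1 - T ∘L (ContinuousLinearMap.mul ℂ (BoundedContinuousFunction ℝ ℂ) (r z))
  have hTn' : ‖T‖ ≤ 1 / (4 * κ) := T.opNorm_le_bound (by positivity) hTn
  have hS : ∀ z : ℂ, δ < z.im → IsUnit (S z) := by
    intro z hz
    have hlt : ‖T ∘L (ContinuousLinearMap.mul ℂ (BoundedContinuousFunction ℝ ℂ) (r z))‖ < 1 := by
      calc ‖T ∘L (ContinuousLinearMap.mul ℂ (BoundedContinuousFunction ℝ ℂ) (r z))‖
          ≤ ‖T‖ * ‖ContinuousLinearMap.mul ℂ (BoundedContinuousFunction ℝ ℂ) (r z)‖ :=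
            ContinuousLinearMap.opNorm_comp_le _ _
        _ ≤ 1 / (4 * κ) * (1 / δ) := by
            gcongr
            exact (ContinuousLinearMap.opNorm_mul_apply_le ℂ _ (r z)).trans (hXz z hz).2.2
        _ = 1 / 2 := by rw [hκ]; field_simp; norm_num
        _ < 1 := by norm_num
    exact isUnit_one_sub_of_norm_lt_one hlt
  let u : ℂ → BoundedContinuousFunction ℝ ℂ := fun z => Ring.inverse (S z) g
  have hu : ∀ z : ℂ, δ < z.im → u z - T (r z * u z) = g := by
    intro z hz
    have h1 : (S z * Ring.inverse (S z)) g = g := by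
      rw [Ring.mul_inverse_cancel _ (hS z hz)]; rfl
    exact h1
  have hAe : Integrable fun s => ((A s * Real.exp (κ * tailMass A s) : ℝ) : ℂ) := by
    refine (hi.mul_bdd (c := Real.exp (κ * ∫ s, |A s|))
      (g := fun s => Real.exp (κ * tailMass A s))
      (Continuous.aestronglyMeasurable (by fun_prop)) (.of_forall fun s => ?_)).ofReal
    rw [Real.norm_eq_abs, Real.abs_exp]
    gcongr
    exact tailMass_le hi s
  have hli : ∀ h : BoundedContinuousFunction ℝ ℂ,
      Integrable fun s => ((A s * Real.exp (κ * tailMass A s) : ℝ) : ℂ) * h s := fun h =>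
    hAe.mul_bdd (c := ‖h‖) h.continuous.aestronglyMeasurable
      (.of_forall fun s => h.norm_coe_le_norm s)
  -- The bounded functional giving `∫ A v / (X - z)` in terms of `r z * u z`; the factor `e^{κN}`
  -- undoes the weight.
  let l₀ : BoundedContinuousFunction ℝ ℂ →ₗ[ℂ] ℂ :=
    { toFun := fun h => ∫ s, ((A s * Real.exp (κ * tailMass A s) : ℝ) : ℂ) * h s
      map_add' := by
        intro h k
        simp only [BoundedContinuousFunction.add_apply, mul_add]
        exact integral_add (hli h) (hli k)
      map_smul' := by
        intro c h
        simp only [BoundedContinuousFunction.smul_apply, RingHom.id_apply, smul_eq_mul]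
        rw [← integral_const_mul]
        congr 1 with s
        ring }
  let l := l₀.mkContinuous (∫ s, ‖((A s * Real.exp (κ * tailMass A s) : ℝ) : ℂ)‖) fun h => by
    rw [← integral_mul_const]
    refine norm_integral_le_of_norm_le (hAe.norm.mul_const _) (.of_forall fun s => ?_)
    rw [norm_mul]
    gcongr
    exact h.norm_coe_le_norm s
  refine ⟨fun z => 1 + 1 / 4 * l (r z * u z),
    fun z t => ((Real.exp (κ * tailMass A t) : ℝ) : ℂ) * u z t, ?_, fun z hz => ⟨?_, ?_, ?_, ?_⟩⟩
  · intro z hz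
    refine DifferentiableAt.differentiableWithinAt ?_
    have hr : DifferentiableAt ℂ r z := by
      have h1 : DifferentiableAt ℂ
          (fun z : ℂ => Xb - z • (1 : BoundedContinuousFunction ℝ ℂ)) z := by fun_prop
      exact DifferentiableAt.comp (f := fun z : ℂ => Xb - z • (1 : BoundedContinuousFunction ℝ ℂ)) z
        (differentiableAt_inverse (hXz z hz).1) h1
    have hSd : DifferentiableAt ℂ S z := by
      have h1 : DifferentiableAt ℂ
          (fun z => T ∘L (ContinuousLinearMap.mul ℂ (BoundedContinuousFunction ℝ ℂ) (r z))) z :=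
        (((ContinuousLinearMap.compL ℂ _ _ _ T).comp
          (ContinuousLinearMap.mul ℂ (BoundedContinuousFunction ℝ ℂ))).differentiableAt).comp z hr
      exact h1.const_sub 1
    have hud : DifferentiableAt ℂ u z :=
       differentiableAt_ringInverse_apply hSd (hS z hz) g
    have hlu : DifferentiableAt ℂ (fun z => l (r z * u z)) z :=
      DifferentiableAt.comp (f := fun z => r z * u z) z l.differentiableAt (hr.mul hud)
    exact (hlu.const_mul _).const_add _
  · exact (Complex.continuous_ofReal.comp (by fun_prop)).mul (u z).continuous
  · refine ⟨Real.exp (κ * ∫ s, |A s|) * ‖u z‖, fun t => ?_⟩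
    rw [norm_mul, Complex.norm_real, Real.norm_eq_abs, Real.abs_exp]
    gcongr
    · exact tailMass_le hi t
    · exact (u z).norm_coe_le_norm t
  · intro t
    have h1 : u z t = g t + T (r z * u z) t := by
      rw [← hu z hz]
      simp
    have h2 : g t = ((Real.exp (-κ * tailMass A t) : ℝ) : ℂ) := rfl
    beta_reduce
    rw [h1, mul_add, h2, ← Complex.ofReal_mul, ← Real.exp_add, hT, ← integral_const_mul]
    congr 1
    · simp
    · congr 1 with s
      have h3 : (r z * u z) s = ((X s : ℂ) - z)⁻¹ * u z s := by
        rw [← (hXz z hz).2.1 s]; rfl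
      have h4 : Real.exp (κ * tailMass A t) * Real.exp (κ * (tailMass A s - tailMass A t))
          = Real.exp (κ * tailMass A s) := by
        rw [← Real.exp_add]; ring_nf
      rw [h3, ← h4]
      push_cast
      ring
  · have hl : l (r z * u z)
        = ∫ s, ((A s * Real.exp (κ * tailMass A s) : ℝ) : ℂ) * (r z * u z) s := rfl
    beta_reduce
    rw [hl]
    congr 2
    refine integral_congr_ae (.of_forall fun s => ?_)
    have h3 : (r z * u z) s = ((X s : ℂ) - z)⁻¹ * u z s := by
      rw [← (hXz z hz).2.1 s]; rfl
    simp only [h3]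
    push_cast
    ring

end Jost

/-! ### Zeros of the Jost function give square integrable solutions. -/

section JostMode

theorem hasWeakDeriv_of_hasDerivAt {u v : ℝ → ℂ} (hu : ∀ t, HasDerivAt u (v t) t)
    (hv : Continuous v) : HasWeakDeriv u v := by
  have huc : Continuous u := continuous_iff_continuousAt.2 fun t => (hu t).continuousAt
  refine ⟨huc.locallyIntegrable, hv.locallyIntegrable, fun η hη hηc => ?_⟩
  have hη' : ContDiff ℝ ∞ (deriv η) := (contDiff_infty_iff_deriv.1 hη).2
  have i1 : Integrable fun t => deriv η t • u t :=
    (hη'.continuous.smul huc).integrable_of_hasCompactSupport hηc.deriv.smul_right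
  have i2 : Integrable fun t => η t • v t :=
    (hη.continuous.smul hv).integrable_of_hasCompactSupport hηc.smul_right
  have i3 : Integrable fun t => η t • u t :=
    (hη.continuous.smul huc).integrable_of_hasCompactSupport hηc.smul_right
  have h0 : ∫ t, (η t • v t + deriv η t • u t) = 0 :=
    integral_eq_zero_of_hasDerivAt_of_integrable
      (fun t => ((hη.differentiable (by simp) t).hasDerivAt.smul (hu t))) (i2.add i1) i3
  rw [integral_add i2 i1] at h0
  exact eq_neg_of_add_eq_zero_right h0

theorem memL2Loc_of_continuous {f : ℝ → ℂ} (hf : Continuous f) : MemL2Loc f := by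
  intro K hK
  obtain ⟨C, hC⟩ := hK.exists_bound_of_continuousOn hf.continuousOn
  have : IsFiniteMeasure (volume.restrict K) :=
    ⟨by rw [Measure.restrict_apply_univ]; exact hK.measure_lt_top⟩
  exact MemLp.of_bound hf.aestronglyMeasurable C
    ((ae_restrict_iff' hK.measurableSet).2 (.of_forall hC))

/-- Exponential decay at `-∞` is preserved by the Green operator (up to the factor `e^{2t}`). -/
theorem norm_halfline_integrals_le {g : ℝ → ℂ} {C β : ℝ} (hβ : 0 < β) (hβ4 : β < 4)
    (hg : ∀ s, ‖g s‖ ≤ C * Real.exp (β * s)) (t : ℝ) :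
    ‖∫ s in Set.Iic t, g s‖ + Real.exp (4 * t) * ‖∫ s in Set.Ioi t, Real.exp (-4 * s) • g s‖
      ≤ C * (1 / β + 1 / (4 - β)) * Real.exp (β * t) := by
  have h1 : ‖∫ s in Set.Iic t, g s‖ ≤ C * (Real.exp (β * t) / β) := by
    rw [← integral_exp_mul_Iic hβ, ← integral_const_mul]
    exact norm_integral_le_of_norm_le ((integrableOn_exp_mul_Iic hβ t).const_mul C) (.of_forall hg)
  have h2 : ‖∫ s in Set.Ioi t, Real.exp (-4 * s) • g s‖
      ≤ C * (-Real.exp ((β - 4) * t) / (β - 4)) := by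
    rw [← integral_exp_mul_Ioi (by linarith : β - 4 < 0), ← integral_const_mul]
    refine norm_integral_le_of_norm_le
      ((integrableOn_exp_mul_Ioi (by linarith : β - 4 < 0) t).const_mul C) (.of_forall fun s => ?_)
    rw [norm_smul, Real.norm_eq_abs, Real.abs_exp]
    calc Real.exp (-4 * s) * ‖g s‖ ≤ Real.exp (-4 * s) * (C * Real.exp (β * s)) := by
          gcongr; exact hg s
      _ = C * (Real.exp (-4 * s) * Real.exp (β * s)) := by ring
      _ = _ := by rw [← Real.exp_add]; ring_nf
  have h3 : Real.exp (4 * t) * Real.exp ((β - 4) * t) = Real.exp (β * t) := by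
    rw [← Real.exp_add]; ring_nf
  have h4 : Real.exp (4 * t) * ‖∫ s in Set.Ioi t, Real.exp (-4 * s) • g s‖
      ≤ C * (Real.exp (β * t) / (4 - β)) := by
    calc _ ≤ Real.exp (4 * t) * (C * (-Real.exp ((β - 4) * t) / (β - 4))) := by gcongr
      _ = C * ((Real.exp (4 * t) * Real.exp ((β - 4) * t)) / (4 - β)) := by
        have : β - 4 ≠ 0 := by linarith
        have : 4 - β ≠ 0 := by linarith
        field_simp
        ring
      _ = _ := by rw [h3]
  calc _ ≤ C * (Real.exp (β * t) / β) + C * (Real.exp (β * t) / (4 - β)) := add_le_add h1 h4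
    _ = _ := by ring

/-- A zero of the Jost function in the upper half-plane is an unstable parameter for `m = 2`. -/
theorem mem_unstableSet_of_jost {X : ℝ → ℝ} (hX : Continuous X) (hA : Continuous (rayleighA X))
    (hi : Integrable (rayleighA X)) {C : ℝ}
    (hC : ∀ s, |rayleighA X s| ≤ C * Real.exp (3 / 2 * s)) {z : ℂ} (hz : 0 < z.im) {v : ℝ → ℂ}
    (hv : Continuous v) {B : ℝ} (hB : ∀ t, ‖v t‖ ≤ B)
    (hvol : ∀ t, v t = 1 + ∫ s, ((jostKernel (s - t) * rayleighA X s : ℝ) : ℂ) *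
      (((X s : ℂ) - z)⁻¹ * v s))
    (hF : 1 + 1 / 4 * ∫ s, (rayleighA X s : ℂ) * (((X s : ℂ) - z)⁻¹ * v s) = 0) :
    z ∈ unstableSet X 2 := by
  set A := rayleighA X
  have hrc : Continuous fun s => ((X s : ℂ) - z)⁻¹ :=
    ((Complex.continuous_ofReal.comp hX).sub continuous_const).inv₀
      fun s => ofReal_sub_ne_zero hz _
  have hr := fun s => norm_inv_ofReal_sub_le hz le_rfl (X s)
  set g : ℝ → ℂ := fun s => (A s : ℂ) * (((X s : ℂ) - z)⁻¹ * v s) with hg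
  have hgc : Continuous g := (Complex.continuous_ofReal.comp hA).mul (hrc.mul hv)
  have hB0 : 0 ≤ B := (norm_nonneg _).trans (hB 0)
  have hgi : Integrable g := hi.ofReal.mul_bdd (c := 1 / z.im * B)
    (hrc.mul hv).aestronglyMeasurable (.of_forall fun s => by
      rw [norm_mul]; gcongr
      · exact hr s
      · exact hB s)
  have hgA : ∀ s, ‖g s‖ ≤ C * Real.exp (3 / 2 * s) * (1 / z.im) * ‖v s‖ := by
    intro s
    rw [hg]
    simp only [norm_mul, Complex.norm_real, Real.norm_eq_abs, ← mul_assoc]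
    gcongr
    · exact (abs_nonneg _).trans (hC s)
    · exact hC s
    · exact hr s
  have hgi4 : ∀ t, IntegrableOn (fun s => Real.exp (-4 * s) • g s) (Set.Ioi t) := by
    intro t
    refine ((hgi.norm.const_mul (Real.exp (-4 * t))).integrableOn (s := Set.Ioi t)).mono'
      (Continuous.aestronglyMeasurable (by fun_prop))
      ((ae_restrict_iff' measurableSet_Ioi).2 (.of_forall fun s hs => ?_))
    rw [norm_smul, Real.norm_eq_abs, Real.abs_exp]
    gcongr ?_ * _
    exact Real.exp_le_exp.2 (by linarith [Set.mem_Ioi.1 hs])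
  set I : ℝ → ℂ := fun t => ∫ s in Set.Iic t, g s with hI
  set J : ℝ → ℂ := fun t => ∫ s in Set.Ioi t, Real.exp (-4 * s) • g s with hJ
  -- When the Jost function vanishes, the constant `1` can be absorbed by replacing the kernel `k`
  -- with `k - 1/4`. This kernel is `-1/4` for `s ≤ t` and `-e^{-4(s-t)}/4` for `s > t`.
  have hIJ : ∀ t, v t = -(1 / 4) * (I t + (Real.exp (4 * t) : ℝ) * J t) := by
    intro t
    have h1 : v t = ∫ s, (((jostKernel (s - t) - 1 / 4 : ℝ)) : ℂ) * g s := by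
      have i1 : Integrable fun s => ((jostKernel (s - t) : ℝ) : ℂ) * g s :=
        hgi.bdd_mul (c := 1 / 4) (Complex.continuous_ofReal.comp
          (continuous_jostKernel.comp (by fun_prop))).aestronglyMeasurable (.of_forall fun s => by
            rw [Complex.norm_real, Real.norm_of_nonneg (jostKernel_nonneg _)]
            exact jostKernel_le _)
      have e1 : ∀ s, (((jostKernel (s - t) - 1 / 4 : ℝ)) : ℂ) * g s
          = ((jostKernel (s - t) : ℝ) : ℂ) * g s - 1 / 4 * g s := by
        intro s; push_cast; ring
      simp only [e1]
      rw [integral_sub i1 (hgi.const_mul _), integral_const_mul, hvol t]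
      have e2 : ∫ s, ((jostKernel (s - t) * A s : ℝ) : ℂ) * (((X s : ℂ) - z)⁻¹ * v s)
          = ∫ s, ((jostKernel (s - t) : ℝ) : ℂ) * g s := by
        congr 1 with s
        rw [hg]; push_cast; ring
      rw [e2]
      linear_combination hF
    have i2 : Integrable fun s => (((jostKernel (s - t) - 1 / 4 : ℝ)) : ℂ) * g s :=
      hgi.bdd_mul (c := 1 / 4) (Complex.continuous_ofReal.comp
        ((continuous_jostKernel.comp (by fun_prop)).sub continuous_const)).aestronglyMeasurable
        (.of_forall fun s => by
          rw [Complex.norm_real, Real.norm_eq_abs, abs_le]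
          constructor <;> linarith [jostKernel_nonneg (s - t), jostKernel_le (s - t)])
    rw [h1, ← integral_add_compl (measurableSet_Iic (a := t)) i2, Set.compl_Iic, mul_add]
    congr 1
    · rw [hI, ← integral_const_mul]
      refine setIntegral_congr_fun measurableSet_Iic fun s hs => ?_
      simp only [jostKernel_of_nonpos (sub_nonpos.2 (Set.mem_Iic.1 hs))]
      push_cast; ring
    · rw [hJ, ← integral_const_mul, ← integral_const_mul]
      refine setIntegral_congr_fun measurableSet_Ioi fun s hs => ?_
      have h2 : max (s - t) 0 = s - t := max_eq_left (sub_nonneg.2 (le_of_lt hs))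
      have h3 : Real.exp (-4 * (s - t)) = Real.exp (4 * t) * Real.exp (-4 * s) := by
        rw [← Real.exp_add]; ring_nf
      simp only [jostKernel, h2, h3, Complex.real_smul]
      push_cast; ring
  -- A decay rate `β` of `g` at `-∞` passes to `v` as long as `0 < β < 4`, and `g` gains `3/2` over
  -- `v` from the bound on `A`. Two rounds take `v` from bounded to rate `3/2` and then to `3`. A
  -- rate above `2` is needed for `φ = e^{-2t} v` to decay, and gains of `2` would reach the
  -- excluded rate `4`.
  have hboot : ∀ {D β : ℝ}, 0 < β → β < 4 → (∀ s, ‖g s‖ ≤ D * Real.exp (β * s)) →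
      ∀ t, ‖v t‖ ≤ D * (1 / β + 1 / (4 - β)) * Real.exp (β * t) := by
    intro D β h0 h4 hD t
    refine le_trans ?_ (norm_halfline_integrals_le h0 h4 hD t)
    rw [hIJ t, norm_mul]
    have h1 : ‖I t + (Real.exp (4 * t) : ℝ) * J t‖ ≤ ‖I t‖ + Real.exp (4 * t) * ‖J t‖ := by
      refine (norm_add_le _ _).trans ?_
      rw [norm_mul, Complex.norm_real, Real.norm_eq_abs, Real.abs_exp]
    have h2 : ‖(-(1 / 4) : ℂ)‖ ≤ 1 := by norm_num
    exact (mul_le_of_le_one_left (norm_nonneg _) h2).trans h1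
  have hC0 : 0 ≤ C := by
    have := (abs_nonneg _).trans (hC 0)
    simpa using this
  obtain ⟨D₁, hD₁⟩ : ∃ D, ∀ t, ‖v t‖ ≤ D * Real.exp (3 / 2 * t) := by
    refine ⟨_, hboot (D := C * (1 / z.im) * B) (β := 3 / 2) (by norm_num) (by norm_num)
      fun s => (hgA s).trans ?_⟩
    calc C * Real.exp (3 / 2 * s) * (1 / z.im) * ‖v s‖
        ≤ C * Real.exp (3 / 2 * s) * (1 / z.im) * B := by gcongr; exact hB s
      _ = _ := by ring
  obtain ⟨D₂, hD₂⟩ : ∃ D, ∀ t, ‖v t‖ ≤ D * Real.exp (3 * t) := by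
    refine ⟨_, hboot (D := C * (1 / z.im) * D₁) (β := 3) (by norm_num) (by norm_num)
      fun s => (hgA s).trans ?_⟩
    calc C * Real.exp (3 / 2 * s) * (1 / z.im) * ‖v s‖
        ≤ C * Real.exp (3 / 2 * s) * (1 / z.im) * (D₁ * Real.exp (3 / 2 * s)) := by
          gcongr; exact hD₁ s
      _ = C * (1 / z.im) * D₁ * (Real.exp (3 / 2 * s) * Real.exp (3 / 2 * s)) := by ring
      _ = _ := by rw [← Real.exp_add]; ring_nf
  have hD₂0 : 0 ≤ D₂ := by
    have := (norm_nonneg _).trans (hD₂ 0)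
    simpa using this
  set φ : ℝ → ℂ := fun t => (Real.exp (-2 * t) : ℝ) * v t with hφ
  have hφc : Continuous φ := (Complex.continuous_ofReal.comp (by fun_prop)).mul hv
  have hexp : ∀ k t : ℝ, HasDerivAt (fun t : ℝ => ((Real.exp (k * t) : ℝ) : ℂ))
      ((k * Real.exp (k * t) : ℝ) : ℂ) t := by
    intro k t
    have h1 : HasDerivAt (fun t : ℝ => Real.exp (k * t)) (k * Real.exp (k * t)) t := by
      simpa [mul_comm] using ((hasDerivAt_id t).const_mul k).exp
    exact h1.ofReal_comp
  have hId : ∀ t, HasDerivAt I (g t) t :=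
    fun t => hasDerivAt_integral_Iic hgc (fun _ => hgi.integrableOn) t
  have hJd : ∀ t, HasDerivAt J (-(Real.exp (-4 * t) • g t)) t :=
    fun t => hasDerivAt_integral_Ioi (by fun_prop) hgi4 t
  have hIc : Continuous I := continuous_iff_continuousAt.2 fun t => (hId t).continuousAt
  have hJc : Continuous J := continuous_iff_continuousAt.2 fun t => (hJd t).continuousAt
  have e24 : ∀ t : ℝ, Real.exp (2 * t) * Real.exp (-4 * t) = Real.exp (-2 * t) := by
    intro t; rw [← Real.exp_add]; ring_nf
  have hφIJ : φ = fun t => -(1 / 4) * ((Real.exp (-2 * t) : ℝ) * I t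
      + (Real.exp (2 * t) : ℝ) * J t) := by
    ext t
    have h1 : Real.exp (2 * t) = Real.exp (-2 * t) * Real.exp (4 * t) := by
      rw [← Real.exp_add]; ring_nf
    rw [hφ, h1]
    simp only [hIJ t]
    push_cast
    ring
  set φ₁ : ℝ → ℂ := fun t => 1 / 2 * ((Real.exp (-2 * t) : ℝ) * I t
      - (Real.exp (2 * t) : ℝ) * J t) with hφ₁
  have hφ₁c : Continuous φ₁ := by
    have : ∀ k : ℝ, Continuous fun t : ℝ => ((Real.exp (k * t) : ℝ) : ℂ) :=
      fun k => Complex.continuous_ofReal.comp (by fun_prop)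
    exact continuous_const.mul (((this _).mul hIc).sub ((this _).mul hJc))
  set φ₂ : ℝ → ℂ := fun t => 4 * φ t + (A t : ℂ) / ((X t : ℂ) - z) * φ t with hφ₂
  have hφ₂c : Continuous φ₂ := by
    refine (continuous_const.mul hφc).add (Continuous.mul ?_ hφc)
    simp only [div_eq_mul_inv]
    exact (Complex.continuous_ofReal.comp hA).mul hrc
  have hd1 : ∀ t, HasDerivAt φ (φ₁ t) t := by
    intro t
    rw [hφIJ]
    refine ((((hexp (-2) t).mul (hId t)).add ((hexp 2 t).mul (hJd t))).const_mul
      (-(1 / 4))).congr_deriv ?_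
    rw [hφ₁]
    simp only [Complex.real_smul]
    have := congrArg (fun x : ℝ => (x : ℂ)) (e24 t)
    push_cast at this ⊢
    linear_combination (1 / 4 * g t) * this
  have hd2 : ∀ t, HasDerivAt φ₁ (φ₂ t) t := by
    intro t
    refine ((((hexp (-2) t).mul (hId t)).sub ((hexp 2 t).mul (hJd t))).const_mul
      (1 / 2)).congr_deriv ?_
    have h1 : (A t : ℂ) / ((X t : ℂ) - z) * φ t = (Real.exp (-2 * t) : ℝ) * g t := by
      rw [hg, hφ, div_eq_mul_inv]; ring
    rw [hφ₂]
    simp only [h1]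
    rw [hφIJ]
    simp only [Complex.real_smul]
    have := congrArg (fun x : ℝ => (x : ℂ)) (e24 t)
    push_cast at this ⊢
    linear_combination (1 / 2 * g t) * this
  refine ⟨hz, φ, ⟨?_, φ₁, φ₂, ⟨hasWeakDeriv_of_hasDerivAt hd1 hφ₁c,
    hasWeakDeriv_of_hasDerivAt hd2 hφ₂c, memL2Loc_of_continuous hφc, memL2Loc_of_continuous hφ₁c,
    memL2Loc_of_continuous hφ₂c⟩, .of_forall fun t => ?_⟩, fun h0 => ?_⟩
  · refine ((memLp_exp_neg_mul_abs one_pos).const_mul (D₂ + B)).mono hφc.aestronglyMeasurable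
      (.of_forall fun t => ?_)
    rw [hφ, norm_mul, Complex.norm_real, Real.norm_eq_abs, Real.abs_exp,
      Real.norm_of_nonneg (by positivity)]
    rcases le_total t 0 with ht | ht
    · rw [abs_of_nonpos ht]
      calc Real.exp (-2 * t) * ‖v t‖ ≤ Real.exp (-2 * t) * (D₂ * Real.exp (3 * t)) := by
            gcongr; exact hD₂ t
        _ = D₂ * (Real.exp (-2 * t) * Real.exp (3 * t)) := by ring
        _ = D₂ * Real.exp (-1 * -t) := by rw [← Real.exp_add]; ring_nf
        _ ≤ (D₂ + B) * Real.exp (-1 * -t) := by gcongr; linarith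
    · rw [abs_of_nonneg ht]
      calc Real.exp (-2 * t) * ‖v t‖ ≤ Real.exp (-1 * t) * B := by
            gcongr
            · linarith
            · exact hB t
        _ = B * Real.exp (-1 * t) := mul_comm _ _
        _ ≤ (D₂ + B) * Real.exp (-1 * t) := by gcongr; linarith
  · rw [hφ₂]
    push_cast
    ring
  -- If `φ` vanished so would `v`, and the Volterra equation would read `0 = 1`.
  · have hφ0 : φ = 0 := (hφc.ae_eq_iff_eq volume continuous_zero).1 h0
    have hv0 : ∀ t, v t = 0 := by
      intro t
      have h1 : ((Real.exp (-2 * t) : ℝ) : ℂ) * v t = 0 := congrFun hφ0 t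
      rcases mul_eq_zero.1 h1 with h | h
      · exact absurd (Complex.ofReal_eq_zero.1 h) (Real.exp_pos _).ne'
      · exact h
    simp [hv0] at hvol

end JostMode

/-! ### The two-interface vortex and the stability of its unstable mode. -/

section TwoDeltas

/-- `h` is bounded by `K` and `K`-Lipschitz. -/
def BddLip (h : ℝ → ℂ) (K : ℝ) : Prop :=
  (∀ t, ‖h t‖ ≤ K) ∧ ∀ s t, ‖h s - h t‖ ≤ K * |s - t|

namespace BddLip

variable {h g : ℝ → ℂ} {K L : ℝ}

theorem nonneg (hh : BddLip h K) : 0 ≤ K := (norm_nonneg _).trans (hh.1 0)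

theorem continuous (hh : BddLip h K) : Continuous h := by
  have : LipschitzWith K.toNNReal h := LipschitzWith.of_dist_le_mul fun s t => by
    rw [dist_eq_norm, Real.dist_eq, Real.coe_toNNReal _ hh.nonneg]
    exact hh.2 s t
  exact this.continuous

theorem add (hh : BddLip h K) (hg : BddLip g L) : BddLip (fun t => h t + g t) (K + L) := by
  refine ⟨fun t => (norm_add_le _ _).trans (add_le_add (hh.1 t) (hg.1 t)), fun s t => ?_⟩
  calc ‖h s + g s - (h t + g t)‖ = ‖(h s - h t) + (g s - g t)‖ := by congr 1; ring
    _ ≤ K * |s - t| + L * |s - t| := (norm_add_le _ _).trans (add_le_add (hh.2 s t) (hg.2 s t))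
    _ = _ := by ring

theorem mul (hh : BddLip h K) (hg : BddLip g L) : BddLip (fun t => h t * g t) (2 * K * L) := by
  have hK := hh.nonneg
  have hL := hg.nonneg
  refine ⟨fun t => ?_, fun s t => ?_⟩
  · rw [norm_mul]
    calc ‖h t‖ * ‖g t‖ ≤ K * L := by
          gcongr
          · exact hh.1 t
          · exact hg.1 t
      _ ≤ _ := by nlinarith [mul_nonneg hK hL]
  · calc ‖h s * g s - h t * g t‖ = ‖(h s - h t) * g s + h t * (g s - g t)‖ := by congr 1; ring
      _ ≤ ‖h s - h t‖ * ‖g s‖ + ‖h t‖ * ‖g s - g t‖ := by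
          rw [← norm_mul, ← norm_mul]; exact norm_add_le _ _
      _ ≤ (K * |s - t|) * L + K * (L * |s - t|) := by
          gcongr
          · exact hh.2 s t
          · exact hg.1 s
          · exact hh.1 t
          · exact hg.2 s t
      _ = _ := by ring

theorem const (c : ℂ) (hc : ‖c‖ ≤ K) : BddLip (fun _ => c) K := by
  refine ⟨fun _ => hc, fun s t => ?_⟩
  rw [sub_self, norm_zero]
  exact mul_nonneg ((norm_nonneg _).trans hc) (abs_nonneg _)

end BddLip

theorem bddLip_exp_max (t : ℝ) :
    BddLip (fun r => ((Real.exp (-2 * max (t - r) 0) : ℝ) : ℂ)) 2 := by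
  refine ⟨fun r => ?_, fun r s => ?_⟩
  · rw [Complex.norm_real, Real.norm_eq_abs, Real.abs_exp]
    have : Real.exp (-2 * max (t - r) 0) ≤ 1 := by
      rw [Real.exp_le_one_iff]; nlinarith [le_max_right (t - r) 0]
    linarith
  · rw [← Complex.ofReal_sub, Complex.norm_real, Real.norm_eq_abs, neg_mul, neg_mul]
    refine (abs_exp_neg_sub_exp_neg_le (by positivity) (by positivity)).trans ?_
    rw [← mul_sub, abs_mul, abs_of_pos (by norm_num : (0 : ℝ) < 2)]
    refine mul_le_mul_of_nonneg_left ((abs_max_sub_max_le_abs _ _ _).trans_eq ?_) (by norm_num)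
    rw [abs_sub_comm]; congr 1; ring

theorem bddLip_jostKernel (t : ℝ) : BddLip (fun s => ((jostKernel (s - t) : ℝ) : ℂ)) 1 := by
  refine ⟨fun s => ?_, fun s r => ?_⟩
  · rw [Complex.norm_real, Real.norm_of_nonneg (jostKernel_nonneg _)]
    linarith [jostKernel_le (s - t)]
  · rw [← Complex.ofReal_sub, Complex.norm_real, Real.norm_eq_abs, one_mul]
    refine (abs_jostKernel_sub_le _ _).trans_eq ?_
    congr 1; ring

theorem bddLip_jostKernel' (a : ℝ) : BddLip (fun t => ((jostKernel (a - t) : ℝ) : ℂ)) 1 := by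
  refine ⟨fun s => ?_, fun s r => ?_⟩
  · rw [Complex.norm_real, Real.norm_of_nonneg (jostKernel_nonneg _)]
    linarith [jostKernel_le (a - s)]
  · rw [← Complex.ofReal_sub, Complex.norm_real, Real.norm_eq_abs, one_mul]
    refine (abs_jostKernel_sub_le _ _).trans_eq ?_
    rw [abs_sub_comm]; congr 1; ring

/-- The density `A` is `η`-close to the measure `-δ_{t₁} + δ_{t₂} / 4` in the dual of bounded
Lipschitz functions. -/
structure NearDeltas (A : ℝ → ℝ) (t₁ t₂ η : ℝ) : Prop where
  continuous : Continuous A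
  integrable : Integrable A
  mass_le : ∫ s, |A s| ≤ 3
  near : ∀ (h : ℝ → ℂ) (K : ℝ), BddLip h K →
    ‖(∫ s, (A s : ℂ) * h s) - (-(h t₁) + 1 / 4 * h t₂)‖ ≤ η * K

/-- The angular velocity generated by the vorticity gradient `A`. -/
noncomputable def velocityOf (A : ℝ → ℝ) (t : ℝ) : ℝ :=
  -(1 / 2) * ∫ r, A r * Real.exp (-2 * max (t - r) 0)

/-- The angular velocity of the two-interface vortex. -/
noncomputable def patchVelocity (t₁ t₂ t : ℝ) : ℝ :=
  1 / 2 * Real.exp (-2 * max (t - t₁) 0) - 1 / 8 * Real.exp (-2 * max (t - t₂) 0)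

theorem patchVelocity_left {t₁ t₂ : ℝ} (h : t₁ ≤ t₂) : patchVelocity t₁ t₂ t₁ = 3 / 8 := by
  rw [patchVelocity, sub_self, max_self, max_eq_right (sub_nonpos.2 h)]
  norm_num

/-- The ratio `3/8` makes both interface velocities rational: `3/8` at `t₁` and `3/16 - 1/8 = 1/16`
at `t₂`. -/
theorem patchVelocity_right {t₁ t₂ : ℝ} (h : t₁ ≤ t₂) (hd : Real.exp (-2 * (t₂ - t₁)) = 3 / 8) :
    patchVelocity t₁ t₂ t₂ = 1 / 16 := by
  rw [patchVelocity, sub_self, max_self, max_eq_left (sub_nonneg.2 h), hd]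
  norm_num

theorem abs_patchVelocity_sub_le (t₁ t₂ s t : ℝ) :
    |patchVelocity t₁ t₂ s - patchVelocity t₁ t₂ t| ≤ 2 * |s - t| := by
  have key : ∀ a, |Real.exp (-2 * max (s - a) 0) - Real.exp (-2 * max (t - a) 0)|
      ≤ 2 * |s - t| := by
    intro a
    rw [neg_mul, neg_mul]
    refine (abs_exp_neg_sub_exp_neg_le (by positivity) (by positivity)).trans ?_
    rw [← mul_sub, abs_mul, abs_of_pos (by norm_num : (0 : ℝ) < 2)]
    refine mul_le_mul_of_nonneg_left ((abs_max_sub_max_le_abs _ _ _).trans_eq ?_) (by norm_num)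
    congr 1; ring
  have h1 := abs_le.1 (key t₁)
  have h2 := abs_le.1 (key t₂)
  unfold patchVelocity
  rw [abs_le]
  constructor <;> linarith [abs_nonneg (s - t)]

theorem abs_velocityOf_sub_le {A : ℝ → ℝ} {t₁ t₂ η : ℝ} (hA : NearDeltas A t₁ t₂ η) (t : ℝ) :
    |velocityOf A t - patchVelocity t₁ t₂ t| ≤ η := by
  have h := hA.near _ _ (bddLip_exp_max t)
  have h1 : (∫ s, (A s : ℂ) * ((Real.exp (-2 * max (t - s) 0) : ℝ) : ℂ))
      = ((∫ s, A s * Real.exp (-2 * max (t - s) 0) : ℝ) : ℂ) := by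
    rw [← integral_complex_ofReal]
    congr 1 with s
    push_cast; rfl
  have h2 : ((velocityOf A t - patchVelocity t₁ t₂ t : ℝ) : ℂ) = -(1 / 2) *
      ((∫ s, (A s : ℂ) * ((Real.exp (-2 * max (t - s) 0) : ℝ) : ℂ)) -
      (-((Real.exp (-2 * max (t - t₁) 0) : ℝ) : ℂ)
        + 1 / 4 * ((Real.exp (-2 * max (t - t₂) 0) : ℝ) : ℂ))) := by
    rw [h1, velocityOf, patchVelocity]
    push_cast
    ring
  rw [← Real.norm_eq_abs, ← Complex.norm_real, h2, norm_mul]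
  have h3 : ‖(-(1 / 2) : ℂ)‖ = 1 / 2 := by norm_num
  rw [h3]
  linarith

/-- The resolvent identity; `4096 = 64²` comes from `Im z ≥ 1/64`. -/
theorem norm_inv_sub_inv_le {z : ℂ} (hz : 1 / 64 ≤ z.im) (x y : ℝ) :
    ‖((x : ℂ) - z)⁻¹ - ((y : ℂ) - z)⁻¹‖ ≤ 4096 * |x - y| := by
  have hx := ofReal_sub_ne_zero (by linarith : 0 < z.im) x
  have hy := ofReal_sub_ne_zero (by linarith : 0 < z.im) y
  have bx := norm_inv_ofReal_sub_le (by norm_num : (0 : ℝ) < 1 / 64) hz x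
  have bY := norm_inv_ofReal_sub_le (by norm_num : (0 : ℝ) < 1 / 64) hz y
  have h : ((x : ℂ) - z)⁻¹ - ((y : ℂ) - z)⁻¹
      = ((x : ℂ) - z)⁻¹ * ((y : ℂ) - z)⁻¹ * ((y - x : ℝ) : ℂ) := by
    push_cast
    field_simp
    ring
  rw [h, norm_mul, norm_mul, Complex.norm_real, Real.norm_eq_abs, abs_sub_comm]
  gcongr
  calc _ ≤ (1 / (1 / 64) : ℝ) * (1 / (1 / 64)) := by gcongr
    _ = 4096 := by norm_num

/-- The Jost function of the two-interface vortex. -/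
noncomputable def patchJost (z : ℂ) : ℂ :=
  1 + 1 / 4 * (-((3 / 8 - z)⁻¹ * (1 + 1 / 4 * (55 / 256) * (1 / 16 - z)⁻¹))
    + 1 / 4 * (1 / 16 - z)⁻¹)

/-- Clearing denominators leaves `(z - 1/8)² + 9/4096`, whose discriminant is negative: this is the
instability of the model. The constant `55/256` is `jostKernel (t₂ - t₁)`, that is `(1 - (3/8)²) /
4`. -/
theorem patchJost_mul {z : ℂ} (h1 : (3 / 8 : ℂ) - z ≠ 0) (h2 : (1 / 16 : ℂ) - z ≠ 0) :
    patchJost z * ((3 / 8 - z) * (1 / 16 - z)) =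
      (z - (1 / 8 + 3 / 64 * Complex.I)) * (z - (1 / 8 - 3 / 64 * Complex.I)) := by
  have hI := Complex.I_sq
  unfold patchJost
  have e1 : (3 / 8 - z)⁻¹ * (3 / 8 - z) = 1 := inv_mul_cancel₀ h1
  have e2 : (1 / 16 - z)⁻¹ * (1 / 16 - z) = 1 := inv_mul_cancel₀ h2
  linear_combination (-(1 / 4) * (1 / 16 - z) - 55 / 4096 * (1 / 16 - z)⁻¹ * (1 / 16 - z)) * e1
    + (1 / 16 * (3 / 8 - z) - 55 / 4096) * e2 + 9 / 4096 * hI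

/-- The Jost functions of nearby densities converge uniformly to the one of the two-interface
vortex. -/
theorem exists_norm_jost_sub_le {t₁ t₂ : ℝ} (h12 : t₁ ≤ t₂)
    (hd : Real.exp (-2 * (t₂ - t₁)) = 3 / 8) :
    ∃ K : ℝ, ∀ (η : ℝ) (A : ℝ → ℝ), NearDeltas A t₁ t₂ η → Continuous (velocityOf A) →
      ∀ (z : ℂ) (v : ℝ → ℂ), 1 / 64 < z.im → Continuous v → (∃ B, ∀ t, ‖v t‖ ≤ B) →
      (∀ t, v t = 1 + ∫ s, ((jostKernel (s - t) * A s : ℝ) : ℂ) *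
        (((velocityOf A s : ℂ) - z)⁻¹ * v s)) →
      ‖(1 + 1 / 4 * ∫ s, (A s : ℂ) * (((velocityOf A s : ℂ) - z)⁻¹ * v s)) - patchJost z‖
        ≤ K * η := by
  set E := Real.exp (1 / (2 * (1 / 64)) * 3) with hE
  -- `M` is a common bound and Lipschitz constant for the model solution `v₀`. In `R`, the first
  -- term pays for replacing `A` by the point masses and the second for replacing the velocity by
  -- its model.
  set M : ℝ := 1 + 1 * (64 * 65) + 1 * 64 with hM
  set R : ℝ := 2 * 1 * (2 * 8192 * M) + 3 * (1 * (4096 * M)) with hR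
  refine ⟨1 / 4 * (3 * (64 * (2 * R * E)) + 3 * (4096 * M) + 2 * 8192 * M), ?_⟩
  intro η A hA hXc z v hz hv ⟨B, hB⟩ hvol
  have hη : 0 ≤ η := (abs_nonneg _).trans (abs_velocityOf_sub_le hA 0)
  set X := velocityOf A
  set Y := patchVelocity t₁ t₂
  have hb : ∀ x : ℝ, ‖((x : ℂ) - z)⁻¹‖ ≤ 64 := fun x => by
    have := norm_inv_ofReal_sub_le (by norm_num : (0 : ℝ) < 1 / 64) hz.le x
    norm_num at this ⊢
    exact this
  set r : ℝ → ℂ := fun s => ((X s : ℂ) - z)⁻¹ with hr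
  set r₀ : ℝ → ℂ := fun s => ((Y s : ℂ) - z)⁻¹ with hr₀
  have hrc : Continuous r := ((Complex.continuous_ofReal.comp hXc).sub continuous_const).inv₀
    fun s => ofReal_sub_ne_zero (by linarith) _
  have hr₀L : BddLip r₀ 8192 := by
    refine ⟨fun t => (hb _).trans (by norm_num), fun s t => ?_⟩
    refine (norm_inv_sub_inv_le hz.le _ _).trans ?_
    linarith [abs_patchVelocity_sub_le t₁ t₂ s t]
  have hrr : ∀ s, ‖r s - r₀ s‖ ≤ 4096 * η := fun s =>
    (norm_inv_sub_inv_le hz.le _ _).trans (by gcongr; exact abs_velocityOf_sub_le hA s)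
  set k : ℂ := ((jostKernel (t₂ - t₁) : ℝ) : ℂ) with hk
  set c : ℂ := 1 + 1 / 4 * k * r₀ t₂ with hc
  have hk1 : ‖k‖ ≤ 1 := (bddLip_jostKernel t₁).1 t₂
  have hcn : ‖c‖ ≤ 65 := by
    calc ‖c‖ ≤ ‖(1 : ℂ)‖ + ‖1 / 4 * k * r₀ t₂‖ := norm_add_le _ _
      _ ≤ 1 + 1 * 1 * 64 := by
        rw [norm_one, norm_mul, norm_mul]
        gcongr
        · norm_num
        · exact hb _
      _ = 65 := by norm_num
  -- The Volterra equation for two point masses is solved by back substitution: `v₀ t₂ = 1`, then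
  -- `v₀ t₁ = c`, then all `t`. It is Lipschitz, hence an admissible test function for `NearDeltas`.
  set v₀ : ℝ → ℂ := fun t => 1 + ((jostKernel (t₁ - t) : ℝ) : ℂ) * (-(r₀ t₁ * c))
    + ((jostKernel (t₂ - t) : ℝ) : ℂ) * (1 / 4 * r₀ t₂) with hv₀
  have hsc : ∀ {h : ℝ → ℂ} {C : ℝ} (w : ℂ), BddLip h 1 → ‖w‖ ≤ C →
      BddLip (fun t => h t * w) (1 * C) := by
    intro h C w hh hw
    have hC : 0 ≤ C := (norm_nonneg _).trans hw
    refine ⟨fun t => ?_, fun s t => ?_⟩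
    · rw [norm_mul]; gcongr; exact hh.1 t
    · rw [← sub_mul, norm_mul]
      calc ‖h s - h t‖ * ‖w‖ ≤ (1 * |s - t|) * C := by gcongr; exact hh.2 s t
        _ = _ := by ring
  have hv₀L : BddLip v₀ M := by
    refine ((BddLip.const 1 norm_one.le).add (hsc _ (bddLip_jostKernel' t₁) ?_)).add
      (hsc _ (bddLip_jostKernel' t₂) ?_)
    · rw [norm_neg, norm_mul]; gcongr; exact hb _
    · rw [norm_mul]
      have h4 : ‖(1 / 4 : ℂ)‖ ≤ 1 := by norm_num
      exact (mul_le_of_le_one_left (norm_nonneg _) h4).trans (hb _)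
  have hv₀2 : v₀ t₂ = 1 := by
    rw [hv₀]
    simp [jostKernel_of_nonpos (sub_nonpos.2 h12), jostKernel_of_nonpos (le_refl (0 : ℝ))]
  have hv₀1 : v₀ t₁ = c := by
    rw [hv₀, hc]
    simp only [sub_self, jostKernel_of_nonpos (le_refl (0 : ℝ)), ← hk]
    push_cast
    ring
  have hrv : BddLip (fun s => r₀ s * v₀ s) (2 * 8192 * M) := hr₀L.mul hv₀L
  have hAi := hA.integrable
  have hv₀c := hv₀L.continuous
  have hM0 : 0 ≤ M := hv₀L.nonneg
  have hrep : ∀ (h : ℝ → ℂ), BddLip h 1 →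
      ‖(∫ s, (A s : ℂ) * (h s * (r s * v₀ s))) - ∫ s, (A s : ℂ) * (h s * (r₀ s * v₀ s))‖
        ≤ 3 * (1 * (4096 * M)) * η := by
    intro h hh
    have i1 : Integrable fun s => (A s : ℂ) * (h s * (r s * v₀ s)) :=
      hAi.ofReal.mul_bdd (c := 1 * (64 * M))
        (hh.continuous.mul (hrc.mul hv₀c)).aestronglyMeasurable (.of_forall fun s => by
          rw [norm_mul, norm_mul]
          gcongr
          · exact hh.1 s
          · exact hb _
          · exact hv₀L.1 s)
    have i2 : Integrable fun s => (A s : ℂ) * (h s * (r₀ s * v₀ s)) :=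
      hAi.ofReal.mul_bdd (c := 1 * (64 * M))
        (hh.continuous.mul hrv.continuous).aestronglyMeasurable (.of_forall fun s => by
          rw [norm_mul, norm_mul]
          gcongr
          · exact hh.1 s
          · exact hb _
          · exact hv₀L.1 s)
    rw [← integral_sub i1 i2]
    calc _ ≤ ∫ s, |A s| * (1 * (4096 * η * M)) := by
          refine norm_integral_le_of_norm_le (hAi.abs.mul_const _) (.of_forall fun s => ?_)
          have : (A s : ℂ) * (h s * (r s * v₀ s)) - (A s : ℂ) * (h s * (r₀ s * v₀ s))
              = (A s : ℂ) * (h s * ((r s - r₀ s) * v₀ s)) := by ring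
          rw [this, norm_mul, norm_mul, norm_mul, Complex.norm_real, Real.norm_eq_abs]
          gcongr
          · exact hh.1 s
          · exact hrr s
          · exact hv₀L.1 s
      _ = (∫ s, |A s|) * (1 * (4096 * η * M)) := integral_mul_const _ _
      _ ≤ 3 * (1 * (4096 * η * M)) := by gcongr; exact hA.mass_le
      _ = _ := by ring
  have hres : ∀ t, ‖(v t - v₀ t) - ∫ s, ((jostKernel (s - t) * A s : ℝ) : ℂ) *
      (r s * (v s - v₀ s))‖ ≤ R * η := by
    intro t
    have hh := bddLip_jostKernel t
    have hn := hA.near _ _ (hh.mul hrv)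
    have hp := hrep _ hh
    simp only [hv₀1, hv₀2] at hn
    have hint : ∀ {w : ℝ → ℂ} {C : ℝ}, Continuous w → (∀ s, ‖w s‖ ≤ C) →
        Integrable fun s => ((jostKernel (s - t) * A s : ℝ) : ℂ) * (r s * w s) := by
      intro w C hw hC
      have h1 : Integrable fun s => (A s : ℂ) * (((jostKernel (s - t) : ℝ) : ℂ) * (r s * w s)) :=
        hAi.ofReal.mul_bdd (c := 1 * (64 * C))
          (hh.continuous.mul (hrc.mul hw)).aestronglyMeasurable (.of_forall fun s => by
            rw [norm_mul, norm_mul]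
            gcongr
            · exact hh.1 s
            · exact hb _
            · exact hC s)
      refine h1.congr (.of_forall fun s => ?_)
      push_cast; ring
    have i1 := hint hv hB
    have i2 := hint hv₀c hv₀L.1
    have e1 : ∫ s, ((jostKernel (s - t) * A s : ℝ) : ℂ) * (r s * (v s - v₀ s))
        = (∫ s, ((jostKernel (s - t) * A s : ℝ) : ℂ) * (r s * v s))
          - ∫ s, (A s : ℂ) * (((jostKernel (s - t) : ℝ) : ℂ) * (r s * v₀ s)) := by
      have e2 : ∫ s, (A s : ℂ) * (((jostKernel (s - t) : ℝ) : ℂ) * (r s * v₀ s))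
          = ∫ s, ((jostKernel (s - t) * A s : ℝ) : ℂ) * (r s * v₀ s) := by
        congr 1 with s
        push_cast; ring
      rw [e2, ← integral_sub i1 i2]
      congr 1 with s
      ring
    -- `v - v₀` solves the perturbed Volterra equation up to a residual with two sources: the error
    -- in the resolvent, and the error of `A` against the Lipschitz function `k r₀ v₀`. Both are of
    -- order `η`.
    have e3 : (v t - v₀ t) - ∫ s, ((jostKernel (s - t) * A s : ℝ) : ℂ) * (r s * (v s - v₀ s))
        = ((∫ s, (A s : ℂ) * (((jostKernel (s - t) : ℝ) : ℂ) * (r s * v₀ s)))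
          - ∫ s, (A s : ℂ) * (((jostKernel (s - t) : ℝ) : ℂ) * (r₀ s * v₀ s)))
        + ((∫ s, (A s : ℂ) * (((jostKernel (s - t) : ℝ) : ℂ) * (r₀ s * v₀ s)))
          - (-(((jostKernel (t₁ - t) : ℝ) : ℂ) * (r₀ t₁ * c))
            + 1 / 4 * (((jostKernel (t₂ - t) : ℝ) : ℂ) * (r₀ t₂ * 1)))) := by
      rw [e1, hvol t, hv₀]
      ring
    rw [e3]
    refine (norm_add_le _ _).trans ((add_le_add hp hn).trans_eq ?_)
    rw [hR]; ring
  have hy : ∀ t, ‖v t - v₀ t‖ ≤ 2 * (R * η) * E := by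
    intro t
    have hR0 : 0 ≤ R := by positivity
    refine (norm_le_of_volterra_residual hA.continuous hAi hXc (δ := 1 / 64) (by norm_num) hz.le
      (y := fun t => v t - v₀ t) (hv.sub hv₀c) (B := B + M)
      (fun t => (norm_sub_le _ _).trans (add_le_add (hB t) (hv₀L.1 t)))
      (mul_nonneg hR0 hη) hres t).trans ?_
    rw [hE]
    gcongr
    exact hA.mass_le
  have hk' : k = 55 / 256 := by
    rw [hk, jostKernel, max_eq_left (sub_nonneg.2 h12)]
    have : Real.exp (-4 * (t₂ - t₁)) = (3 / 8) ^ 2 := by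
      rw [← hd, ← Real.exp_nat_mul]; congr 1; push_cast; ring
    rw [this]
    push_cast
    norm_num
  have hpj : patchJost z = 1 + 1 / 4 * (-(r₀ t₁ * c) + 1 / 4 * (r₀ t₂ * 1)) := by
    rw [hc, hk', hr₀]
    simp only [Y, patchVelocity_left h12, patchVelocity_right h12 hd]
    unfold patchJost
    push_cast
    ring
  have hn := hA.near _ _ hrv
  simp only [hv₀1, hv₀2] at hn
  have hp := hrep _ (BddLip.const 1 norm_one.le)
  simp only [one_mul] at hp
  have i1 : Integrable fun s => (A s : ℂ) * (r s * (v s - v₀ s)) :=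
    hAi.ofReal.mul_bdd (c := 64 * (2 * (R * η) * E))
      (hrc.mul (hv.sub hv₀c)).aestronglyMeasurable (.of_forall fun s => by
        rw [norm_mul]
        gcongr
        · exact hb _
        · exact hy s)
  have i2 : Integrable fun s => (A s : ℂ) * (r s * v₀ s) :=
    hAi.ofReal.mul_bdd (c := 64 * M)
      (hrc.mul hv₀c).aestronglyMeasurable (.of_forall fun s => by
        rw [norm_mul]
        gcongr
        · exact hb _
        · exact hv₀L.1 s)
  have hy' : ‖∫ s, (A s : ℂ) * (r s * (v s - v₀ s))‖ ≤ 3 * (64 * (2 * (R * η) * E)) := by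
    calc _ ≤ ∫ s, |A s| * (64 * (2 * (R * η) * E)) := by
          refine norm_integral_le_of_norm_le (hAi.abs.mul_const _) (.of_forall fun s => ?_)
          rw [norm_mul, norm_mul, Complex.norm_real, Real.norm_eq_abs]
          gcongr
          · exact hb _
          · exact hy s
      _ = (∫ s, |A s|) * (64 * (2 * (R * η) * E)) := integral_mul_const _ _
      _ ≤ _ := by gcongr; exact hA.mass_le
  have e1 : ∫ s, (A s : ℂ) * (r s * v s) = (∫ s, (A s : ℂ) * (r s * (v s - v₀ s)))
      + ∫ s, (A s : ℂ) * (r s * v₀ s) := by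
    rw [← integral_add i1 i2]
    congr 1 with s
    ring
  have e2 : (1 + 1 / 4 * ∫ s, (A s : ℂ) * (r s * v s)) - patchJost z
      = 1 / 4 * ((∫ s, (A s : ℂ) * (r s * (v s - v₀ s)))
        + ((∫ s, (A s : ℂ) * (r s * v₀ s)) - ∫ s, (A s : ℂ) * (r₀ s * v₀ s))
        + ((∫ s, (A s : ℂ) * (r₀ s * v₀ s)) - (-(r₀ t₁ * c) + 1 / 4 * (r₀ t₂ * 1)))) := by
    rw [e1, hpj]; ring
  rw [e2, norm_mul]
  have h4 : ‖(1 / 4 : ℂ)‖ = 1 / 4 := by norm_num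
  rw [h4]
  calc _ ≤ 1 / 4 * (3 * (64 * (2 * (R * η) * E)) + 3 * (4096 * M) * η + η * (2 * 8192 * M)) := by
        gcongr
        exact (norm_add_le _ _).trans (add_le_add ((norm_add_le _ _).trans (add_le_add hy' hp)) hn)
    _ = _ := by ring

/-- Densities close to the two-interface vortex have a Jost zero in the upper half-plane. -/
theorem exists_jost_zero {t₁ t₂ : ℝ} (h12 : t₁ ≤ t₂) (hd : Real.exp (-2 * (t₂ - t₁)) = 3 / 8) :
    ∃ η₀ > 0, ∀ η ≤ η₀, ∀ (A : ℝ → ℝ), NearDeltas A t₁ t₂ η → Continuous (velocityOf A) →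
      (∃ D, ∀ t, |velocityOf A t| ≤ D) → ∃ (z : ℂ) (v : ℝ → ℂ), 0 < z.im ∧ Continuous v ∧
      (∃ B, ∀ t, ‖v t‖ ≤ B) ∧
      (∀ t, v t = 1 + ∫ s, ((jostKernel (s - t) * A s : ℝ) : ℂ) *
        (((velocityOf A s : ℂ) - z)⁻¹ * v s)) ∧
      1 + 1 / 4 * ∫ s, (A s : ℂ) * (((velocityOf A s : ℂ) - z)⁻¹ * v s) = 0 := by
  obtain ⟨K, hK⟩ := exists_norm_jost_sub_le h12 hd
  -- Makes the Jost functions differ by at most `1/65536`, below the lower bound `1/4096` of the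
  -- model on the circle used below.
  refine ⟨1 / (65536 * (|K| + 1)), by positivity, fun η hη A hA hXc ⟨D, hD⟩ => ?_⟩
  have hη0 : 0 ≤ η := (abs_nonneg _).trans (abs_velocityOf_sub_le hA 0)
  obtain ⟨F, v, hFd, hv⟩ := exists_jost_solution hA.continuous hA.integrable hXc hD
    (by norm_num : (0 : ℝ) < 1 / 64)
  have hKη : K * η ≤ 1 / 65536 := by
    calc K * η ≤ (|K| + 1) * (1 / (65536 * (|K| + 1))) := by
          gcongr
          linarith [le_abs_self K]
      _ = _ := by field_simp
  have hnear : ∀ z : ℂ, 1 / 64 < z.im → ‖F z - patchJost z‖ ≤ 1 / 65536 := by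
    intro z hz
    obtain ⟨h1, h2, h3, h4⟩ := hv z hz
    rw [h4]
    exact (hK η A hA hXc z (v z) hz h1 h2 h3).trans hKη
  set z₀ : ℂ := 1 / 8 + 3 / 64 * Complex.I with hz₀
  have hz₀im : z₀.im = 3 / 64 := by rw [hz₀]; norm_num
  have him : ∀ z ∈ Metric.closedBall z₀ (1 / 64), 1 / 64 < z.im := by
    intro z hz
    rw [mem_closedBall_iff_norm] at hz
    have h1 := (Complex.abs_im_le_norm (z - z₀)).trans hz
    rw [Complex.sub_im, hz₀im] at h1
    linarith [(abs_le.1 h1).1]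
  have hne : ∀ z : ℂ, 1 / 64 < z.im → (3 / 8 : ℂ) - z ≠ 0 ∧ (1 / 16 : ℂ) - z ≠ 0 := by
    intro z hz
    have h1 := ofReal_sub_ne_zero (by linarith : 0 < z.im) (3 / 8)
    have h2 := ofReal_sub_ne_zero (by linarith : 0 < z.im) (1 / 16)
    push_cast at h1 h2
    exact ⟨h1, h2⟩
  by_cases hzero : ∃ z ∈ Metric.closedBall z₀ (1 / 64), F z = 0
  · obtain ⟨z, hz, hFz⟩ := hzero
    obtain ⟨h1, h2, h3, h4⟩ := hv z (him z hz)
    exact ⟨z, v z, by linarith [him z hz], h1, h2, h3, h4 ▸ hFz⟩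
  · exfalso
    push Not at hzero
    -- Maximum principle for `1 / F` on the disc of radius `1/64` about the model zero, which stays
    -- in `Im z > 1/64`.
    have hdiff : DiffContOnCl ℂ (fun z => (F z)⁻¹) (Metric.ball z₀ (1 / 64)) := by
      refine DifferentiableOn.diffContOnCl ?_
      rw [closure_ball _ (by norm_num)]
      exact (hFd.mono fun z hz => him z hz).inv hzero
    have hfront : ∀ z ∈ frontier (Metric.ball z₀ (1 / 64)), ‖(F z)⁻¹‖ ≤ 32768 := by
      intro z hz
      rw [frontier_ball _ (by norm_num)] at hz
      have hzi := him z (Metric.sphere_subset_closedBall hz)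
      rw [mem_sphere_iff_norm] at hz
      obtain ⟨n1, n2⟩ := hne z hzi
      have hmul := congrArg norm (patchJost_mul n1 n2)
      rw [norm_mul, norm_mul, norm_mul, ← hz₀, hz] at hmul
      have hzb : ‖z‖ ≤ 1 / 2 := by
        have h0 : ‖z₀‖ ≤ 1 / 8 + 3 / 64 := by
          refine (norm_add_le _ _).trans_eq ?_
          rw [norm_mul, Complex.norm_I]
          norm_num
        have h1 : ‖z‖ ≤ ‖z - z₀‖ + ‖z₀‖ := by simpa using norm_add_le (z - z₀) z₀
        rw [hz] at h1
        linarith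
      have b1 : ‖(3 / 8 : ℂ) - z‖ ≤ 1 := by
        refine (norm_sub_le _ _).trans ?_
        have : ‖(3 / 8 : ℂ)‖ = 3 / 8 := by norm_num
        linarith
      have b2 : ‖(1 / 16 : ℂ) - z‖ ≤ 1 := by
        refine (norm_sub_le _ _).trans ?_
        have : ‖(1 / 16 : ℂ)‖ = 1 / 16 := by norm_num
        linarith
      have b3 : 1 / 64 ≤ ‖z - (1 / 8 - 3 / 64 * Complex.I)‖ := by
        refine le_trans ?_ ((le_abs_self _).trans (Complex.abs_im_le_norm _))
        have : (z - (1 / 8 - 3 / 64 * Complex.I)).im = z.im + 3 / 64 := by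
          simp
        rw [this]; linarith
      -- Both root factors are at least `1/64` on the circle, and the two denominators have modulus
      -- at most `1`. The perturbation `1/65536` then leaves `‖F z‖ ≥ 1/32768`, whereas `‖F z₀‖ ≤
      -- 1/65536` at the centre.
      have hp : 1 / 4096 ≤ ‖patchJost z‖ := by
        have h1 : ‖patchJost z‖ * (‖(3 / 8 : ℂ) - z‖ * ‖(1 / 16 : ℂ) - z‖) ≤ ‖patchJost z‖ * (1 * 1) := by
          gcongr
        nlinarith
      have hF : 1 / 32768 ≤ ‖F z‖ := by
        have h1 := norm_sub_norm_le (patchJost z) (F z)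
        rw [norm_sub_rev] at h1
        linarith [hnear z hzi]
      rw [norm_inv]
      exact (inv_anti₀ (by norm_num) hF).trans_eq (by norm_num)
    have hmem : z₀ ∈ closure (Metric.ball z₀ (1 / 64)) :=
      subset_closure (Metric.mem_ball_self (by norm_num))
    have hmax := Complex.norm_le_of_forall_mem_frontier_norm_le Metric.isBounded_ball hdiff hfront
      hmem
    have hz₀i : 1 / 64 < z₀.im := by rw [hz₀im]; norm_num
    obtain ⟨n1, n2⟩ := hne z₀ hz₀i
    have hp0 : patchJost z₀ = 0 := by
      have h1 := patchJost_mul n1 n2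
      rw [← hz₀, sub_self, zero_mul] at h1
      exact (mul_eq_zero.1 h1).resolve_right (mul_ne_zero n1 n2)
    have h1 := hnear z₀ hz₀i
    rw [hp0, sub_zero] at h1
    have h2 : 0 < ‖F z₀‖ := norm_pos_iff.2 (hzero z₀ (Metric.mem_closedBall_self (by norm_num)))
    rw [norm_inv] at hmax
    have h3 : 1 ≤ 32768 * ‖F z₀‖ := by
      rw [inv_le_iff_one_le_mul₀ h2] at hmax
      exact hmax
    linarith

end TwoDeltas

/-! ### Recovering the profile from the vorticity gradient. -/

section Velocity

variable {A : ℝ → ℝ}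

/-- The weighted primitive `∫_{r ≤ t} e^{2r} A(r) dr`. -/
noncomputable def circulation (A : ℝ → ℝ) (t : ℝ) : ℝ :=
  ∫ r in Set.Iic t, Real.exp (2 * r) * A r

theorem integrableOn_exp_mul_Iic_of_integrable (hc : Continuous A) (hi : Integrable A) (t : ℝ) :
    IntegrableOn (fun r => Real.exp (2 * r) * A r) (Set.Iic t) := by
  refine ((hi.abs.const_mul (Real.exp (2 * t))).integrableOn (s := Set.Iic t)).mono'
    (Continuous.aestronglyMeasurable (by fun_prop))
    ((ae_restrict_iff' measurableSet_Iic).2 (.of_forall fun s hs => ?_))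
  rw [Real.norm_eq_abs, abs_mul, Real.abs_exp]
  gcongr
  exact Set.mem_Iic.1 hs

theorem hasDerivAt_circulation (hc : Continuous A) (hi : Integrable A) (t : ℝ) :
    HasDerivAt (circulation A) (Real.exp (2 * t) * A t) t :=
  hasDerivAt_integral_Iic (by fun_prop) (integrableOn_exp_mul_Iic_of_integrable hc hi) t

/-- Splitting at `r = t` separates the kernel into `1` and `e^{-2(t-r)}`. On differentiation the two
contributions of `A t` cancel, so the sign of the velocity's derivative is that of `circulation`. -/
theorem velocityOf_eq (hi : Integrable A) (t : ℝ) :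
    velocityOf A t
      = -(1 / 2) * ((∫ r in Set.Ioi t, A r) + Real.exp (-2 * t) * circulation A t) := by
  have hint : Integrable fun r => A r * Real.exp (-2 * max (t - r) 0) := by
    refine hi.mul_bdd (c := 1) (Continuous.aestronglyMeasurable (by fun_prop))
      (.of_forall fun r => ?_)
    rw [Real.norm_eq_abs, Real.abs_exp, Real.exp_le_one_iff]
    nlinarith [le_max_right (t - r) 0]
  rw [velocityOf, ← integral_add_compl (measurableSet_Iic (a := t)) hint, Set.compl_Iic, add_comm,
    circulation, ← integral_const_mul]
  congr 2
  · refine setIntegral_congr_fun measurableSet_Ioi fun r hr => ?_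
    simp [max_eq_right (sub_nonpos.2 (le_of_lt (Set.mem_Ioi.1 hr)))]
  · refine setIntegral_congr_fun measurableSet_Iic fun r hr => ?_
    simp only [max_eq_left (sub_nonneg.2 (Set.mem_Iic.1 hr))]
    rw [← mul_assoc, ← Real.exp_add, mul_comm]
    ring_nf

theorem abs_velocityOf_le (hi : Integrable A) (t : ℝ) :
    |velocityOf A t| ≤ ∫ r, |A r| := by
  have h : ‖∫ r, A r * Real.exp (-2 * max (t - r) 0)‖ ≤ ∫ r, |A r| := by
    refine norm_integral_le_of_norm_le hi.abs (.of_forall fun r => ?_)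
    rw [norm_mul, Real.norm_eq_abs, Real.norm_eq_abs, Real.abs_exp]
    refine mul_le_of_le_one_right (abs_nonneg _) (Real.exp_le_one_iff.2 ?_)
    nlinarith [le_max_right (t - r) 0]
  rw [velocityOf, abs_mul, ← Real.norm_eq_abs (∫ r, A r * _)]
  have h2 : |(-(1 / 2) : ℝ)| ≤ 1 := by norm_num [abs_le]
  exact (mul_le_of_le_one_left (norm_nonneg _) h2).trans h

theorem hasDerivAt_exp_const_mul (k t : ℝ) :
    HasDerivAt (fun t => Real.exp (k * t)) (k * Real.exp (k * t)) t := by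
  simpa [mul_comm] using ((hasDerivAt_id t).const_mul k).exp

theorem hasDerivAt_velocityOf (hc : Continuous A) (hi : Integrable A) (t : ℝ) :
    HasDerivAt (velocityOf A) (Real.exp (-2 * t) * circulation A t) t := by
  have h : velocityOf A = fun t =>
      -(1 / 2) * ((∫ r in Set.Ioi t, A r) + Real.exp (-2 * t) * circulation A t) :=
    funext (velocityOf_eq hi)
  rw [h]
  have h1 := hasDerivAt_integral_Ioi hc (fun _ => hi.integrableOn) t
  refine ((h1.add ((hasDerivAt_exp_const_mul (-2) t).mul
    (hasDerivAt_circulation hc hi t))).const_mul (-(1 / 2))).congr_deriv ?_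
  have h2 : Real.exp (-2 * t) * Real.exp (2 * t) = 1 := by
    rw [← Real.exp_add, ← Real.exp_zero]; ring_nf
  linear_combination (-(1 / 2) * A t) * h2

theorem deriv_velocityOf (hc : Continuous A) (hi : Integrable A) :
    deriv (velocityOf A) = fun t => Real.exp (-2 * t) * circulation A t :=
  funext fun t => (hasDerivAt_velocityOf hc hi t).deriv

theorem continuous_velocityOf (hc : Continuous A) (hi : Integrable A) :
    Continuous (velocityOf A) :=
  continuous_iff_continuousAt.2 fun t => (hasDerivAt_velocityOf hc hi t).continuousAt

theorem rayleighA_velocityOf (hc : Continuous A) (hi : Integrable A) :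
    rayleighA (velocityOf A) = A := by
  ext t
  unfold rayleighA
  rw [deriv_velocityOf hc hi]
  have h1 := ((hasDerivAt_exp_const_mul (-2) t).mul (hasDerivAt_circulation hc hi t)).deriv
  have h2 : Real.exp (-2 * t) * Real.exp (2 * t) = 1 := by
    rw [← Real.exp_add, ← Real.exp_zero]; ring_nf
  refine (congrArg (· + _) h1).trans ?_
  linear_combination A t * h2

theorem contDiff_velocityOf (hA : ContDiff ℝ ∞ A) (hi : Integrable A) :
    ContDiff ℝ ∞ (velocityOf A) := by
  have hc := hA.continuous
  have h1 : ContDiff ℝ ∞ (circulation A) := by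
    rw [contDiff_infty_iff_deriv]
    refine ⟨fun t => (hasDerivAt_circulation hc hi t).differentiableAt, ?_⟩
    have : deriv (circulation A) = fun t => Real.exp (2 * t) * A t :=
      funext fun t => (hasDerivAt_circulation hc hi t).deriv
    rw [this]
    fun_prop
  rw [contDiff_infty_iff_deriv]
  refine ⟨fun t => (hasDerivAt_velocityOf hc hi t).differentiableAt, ?_⟩
  rw [deriv_velocityOf hc hi]
  fun_prop

theorem rayleighA_const_mul (c : ℝ) (Ξ : ℝ → ℝ) :
    rayleighA (fun t => c * Ξ t) = fun t => c * rayleighA Ξ t := by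
  ext t
  unfold rayleighA
  have h : deriv (fun t => c * Ξ t) = fun t => c * deriv Ξ t :=
    funext fun t => deriv_const_mul_field c
  rw [h, deriv_const_mul_field]
  ring

/-- The unstable set scales with the angular velocity. -/
theorem mul_mem_unstableSet {Ξ : ℝ → ℝ} {m : ℝ} {z : ℂ} {c : ℝ} (hc : 0 < c)
    (hz : z ∈ unstableSet Ξ m) : (c : ℂ) * z ∈ unstableSet (fun t => c * Ξ t) m := by
  obtain ⟨hz, φ, ⟨h2, φ₁, φ₂, hW, heq⟩, h0⟩ := hz
  refine ⟨by simpa using mul_pos hc hz, φ, ⟨h2, φ₁, φ₂, hW, ?_⟩, h0⟩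
  filter_upwards [heq] with t ht
  rw [rayleighA_const_mul]
  have hcc : (c : ℂ) ≠ 0 := by exact_mod_cast hc.ne'
  push_cast
  rw [← mul_sub, mul_div_mul_left _ _ hcc]
  exact ht

end Velocity

/-! ### Admissible vorticity gradients and membership in `ClassC`. -/

section Density

/-- Admissible vorticity gradients: sign pattern `-, +, -` with the prescribed exponential tails. -/
structure IsDensity (α ε M a b : ℝ) (A : ℝ → ℝ) : Prop where
  smooth : ContDiff ℝ ∞ A
  left : ∀ t ≤ M, A t = -(ε * Real.exp (2 * t))
  right : ∀ t, Real.log 2 ≤ t → A t = -(ε * Real.exp (-α * t))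
  neg_left : ∀ t < a, A t < 0
  zero_left : A a = 0
  pos : ∀ t, a < t → t < b → 0 < A t
  zero_right : A b = 0
  neg_right : ∀ t, b < t → A t < 0
  deriv_left : 0 < deriv A a
  deriv_right : deriv A b < 0

namespace IsDensity

variable {α ε M a b : ℝ} {A : ℝ → ℝ}

theorem continuous (h : IsDensity α ε M a b A) : Continuous A := h.smooth.continuous

theorem integrable (h : IsDensity α ε M a b A) (hα : 0 < α) : Integrable A := by
  rw [← integrableOn_univ, ← Set.Iic_union_Ioi (a := M)]
  refine IntegrableOn.union ?_ ?_
  · have h1 : IntegrableOn (fun t => -ε * Real.exp (2 * t)) (Set.Iic M) :=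
      Integrable.const_mul (integrableOn_exp_mul_Iic two_pos M) _
    exact h1.congr_fun (fun t ht => by simp only [h.left t ht, neg_mul]) measurableSet_Iic
  · refine IntegrableOn.mono_set (t := Set.Icc M (Real.log 2) ∪ Set.Ioi (Real.log 2)) ?_ ?_
    · refine (h.continuous.integrableOn_Icc).union ?_
      have h1 : IntegrableOn (fun t => -ε * Real.exp (-α * t)) (Set.Ioi (Real.log 2)) :=
        Integrable.const_mul (integrableOn_exp_mul_Ioi (neg_lt_zero.2 hα) _) _
      exact h1.congr_fun (fun t ht => by simp only [h.right t (le_of_lt ht), neg_mul])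
        measurableSet_Ioi
    · intro t ht
      rcases le_or_gt t (Real.log 2) with h1 | h1
      · exact Or.inl ⟨le_of_lt ht, h1⟩
      · exact Or.inr h1

theorem exists_abs_le_exp (h : IsDensity α ε M a b A) (hα : 0 < α) (hM : M ≤ 0) :
    ∃ C, ∀ s, |A s| ≤ C * Real.exp (3 / 2 * s) ∧ |A s| ≤ C := by
  obtain ⟨C₁, hC₁⟩ := (isCompact_Icc (a := M) (b := Real.log 2)).exists_bound_of_continuousOn
    h.continuous.continuousOn
  obtain ⟨C₂, hC₂⟩ := (isCompact_Icc (a := M) (b := Real.log 2)).exists_bound_of_continuousOn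
    (f := fun s => A s * Real.exp (-(3 / 2 * s))) (by have := h.continuous; fun_prop)
  refine ⟨max |ε| (max C₁ C₂), fun s => ?_⟩
  have m1 : |ε| ≤ max |ε| (max C₁ C₂) := le_max_left _ _
  have m2 : C₁ ≤ max |ε| (max C₁ C₂) := (le_max_left _ _).trans (le_max_right _ _)
  have m3 : C₂ ≤ max |ε| (max C₁ C₂) := (le_max_right _ _).trans (le_max_right _ _)
  have m0 : 0 ≤ max |ε| (max C₁ C₂) := (abs_nonneg ε).trans m1
  have hlog : 0 ≤ Real.log 2 := Real.log_nonneg (by norm_num)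
  rcases le_or_gt s M with hs | hs
  · rw [h.left s hs, abs_neg, abs_mul, Real.abs_exp]
    constructor
    · exact mul_le_mul m1 (Real.exp_le_exp.2 (by linarith)) (Real.exp_pos _).le m0
    · exact (mul_le_of_le_one_right (abs_nonneg _)
        (Real.exp_le_one_iff.2 (by linarith))).trans m1
  · rcases le_or_gt s (Real.log 2) with hs2 | hs2
    · refine ⟨?_, (hC₁ s ⟨hs.le, hs2⟩).trans m2⟩
      have h2 := (hC₂ s ⟨hs.le, hs2⟩).trans m3
      rw [Real.norm_eq_abs, abs_mul, Real.abs_exp, Real.exp_neg, ← div_eq_mul_inv,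
        div_le_iff₀ (Real.exp_pos _)] at h2
      exact h2
    · rw [h.right s hs2.le, abs_neg, abs_mul, Real.abs_exp]
      have e1 : Real.exp (-α * s) ≤ 1 := by
        rw [Real.exp_le_one_iff]; nlinarith
      have e2 : 1 ≤ Real.exp (3 / 2 * s) := Real.one_le_exp (by linarith)
      constructor
      · exact mul_le_mul m1 (e1.trans e2) (Real.exp_pos _).le m0
      · exact (mul_le_of_le_one_right (abs_nonneg _) e1).trans m1

theorem circulation_left (h : IsDensity α ε M a b A) {t : ℝ} (ht : t ≤ M) :
    circulation A t = -(ε / 4 * Real.exp (4 * t)) := by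
  have h1 : circulation A t = ∫ r in Set.Iic t, -ε * Real.exp (4 * r) := by
    refine setIntegral_congr_fun measurableSet_Iic fun r hr => ?_
    have h2 : Real.exp (4 * r) = Real.exp (2 * r) * Real.exp (2 * r) := by
      rw [← Real.exp_add]; ring_nf
    simp only [h.left r ((Set.mem_Iic.1 hr).trans ht), h2]
    ring
  rw [h1, integral_const_mul, integral_exp_mul_Iic (by norm_num)]
  ring

/-- The circulation starts negative in the left tail, decreases up to `a`, increases to `b` and
decreases afterwards. Its value at `b` is therefore the only one to check. -/
theorem circulation_neg (h : IsDensity α ε M a b A) (hα : 0 < α) (hε : 0 < ε) (hMa : M < a)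
    (hab : a < b) (hb : circulation A b < 0) (t : ℝ) : circulation A t < 0 := by
  have hd := hasDerivAt_circulation h.continuous (h.integrable hα)
  have hcont : Continuous (circulation A) :=
    continuous_iff_continuousAt.2 fun t => (hd t).continuousAt
  have hM : ∀ t ≤ M, circulation A t < 0 := fun t ht => by
    rw [h.circulation_left ht]
    have : 0 < ε / 4 * Real.exp (4 * t) := by positivity
    linarith
  rcases le_or_gt t a with hta | hta
  · rcases le_or_gt t M with htM | htM
    · exact hM t htM
    · have hanti : AntitoneOn (circulation A) (Set.Icc M a) := by
        refine antitoneOn_of_deriv_nonpos (convex_Icc _ _) hcont.continuousOn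
          (fun s _ => (hd s).differentiableAt.differentiableWithinAt) fun s hs => ?_
        rw [interior_Icc] at hs
        rw [(hd s).deriv]
        exact mul_nonpos_of_nonneg_of_nonpos (Real.exp_pos _).le (h.neg_left s hs.2).le
      exact (hanti ⟨le_rfl, hMa.le⟩ ⟨htM.le, hta⟩ htM.le).trans_lt (hM M le_rfl)
  · rcases le_or_gt t b with htb | htb
    · have hmono : MonotoneOn (circulation A) (Set.Icc a b) := by
        refine monotoneOn_of_deriv_nonneg (convex_Icc _ _) hcont.continuousOn
          (fun s _ => (hd s).differentiableAt.differentiableWithinAt) fun s hs => ?_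
        rw [interior_Icc] at hs
        rw [(hd s).deriv]
        exact mul_nonneg (Real.exp_pos _).le (h.pos s hs.1 hs.2).le
      exact (hmono ⟨hta.le, htb⟩ ⟨hab.le, le_rfl⟩ htb).trans_lt hb
    · have hanti : AntitoneOn (circulation A) (Set.Ici b) := by
        refine antitoneOn_of_deriv_nonpos (convex_Ici _) hcont.continuousOn
          (fun s _ => (hd s).differentiableAt.differentiableWithinAt) fun s hs => ?_
        rw [interior_Ici] at hs
        rw [(hd s).deriv]
        exact mul_nonpos_of_nonneg_of_nonpos (Real.exp_pos _).le (h.neg_right s hs).le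
      exact (hanti (Set.mem_Ici.2 le_rfl) (Set.mem_Ici.2 htb.le) htb.le).trans_lt hb

theorem velocityOf_left (h : IsDensity α ε M a b A) (hα : 0 < α) {t : ℝ} (ht : t ≤ M) :
    velocityOf A t = -(1 / 2) * (∫ r, A r) - ε / 8 * Real.exp (2 * t) := by
  have hi := h.integrable hα
  have h1 : ∫ r in Set.Iic t, A r = -(ε / 2 * Real.exp (2 * t)) := by
    have : ∫ r in Set.Iic t, A r = ∫ r in Set.Iic t, -ε * Real.exp (2 * r) :=
      setIntegral_congr_fun measurableSet_Iic fun r hr => by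
        simp only [h.left r ((Set.mem_Iic.1 hr).trans ht), neg_mul]
    rw [this, integral_const_mul, integral_exp_mul_Iic two_pos]
    ring
  have h2 := integral_add_compl (measurableSet_Iic (a := t)) hi
  rw [Set.compl_Iic, h1] at h2
  have h3 : Real.exp (-2 * t) * Real.exp (4 * t) = Real.exp (2 * t) := by
    rw [← Real.exp_add]; ring_nf
  rw [velocityOf_eq hi, h.circulation_left ht]
  linear_combination (-(1 / 2)) * h2 + ε / 8 * h3

theorem velocityOf_right (h : IsDensity α ε M a b A) (hα : 0 < α) (hα2 : α < 2) :
    ∃ c : ℝ, ∀ t, Real.log 2 ≤ t → velocityOf A t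
      = c * Real.exp (-2 * t) + ε / (α * (2 - α)) * Real.exp (-α * t) := by
  have hi := h.integrable hα
  have hd := hasDerivAt_circulation h.continuous hi
  have hne : 2 - α ≠ 0 := by linarith
  -- For `t ≥ log 2` the circulation has derivative `-ε e^{(2-α)t}`, so `f` is constant there. This
  -- constant produces the `e^{-2t}` term of the tail.
  set f : ℝ → ℝ := fun t => circulation A t + ε / (2 - α) * Real.exp ((2 - α) * t) with hf
  have hfd : ∀ t, HasDerivAt f (Real.exp (2 * t) * A t
      + ε / (2 - α) * ((2 - α) * Real.exp ((2 - α) * t))) t := fun t =>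
    (hd t).add ((hasDerivAt_exp_const_mul (2 - α) t).const_mul _)
  have hconst : ∀ t, Real.log 2 ≤ t → f t = f (Real.log 2) := by
    intro t ht
    refine constant_of_has_deriv_right_zero (b := t)
      (fun s _ => (hfd s).continuousAt.continuousWithinAt) (fun s hs => ?_) t ⟨ht, le_rfl⟩
    refine ((hfd s).congr_deriv ?_).hasDerivWithinAt
    have h2 : Real.exp ((2 - α) * s) = Real.exp (2 * s) * Real.exp (-α * s) := by
      rw [← Real.exp_add]; ring_nf
    rw [h.right s hs.1, h2]
    field_simp
    ring
  refine ⟨-(1 / 2) * f (Real.log 2), fun t ht => ?_⟩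
  have h1 : ∫ r in Set.Ioi t, A r = -(ε / α * Real.exp (-α * t)) := by
    have : ∫ r in Set.Ioi t, A r = ∫ r in Set.Ioi t, -ε * Real.exp (-α * r) :=
      setIntegral_congr_fun measurableSet_Ioi fun r hr => by
        simp only [h.right r (ht.trans (le_of_lt (Set.mem_Ioi.1 hr))), neg_mul]
    rw [this, integral_const_mul, integral_exp_mul_Ioi (neg_lt_zero.2 hα)]
    field_simp
  have h2 : circulation A t = f (Real.log 2) - ε / (2 - α) * Real.exp ((2 - α) * t) := by
    rw [← hconst t ht, hf]; ring
  have h3 : Real.exp (-2 * t) * Real.exp ((2 - α) * t) = Real.exp (-α * t) := by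
    rw [← Real.exp_add]; ring_nf
  have h4 : ε / (α * (2 - α)) = 1 / 2 * (ε / α + ε / (2 - α)) := by
    field_simp
    ring
  rw [velocityOf_eq hi, h1, h2, h4]
  linear_combination (1 / 2 * (ε / (2 - α))) * h3

/-- An admissible density with negative circulation generates a profile in the class `𝒞`. -/
theorem classC (h : IsDensity α ε M a b A) (hα : 0 < α) (hα1 : α < 1) (hε : 0 < ε) (hMa : M < a)
    (hab : a < b) (hb : circulation A b < 0) : ClassC α (fun t => α / ε * velocityOf A t) := by
  have hi := h.integrable hα
  have hc := h.continuous
  have hk : 0 < α / ε := div_pos hα hε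
  have hderiv : ∀ t, deriv (velocityOf A) t < 0 := fun t => by
    rw [deriv_velocityOf hc hi]
    exact mul_neg_of_pos_of_neg (Real.exp_pos _) (h.circulation_neg hα hε hMa hab hb t)
  have hanti : StrictAnti (velocityOf A) := strictAnti_of_deriv_neg hderiv
  obtain ⟨c, hcr⟩ := h.velocityOf_right hα (by linarith)
  have hlim : Tendsto (velocityOf A) atTop (𝓝 0) := by
    have e : ∀ k : ℝ, 0 < k → Tendsto (fun t : ℝ => Real.exp (-k * t)) atTop (𝓝 0) := by
      intro k hk
      refine Real.tendsto_exp_atBot.comp ?_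
      exact tendsto_id.const_mul_atTop_of_neg (neg_lt_zero.2 hk)
    have h1 := ((e 2 two_pos).const_mul c).add ((e α hα).const_mul (ε / (α * (2 - α))))
    simp only [mul_zero, add_zero] at h1
    refine h1.congr' ?_
    filter_upwards [eventually_ge_atTop (Real.log 2)] with t ht
    exact (hcr t ht).symm
  -- A strictly decreasing function with limit `0` at `+∞` is positive.
  have hpos : ∀ t, 0 < velocityOf A t := fun t =>
    (hanti.antitone.le_of_tendsto hlim (t + 1)).trans_lt (hanti (lt_add_one t))
  have hA : rayleighA (fun t => α / ε * velocityOf A t) = fun t => α / ε * A t := by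
    rw [rayleighA_const_mul, rayleighA_velocityOf hc hi]
  -- The factor `α / ε` turns the tail coefficient `ε / (α (2 - α))` into the prescribed `1 / (2 -
  -- α)`, and the left coefficient `ε / 8` into `c₀ = α / 8`.
  refine ⟨contDiff_const.mul (contDiff_velocityOf h.smooth hi), fun t => mul_pos hk (hpos t),
    ⟨α / ε * (-(1 / 2) * ∫ r, A r), ?_, α / 8, M, by positivity, fun t ht => ?_⟩,
    ⟨α / ε * c, fun t ht => ?_⟩, ⟨a, b, hab, fun t => ?_, ?_, ?_⟩, fun t => ?_⟩
  · have h1 : Tendsto (fun t : ℝ => Real.exp (2 * t)) atBot (𝓝 0) :=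
      Real.tendsto_exp_atBot.comp (tendsto_id.const_mul_atBot two_pos)
    have h2 := ((h1.const_mul (ε / 8)).const_sub (-(1 / 2) * ∫ r, A r)).const_mul (α / ε)
    simp only [mul_zero, sub_zero] at h2
    refine h2.congr' ?_
    filter_upwards [eventually_le_atBot M] with t ht
    rw [h.velocityOf_left hα ht]
  · rw [h.velocityOf_left hα ht]
    field_simp
  · rw [hcr t ht]
    have : 2 - α ≠ 0 := by linarith
    field_simp
  · rw [hA]
    simp only [mul_eq_zero, hk.ne', false_or]
    constructor
    · intro h0
      by_contra hcon
      push Not at hcon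
      rcases lt_or_gt_of_ne hcon.1 with h1 | h1
      · exact (h.neg_left t h1).ne h0
      · rcases lt_or_gt_of_ne hcon.2 with h2 | h2
        · exact (h.pos t h1 h2).ne' h0
        · exact (h.neg_right t h2).ne h0
    · rintro (rfl | rfl)
      · exact h.zero_left
      · exact h.zero_right
  · rw [hA, deriv_const_mul_field]
    exact mul_pos hk h.deriv_left
  · rw [hA, deriv_const_mul_field]
    exact mul_neg_of_pos_of_neg hk h.deriv_right
  · rw [deriv_const_mul_field]
    exact mul_neg_of_pos_of_neg hk (hderiv t)

end IsDensity

end Density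

/-! ### A background density with the prescribed signs and tails. -/

section Background

/-- An admissible density with zeros `a < b`, glued from its two exponential tails and a parabola. -/
noncomputable def background (α p a b t : ℝ) : ℝ :=
  -(Real.exp (2 * t) * Real.smoothTransition (p - t))
    - Real.exp (-α * t) * Real.smoothTransition (t - (Real.log 2 - 1))
    - (t - a) * (t - b) *
      (Real.smoothTransition (t - (p - 1)) * Real.smoothTransition (Real.log 2 - t))

variable {α p a b : ℝ}

theorem contDiff_background : ContDiff ℝ ∞ (background α p a b) := by
  have h : ContDiff ℝ ∞ Real.smoothTransition := Real.smoothTransition.contDiff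
  unfold background
  fun_prop

theorem hasDerivAt_sub_mul {g : ℝ → ℝ} {c : ℝ} (hg : DifferentiableAt ℝ g c) :
    HasDerivAt (fun t => (t - c) * g t) (g c) c := by
  exact (((hasDerivAt_id c).sub_const c).mul hg.hasDerivAt).congr_deriv (by simp)

theorem background_eq {t : ℝ} (hp : p ≤ t) (ht : t ≤ Real.log 2 - 1) :
    background α p a b t = -((t - a) * (t - b) * Real.smoothTransition (Real.log 2 - t)) := by
  rw [background, Real.smoothTransition.zero_of_nonpos (sub_nonpos.2 hp),
    Real.smoothTransition.zero_of_nonpos (sub_nonpos.2 ht),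
    Real.smoothTransition.one_of_one_le (x := t - (p - 1)) (by linarith)]
  ring

theorem isDensity_background (hpa : p < a) (hab : a < b) (hb : b < Real.log 2 - 1) :
    IsDensity α 1 (p - 1) a b (background α p a b) := by
  have hσ := Real.smoothTransition.nonneg
  have hdiff : Differentiable ℝ Real.smoothTransition :=
    (Real.smoothTransition.contDiff (n := 1)).differentiable one_ne_zero
  have hnear : ∀ c, p < c → c < Real.log 2 - 1 → background α p a b =ᶠ[𝓝 c]
      fun t => -((t - a) * (t - b) * Real.smoothTransition (Real.log 2 - t)) := fun c h1 h2 => by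
    filter_upwards [Ioo_mem_nhds h1 h2] with t ht
    exact background_eq ht.1.le ht.2.le
  -- Outside `[a, b]` all three terms are nonpositive, and the supports overlap enough that at least
  -- one is strictly negative.
  have hout : ∀ t, 0 < (t - a) * (t - b) → background α p a b t < 0 := fun t ht => by
    have h1 := mul_nonneg (Real.exp_pos (2 * t)).le (hσ (p - t))
    have h2 := mul_nonneg (Real.exp_pos (-α * t)).le (hσ (t - (Real.log 2 - 1)))
    have h3 := mul_nonneg ht.le (mul_nonneg (hσ (t - (p - 1))) (hσ (Real.log 2 - t)))
    unfold background
    rcases lt_or_ge t p with htp | htp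
    · have := mul_pos (Real.exp_pos (2 * t)) (Real.smoothTransition.pos_of_pos (sub_pos.2 htp))
      linarith
    rcases lt_or_ge t (Real.log 2) with htl | htl
    · have := mul_pos ht (mul_pos (Real.smoothTransition.pos_of_pos
        (by linarith : 0 < t - (p - 1))) (Real.smoothTransition.pos_of_pos (sub_pos.2 htl)))
      linarith
    · have := mul_pos (Real.exp_pos (-α * t)) (Real.smoothTransition.pos_of_pos
        (by linarith : 0 < t - (Real.log 2 - 1)))
      linarith
  refine ⟨contDiff_background, fun t ht => ?_, fun t ht => ?_,
    fun t ht => hout t (mul_pos_of_neg_of_neg (by linarith) (by linarith)), ?_,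
    fun t h1 h2 => ?_, ?_, fun t ht => hout t (mul_pos (by linarith) (by linarith)), ?_, ?_⟩
  · rw [background, Real.smoothTransition.one_of_one_le (by linarith : 1 ≤ p - t),
      Real.smoothTransition.zero_of_nonpos (by linarith : t - (Real.log 2 - 1) ≤ 0),
      Real.smoothTransition.zero_of_nonpos (by linarith : t - (p - 1) ≤ 0)]
    ring
  · rw [background, Real.smoothTransition.zero_of_nonpos (by linarith : p - t ≤ 0),
      Real.smoothTransition.one_of_one_le (by linarith : 1 ≤ t - (Real.log 2 - 1)),
      Real.smoothTransition.zero_of_nonpos (by linarith : Real.log 2 - t ≤ 0)]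
    ring
  · rw [background_eq hpa.le (by linarith)]; ring
  · rw [background_eq (by linarith) (by linarith), neg_pos]
    exact mul_neg_of_neg_of_pos (mul_neg_of_pos_of_neg (by linarith) (by linarith))
      (Real.smoothTransition.pos_of_pos (by linarith))
  · rw [background_eq (by linarith) (by linarith)]; ring
  · rw [(hnear a hpa (by linarith)).deriv_eq]
    have h1 := hasDerivAt_sub_mul (c := a)
      (g := fun t => -((t - b) * Real.smoothTransition (Real.log 2 - t))) (by fun_prop)
    have h2 : (fun t => -((t - a) * (t - b) * Real.smoothTransition (Real.log 2 - t))) =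
        fun t => (t - a) * -((t - b) * Real.smoothTransition (Real.log 2 - t)) := by
      ext t; ring
    rw [h2, h1.deriv, neg_pos]
    exact mul_neg_of_neg_of_pos (by linarith) (Real.smoothTransition.pos_of_pos (by linarith))
  · rw [(hnear b (by linarith) hb).deriv_eq]
    have h1 := hasDerivAt_sub_mul (c := b)
      (g := fun t => -((t - a) * Real.smoothTransition (Real.log 2 - t))) (by fun_prop)
    have h2 : (fun t => -((t - a) * (t - b) * Real.smoothTransition (Real.log 2 - t))) =
        fun t => (t - b) * -((t - a) * Real.smoothTransition (Real.log 2 - t)) := by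
      ext t; ring
    rw [h2, h1.deriv, neg_lt_zero]
    exact mul_pos (by linarith) (Real.smoothTransition.pos_of_pos (by linarith))

end Background

/-! ### Adding narrow bumps that approximate the two point masses. -/

section Bumps

/-- Adding a negative bump left of `a` and a positive bump inside `(a, b)` keeps a density
admissible. -/
theorem IsDensity.add_bumps {α ε M a b c₁ c₂ c₃ : ℝ} {H β₁ β₂ : ℝ → ℝ}
    (h : IsDensity α 1 M a b H) (hε : 0 < ε) (hab : a < b) (hbl : b ≤ Real.log 2)
    (hs₁ : ContDiff ℝ ∞ β₁) (hs₂ : ContDiff ℝ ∞ β₂) (hn₁ : ∀ t, 0 ≤ β₁ t) (hn₂ : ∀ t, 0 ≤ β₂ t)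
    (hMa : M < a) (hc₁ : c₁ < a) (hc₂ : a < c₂) (hc₃ : c₃ < b)
    (hz₁ : ∀ t, t ≤ M ∨ c₁ ≤ t → β₁ t = 0) (hz₂ : ∀ t, t ≤ c₂ ∨ c₃ ≤ t → β₂ t = 0) :
    IsDensity α ε M a b (fun t => ε * H t - β₁ t + 1 / 4 * β₂ t) := by
  have h₁ : ∀ t, c₁ ≤ t → β₁ t = 0 := fun t ht => hz₁ t (.inr ht)
  have h₂ : ∀ t, t ≤ c₂ → β₂ t = 0 := fun t ht => hz₂ t (.inl ht)
  have h₃ : ∀ t, c₃ ≤ t → β₂ t = 0 := fun t ht => hz₂ t (.inr ht)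
  -- The bumps vanish near `a` and near `b`, so the simple zeros and the signs of `A'` there come
  -- from the background.
  have hea : (fun t => ε * H t - β₁ t + 1 / 4 * β₂ t) =ᶠ[𝓝 a] fun t => ε * H t := by
    filter_upwards [Ioo_mem_nhds hc₁ hc₂] with t ht
    rw [h₁ t ht.1.le, h₂ t ht.2.le]; ring
  have heb : (fun t => ε * H t - β₁ t + 1 / 4 * β₂ t) =ᶠ[𝓝 b] fun t => ε * H t := by
    filter_upwards [Ioi_mem_nhds hc₃, Ioi_mem_nhds (hc₁.trans hab)] with t ht ht'
    rw [h₁ t (le_of_lt ht'), h₃ t (le_of_lt ht)]; ring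
  have hH := h.smooth
  refine ⟨by fun_prop, fun t ht => ?_, fun t ht => ?_, fun t ht => ?_, ?_, fun t h1 h2 => ?_, ?_,
    fun t ht => ?_, ?_, ?_⟩
  · simp only [h.left t ht, hz₁ t (.inl ht), h₂ t (by linarith)]; ring
  · simp only [h.right t ht, h₁ t (by linarith), h₃ t (by linarith)]; ring
  · simp only [h₂ t (by linarith)]
    have := mul_neg_of_pos_of_neg hε (h.neg_left t ht)
    linarith [hn₁ t]
  · simp only [h.zero_left, h₁ a hc₁.le, h₂ a hc₂.le]; ring
  · simp only [h₁ t (by linarith)]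
    have := mul_pos hε (h.pos t h1 h2)
    linarith [hn₂ t]
  · simp only [h.zero_right, h₁ b (by linarith), h₃ b hc₃.le]; ring
  · simp only [h₁ t (by linarith), h₃ t (by linarith)]
    have := mul_neg_of_pos_of_neg hε (h.neg_right t ht)
    linarith
  · rw [hea.deriv_eq, deriv_const_mul_field]
    exact mul_pos hε h.deriv_left
  · rw [heb.deriv_eq, deriv_const_mul_field]
    exact mul_neg_of_pos_of_neg hε h.deriv_right

theorem ContDiffBump.normed_eq_zero {c t : ℝ} (φ : ContDiffBump c) (h : φ.rOut ≤ |t - c|) :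
    φ.normed volume t = 0 := by
  by_contra h0
  have h1 : t ∈ Function.support (φ.normed volume) := h0
  rw [φ.support_normed_eq, Metric.mem_ball, Real.dist_eq] at h1
  linarith

/-- A unit mass supported within `rOut` of `c` averages `h` with error at most the Lipschitz
constant times `rOut`. -/
theorem ContDiffBump.norm_integral_normed_mul_sub_le {c K : ℝ} (φ : ContDiffBump c) {h : ℝ → ℂ}
    (hh : BddLip h K) :
    ‖(∫ s, (φ.normed volume s : ℂ) * h s) - h c‖ ≤ φ.rOut * K := by
  have hφ : Integrable (φ.normed volume) := φ.integrable_normed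
  have h1 : Integrable fun s => (φ.normed volume s : ℂ) * h s :=
    hφ.ofReal.mul_bdd (c := K) hh.continuous.aestronglyMeasurable (.of_forall hh.1)
  have h2 : ∫ s, (φ.normed volume s : ℂ) * h c = h c := by
    rw [integral_mul_const, integral_complex_ofReal, φ.integral_normed]; simp
  have h3 : (∫ s, (φ.normed volume s : ℂ) * h s) - h c
      = ∫ s, (φ.normed volume s : ℂ) * (h s - h c) := by
    have h4 : Integrable fun s => (φ.normed volume s : ℂ) * h c := hφ.ofReal.mul_const _
    conv_lhs => rw [← h2]
    rw [← integral_sub h1 h4]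
    simp only [mul_sub]
  rw [h3]
  have h4 : ∫ s, φ.normed volume s * (φ.rOut * K) = φ.rOut * K := by
    rw [integral_mul_const, φ.integral_normed, one_mul]
  rw [← h4]
  refine norm_integral_le_of_norm_le (hφ.mul_const _) (.of_forall fun s => ?_)
  rw [norm_mul, Complex.norm_real, Real.norm_of_nonneg (φ.nonneg_normed s)]
  rcases le_or_gt φ.rOut |s - c| with hs | hs
  · rw [φ.normed_eq_zero hs, zero_mul, zero_mul]
  · refine mul_le_mul_of_nonneg_left ((hh.2 s c).trans ?_) (φ.nonneg_normed s)
    rw [mul_comm]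
    exact mul_le_mul_of_nonneg_right hs.le hh.nonneg

/-- The background contributes at most `ε ∫|H|` to the error and the bumps `ε` and `ε / 4`. The
total mass is at most `1 + 1 + 1/4`. -/
theorem nearDeltas_add_bumps {H : ℝ → ℝ} {t₁ t₂ ε : ℝ} (hH : Continuous H) (hi : Integrable H)
    (hε : 0 < ε) (hm : ε * ∫ s, |H s| ≤ 1) (φ₁ : ContDiffBump t₁) (φ₂ : ContDiffBump t₂)
    (h₁ : φ₁.rOut ≤ ε) (h₂ : φ₂.rOut ≤ ε) :
    NearDeltas (fun t => ε * H t - φ₁.normed volume t + 1 / 4 * φ₂.normed volume t) t₁ t₂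
      (ε * ((∫ s, |H s|) + 2)) := by
  have i₁ : Integrable (φ₁.normed volume) := φ₁.integrable_normed
  have i₂ : Integrable (φ₂.normed volume) := φ₂.integrable_normed
  have c₁ : Continuous (φ₁.normed volume) := φ₁.continuous_normed
  have c₂ : Continuous (φ₂.normed volume) := φ₂.continuous_normed
  refine ⟨by fun_prop, ((hi.const_mul ε).sub i₁).add (i₂.const_mul _), ?_, fun h K hh => ?_⟩
  · calc ∫ s, |ε * H s - φ₁.normed volume s + 1 / 4 * φ₂.normed volume s|
        ≤ ∫ s, (ε * |H s| + φ₁.normed volume s + 1 / 4 * φ₂.normed volume s) := by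
          refine integral_mono_of_nonneg (.of_forall fun _ => abs_nonneg _)
            (((hi.abs.const_mul ε).add i₁).add (i₂.const_mul _)) (.of_forall fun s => ?_)
          have e1 := φ₁.nonneg_normed (μ := volume) s
          have e2 := φ₂.nonneg_normed (μ := volume) s
          have e3 := mul_le_mul_of_nonneg_left (le_abs_self (H s)) hε.le
          have e4 := mul_le_mul_of_nonneg_left (neg_abs_le (H s)) hε.le
          exact abs_le.2 ⟨by linarith, by linarith⟩
      _ = ε * (∫ s, |H s|) + 1 + 1 / 4 * 1 := by
          have i₃ : Integrable fun s => ε * |H s| + φ₁.normed volume s :=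
            (hi.abs.const_mul ε).add i₁
          rw [integral_add i₃ (i₂.const_mul _),
            integral_add (hi.abs.const_mul ε) i₁, integral_const_mul, integral_const_mul,
            φ₁.integral_normed, φ₂.integral_normed]
      _ ≤ 3 := by linarith
  · have hK := hh.nonneg
    have m : ∀ {f : ℝ → ℝ}, Integrable f → Integrable fun s => (f s : ℂ) * h s := fun hf =>
      hf.ofReal.mul_bdd (c := K) hh.continuous.aestronglyMeasurable (.of_forall hh.1)
    have e0 : ‖∫ s, (H s : ℂ) * h s‖ ≤ (∫ s, |H s|) * K := by
      rw [← integral_mul_const]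
      refine norm_integral_le_of_norm_le (hi.abs.mul_const _) (.of_forall fun s => ?_)
      rw [norm_mul, Complex.norm_real, Real.norm_eq_abs]
      exact mul_le_mul_of_nonneg_left (hh.1 s) (abs_nonneg _)
    have e1 := (φ₁.norm_integral_normed_mul_sub_le hh).trans
      (mul_le_mul_of_nonneg_right h₁ hK)
    have e2 := (φ₂.norm_integral_normed_mul_sub_le hh).trans
      (mul_le_mul_of_nonneg_right h₂ hK)
    have hsplit : ∫ s, ((ε * H s - φ₁.normed volume s + 1 / 4 * φ₂.normed volume s : ℝ) : ℂ) * h s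
        = ε * (∫ s, (H s : ℂ) * h s) - (∫ s, (φ₁.normed volume s : ℂ) * h s)
          + 1 / 4 * ∫ s, (φ₂.normed volume s : ℂ) * h s := by
      have i₃ : Integrable fun s => (ε : ℂ) * ((H s : ℂ) * h s) - (φ₁.normed volume s : ℂ) * h s :=
        ((m hi).const_mul _).sub (m i₁)
      rw [← integral_const_mul, ← integral_const_mul, ← integral_sub ((m hi).const_mul _) (m i₁),
        ← integral_add i₃ ((m i₂).const_mul _)]
      refine integral_congr_ae (.of_forall fun s => ?_)
      push_cast
      ring
    rw [hsplit]
    have hre : (ε : ℂ) * (∫ s, (H s : ℂ) * h s) - (∫ s, (φ₁.normed volume s : ℂ) * h s)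
          + 1 / 4 * (∫ s, (φ₂.normed volume s : ℂ) * h s) - (-(h t₁) + 1 / 4 * h t₂)
        = ε * (∫ s, (H s : ℂ) * h s) - ((∫ s, (φ₁.normed volume s : ℂ) * h s) - h t₁)
          + 1 / 4 * ((∫ s, (φ₂.normed volume s : ℂ) * h s) - h t₂) := by ring
    rw [hre]
    refine (norm_add_le_of_le (norm_sub_le _ _) le_rfl).trans ?_
    rw [norm_mul, norm_mul, Complex.norm_real, Real.norm_of_nonneg hε.le]
    have e3 : ‖(1 / 4 : ℂ)‖ = 1 / 4 := by norm_num
    rw [e3]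
    have e4 := mul_le_mul_of_nonneg_left e0 hε.le
    have e5 := mul_nonneg hε.le hK
    linarith

end Bumps

/-! ### Choice of parameters and conclusion. -/

section Main

/-- To the right of `t₂` the model velocity is `e^{-2(t - t₂)} / 16 > 0`. Up to the small tail of
`A` beyond `b`, the velocity at `b` equals `-e^{-2b} / 2` times the circulation, which must then be
negative. -/
theorem circulation_neg_of_nearDeltas {A : ℝ → ℝ} {t₁ t₂ η μ b : ℝ} (h12 : t₁ ≤ t₂) (hb : t₂ ≤ b)
    (hd : Real.exp (-2 * (t₂ - t₁)) = 3 / 8) (hA : NearDeltas A t₁ t₂ η)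
    (hμ : -μ ≤ ∫ s in Set.Ioi b, A s) (hsmall : 2 * η + μ < Real.exp (-2 * (b - t₂)) / 8) :
    circulation A b < 0 := by
  have h1 := abs_le.1 (abs_velocityOf_sub_le hA b)
  rw [velocityOf_eq hA.integrable] at h1
  have h2 : patchVelocity t₁ t₂ b = Real.exp (-2 * (b - t₂)) / 16 := by
    rw [patchVelocity, max_eq_left (by linarith), max_eq_left (by linarith)]
    have : Real.exp (-2 * (b - t₁)) = Real.exp (-2 * (b - t₂)) * (3 / 8) := by
      rw [← hd, ← Real.exp_add]; ring_nf
    rw [this]; ring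
  rw [h2] at h1
  have h3 : Real.exp (-2 * b) * circulation A b < 0 := by linarith [h1.1]
  exact (pos_iff_neg_of_mul_neg h3).1 (Real.exp_pos _)

/-- An admissible density close to the two-interface vortex. -/
theorem exists_isDensity_nearDeltas (α : ℝ) (hα : 0 < α) :
    ∃ t₁ t₂ a b M : ℝ, t₁ ≤ t₂ ∧ Real.exp (-2 * (t₂ - t₁)) = 3 / 8 ∧ M < a ∧ a < b ∧ M ≤ 0 ∧
      ∀ η₀ > 0, ∃ ε η A, 0 < ε ∧ η ≤ η₀ ∧ IsDensity α ε M a b A ∧ NearDeltas A t₁ t₂ η ∧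
        circulation A b < 0 := by
  -- The interface distance solving `e^{-2d} = 3/8`. The interfaces sit at `-2 - d` and `-2`, the
  -- zero `a` lies midway between them, and `b = -1` lies left of the right tail.
  set d : ℝ := Real.log (8 / 3) / 2 with hd
  have hd0 : 0 < d := div_pos (Real.log_pos (by norm_num)) two_pos
  have hl : 0 < Real.log 2 := Real.log_pos (by norm_num)
  have hexp : Real.exp (-2 * (-2 - (-2 - d))) = 3 / 8 := by
    have : -2 * (-2 - (-2 - d)) = -Real.log (8 / 3) := by rw [hd]; ring
    rw [this, Real.exp_neg, Real.exp_log (by norm_num)]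
    norm_num
  refine ⟨-2 - d, -2, -2 - d / 2, -1, -2 - d - 1, by linarith, hexp, by linarith, by linarith,
    by linarith, fun η₀ hη₀ => ?_⟩
  set H := background α (-2 - d) (-2 - d / 2) (-1)
  have hH : IsDensity α 1 (-2 - d - 1) (-2 - d / 2) (-1) H :=
    isDensity_background (by linarith) (by linarith) (by linarith)
  have hi : Integrable H := hH.integrable hα
  set N : ℝ := ∫ s, |H s| with hN
  have hN0 : 0 ≤ N := integral_nonneg fun _ => abs_nonneg _
  -- The four constraints: total mass, closeness `η₀`, bumps too narrow to reach `a` or each other,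
  -- and negative circulation, where `2κ + ε N < 3κ ≤ e^{-2} / 8`.
  set κ : ℝ := min (min 1 η₀) (min (d / 4) (Real.exp (-2) / 24)) with hκ
  have hκ0 : 0 < κ := by
    have := Real.exp_pos (-2)
    positivity
  have k1 : κ ≤ 1 := (min_le_left _ _).trans (min_le_left _ _)
  have k2 : κ ≤ η₀ := (min_le_left _ _).trans (min_le_right _ _)
  have k3 : κ ≤ d / 4 := (min_le_right _ _).trans (min_le_left _ _)
  have k4 : κ ≤ Real.exp (-2) / 24 := (min_le_right _ _).trans (min_le_right _ _)
  set ε : ℝ := κ / (N + 2) with hεd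
  have hε : 0 < ε := by positivity
  have hεN : ε * (N + 2) = κ := by rw [hεd]; field_simp
  have hεN0 : 0 ≤ ε * N := by positivity
  let φ₁ : ContDiffBump (-2 - d) := ⟨ε / 2, ε, by positivity, by linarith⟩
  let φ₂ : ContDiffBump (-2 : ℝ) := ⟨ε / 2, ε, by positivity, by linarith⟩
  have hnear := nearDeltas_add_bumps hH.continuous hi hε (by linarith) φ₁ φ₂ le_rfl le_rfl
  rw [← hN, hεN] at hnear
  refine ⟨ε, κ, _, hε, k2, ?_, hnear, ?_⟩
  · refine hH.add_bumps (c₁ := -2 - d + ε) (c₂ := -2 - ε) (c₃ := -2 + ε) hε (by linarith)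
      (by linarith) φ₁.contDiff_normed φ₂.contDiff_normed φ₁.nonneg_normed φ₂.nonneg_normed
      (by linarith) (by linarith) (by linarith) (by linarith) (fun t ht => ?_) fun t ht => ?_
    · refine φ₁.normed_eq_zero (le_abs.2 ?_)
      change ε ≤ _ ∨ ε ≤ _
      rcases ht with ht | ht
      · right; linarith
      · left; linarith
    · refine φ₂.normed_eq_zero (le_abs.2 ?_)
      change ε ≤ _ ∨ ε ≤ _
      rcases ht with ht | ht
      · right; linarith
      · left; linarith
  · refine circulation_neg_of_nearDeltas (μ := ε * N) (by linarith) (by norm_num) hexp hnear ?_ ?_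
    · have h1 : ∫ s in Set.Ioi (-1 : ℝ), (ε * H s - φ₁.normed volume s + 1 / 4 * φ₂.normed volume s)
          = ε * ∫ s in Set.Ioi (-1 : ℝ), H s := by
        rw [← integral_const_mul]
        refine setIntegral_congr_fun measurableSet_Ioi fun s hs => ?_
        have hs' : -1 < s := hs
        have e1 : φ₁.normed volume s = 0 := φ₁.normed_eq_zero (le_abs.2 (.inl (by
          change ε ≤ _; linarith)))
        have e2 : φ₂.normed volume s = 0 := φ₂.normed_eq_zero (le_abs.2 (.inl (by
          change ε ≤ _; linarith)))
        simp only [e1, e2]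
        ring
      rw [h1]
      have h2 : |∫ s in Set.Ioi (-1 : ℝ), H s| ≤ N :=
        (abs_integral_le_integral_abs).trans
          (setIntegral_le_integral hi.abs (.of_forall fun _ => abs_nonneg _))
      have := mul_le_mul_of_nonneg_left (neg_le_of_abs_le h2) hε.le
      linarith
    · have : Real.exp (-2 * (-1 - -2)) = Real.exp (-2) := by norm_num
      rw [this]
      linarith

theorem finite_unstableSet_velocityOf {α ε M a b : ℝ} {A : ℝ → ℝ} (h : IsDensity α ε M a b A)
    (hα : 0 < α) (hε : 0 < ε) (hM : M ≤ 0) (hMa : M < a) (hab : a < b)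
    (hb : circulation A b < 0) {m : ℝ} (hm : 0 < m) :
    (unstableSet (fun t => α / ε * velocityOf A t) m).Finite := by
  have hi := h.integrable hα
  have hc := h.continuous
  have hk : 0 < α / ε := div_pos hα hε
  have hd : Differentiable ℝ (velocityOf A) := fun t =>
    (hasDerivAt_velocityOf hc hi t).differentiableAt
  obtain ⟨C, hC⟩ := h.exists_abs_le_exp hα hM
  have hA : rayleighA (fun t => α / ε * velocityOf A t) = fun t => α / ε * A t := by
    rw [rayleighA_const_mul, rayleighA_velocityOf hc hi]
  obtain ⟨ρ, hρ, ⟨R, hR⟩, hAρ⟩ := exists_weight (Ξ := fun t => α / ε * velocityOf A t)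
    (A := fun t => α / ε * A t) (a := a) (b := b) (D := α / ε * C) (hd.const_mul _)
    (fun t => by
      rw [deriv_const_mul_field, deriv_velocityOf hc hi]
      exact mul_neg_of_pos_of_neg hk (mul_neg_of_pos_of_neg (Real.exp_pos _)
        (h.circulation_neg hα hε hMa hab hb t)))
    ((h.smooth.differentiable (by simp)).const_mul _) (hi.const_mul _)
    (fun t => by
      rw [abs_mul, abs_of_pos hk]
      exact mul_le_mul_of_nonneg_left (hC t).2 hk.le) hab
    (by simp [h.zero_left]) (by simp [h.zero_right])
    (fun t ht => mul_nonpos_of_nonneg_of_nonpos hk.le (h.neg_left t ht).le)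
    (fun t h1 h2 => mul_nonneg hk.le (h.pos t h1 h2).le)
    (fun t ht => mul_nonpos_of_nonneg_of_nonpos hk.le (h.neg_right t ht).le)
  refine finite_unstableSet (hd.const_mul _).continuous (B := α / ε * ∫ r, |A r|) (fun t => ?_)
    hR hρ _ _ (fun t => by rw [hA]; exact hAρ t) hm
  rw [abs_mul, abs_of_pos hk]
  exact mul_le_mul_of_nonneg_left (abs_velocityOf_le hi t) hk.le

end Main

theorem theorem4p7 (α : ℝ) (hα0 : 0 < α) (hα1 : α < 1) :
    ∃ Ξ : ℝ → ℝ, ClassC α Ξ ∧ ∃ m₀ : ℕ, 2 ≤ m₀ ∧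
      (unstableSet Ξ (m₀ : ℝ)).Finite ∧ (unstableSet Ξ (m₀ : ℝ)).Nonempty := by
  obtain ⟨t₁, t₂, a, b, M, h12, hd, hMa, hab, hM, hex⟩ := exists_isDensity_nearDeltas α hα0
  obtain ⟨η₀, hη₀, hjost⟩ := exists_jost_zero h12 hd
  obtain ⟨ε, η, A, hε, hη, hA, hnear, hb⟩ := hex η₀ hη₀
  have hi := hA.integrable hα0
  have hc := hA.continuous
  have hV := continuous_velocityOf hc hi
  obtain ⟨z, v, hz, hv, ⟨B, hB⟩, hvol, hF⟩ :=
    hjost η hη A hnear hV ⟨_, abs_velocityOf_le hi⟩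
  obtain ⟨C, hC⟩ := hA.exists_abs_le_exp hα0 hM
  have hR := rayleighA_velocityOf hc hi
  refine ⟨fun t => α / ε * velocityOf A t, hA.classC hα0 hα1 hε hMa hab hb, 2, le_rfl, ?_, ?_⟩
  · exact finite_unstableSet_velocityOf hA hα0 hε hM hMa hab hb (by norm_num)
  · rw [Nat.cast_ofNat]
    -- The Jost zero belongs to the unscaled profile; multiplying it by `α / ε` gives an unstable
    -- parameter of `Ξ`.
    exact ⟨_, mul_mem_unstableSet (div_pos hα0 hε)
      (mem_unstableSet_of_jost hV (by rwa [hR]) (by rwa [hR])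
        (fun s => by rw [hR]; exact (hC s).1) hz hv hB (by rwa [hR]) (by rwa [hR]))⟩
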